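/- **Setting.** Let $d\ge 1$ be an integer, $a\in\mathbb R$, $\gamma>-\min(2,d)$, $\alpha>1+\frac{2+\gamma}{d}$, and $\frac1{q_c}:=\frac{2+\gamma}{d(\alpha-1)}$. Functions and distributions are real- or complex-valued. For $t>0$ put $G_t(x)=(4\pi t)^{-d/2}e^{-|x|^2/(4t)}$; $e^{t\Delta}f(x)=\int G_t(x-y)f(y)\,dy$ for functions and $e^{t\Delta}\varphi(x)=\langle \varphi,G_t(x-\cdot)\rangle$ for $\varphi\in\mathcal S'(\mathbb R^d)$. For $k\in\mathbb R$, $p\in[1,\infty]$ let $\|f\|_{L^{p,\infty}_k}=\sup_{s>0}s^{1/p}(|\cdot|^kf)^*(s)$, where $^*$ is the decreasing rearrangement and $1/\infty=0$. Consider the integral equation $$u(t)=e^{t\Delta}\varphi+a\int_0^t e^{(t-\tau)\Delta}\{|\cdot|^\gamma|u(\tau)|^{\alpha-1}u(\tau)\}\,d\tau,\qquad t>0, \text{ a.e. in } x, \tag{1}$$ of the Hardy–Hénon parabolic equation $\partial_tu-\Delta u=a|x|^\gamma|u|^{\alpha-1}u$, $u(0)=\varphi$. A global solution is a measurable $u$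 on $(0,\infty)\times\mathbb R^d$ satisfying (1), with absolutely convergent integral. Let $l\in\mathbb R$, $q\in[1,\infty]$ satisfy $\frac ld+\frac1q=\frac1{q_c}$ and $\frac{\gamma}{\alpha-1}\le l$. Let $k\in\mathbb R$, $p\in[1,\infty]$ satisfy $\alpha<p$, $\frac{l+\gamma}{\alpha}\le k\le l$, $0\le\frac kd+\frac1p$ and $$\frac{2+\gamma\alpha}{d\alpha(\alpha-1)}<\frac kd+\frac1p<\min\Big\{\frac1{q_c},\frac{d+\gamma}{d\alpha}\Big\}.$$ Put $\|u\|_{\mathcal K^p_k}=\sup_{t>0}t^{\frac d2(\frac1{q_c}-\frac kd-\frac1p)}\|u(t)\|_{L^{p,\infty}_k}$. Let $\frac{2+\gamma}{\alpha-1}\le\sigma<d$ and $\Phi_\sigma(x)=\omega(x)|x|^{-\sigma}$, where $\omega\in L^\infty(\mathbb R^d)$ is homogeneous of degree $0$. For $\varphi\in\mathcal S'(\mathbb R^d)$ and $C,\delta>0$ consider the condition $$\|e^{t\Delta}\varphi\|_{L^{p,\infty}_k}\le Ct^{-\frac d2(\frac\sigma d-\frac kd-\frac1p)},\qquad \|e^{t\Delta}(\varphi-\Phi_\sigma)\|_{L^{p,\infty}_k}\le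 Ct^{-\frac d2(\frac\sigma d-\frac kd-\frac1p)-\delta}\qquad(t>0).\tag{2}$$ Call $(\tilde k,\tilde p)\in\mathbb R\times[1,\infty]$ admissible if $\tilde k\le k$, $p\le\tilde p$ and $0\le\frac{\tilde k}d+\frac1{\tilde p}$. **(i) Nonlinear behavior.** Let $\sigma=\frac{2+\gamma}{\alpha-1}$ and let $\delta_0>0$ satisfy $\frac{d\alpha}2\big(\frac1{q_c}-\frac kd-\frac1p\big)+\delta_0<1$. There are $\rho,M>0$, depending only on $\delta_0$ and on the parameters $d,a,\gamma,\alpha,l,q,k,p$ (and the scalar field), such that for all $\varphi$ and $\omega$ with $\|e^{t\Delta}\varphi\|_{\mathcal K^p_k}\le\rho$ and $\|\omega\|_{L^\infty}\le\rho$: equation (1) has exactly one global solution $u$ with $\|u\|_{\mathcal K^p_k}\le M$; equation (1) with $\Phi_\sigma$ in place of $\varphi$ has exactly one global solution $u_{\mathcal S}$ with $\|u_{\mathcal S}\|_{\mathcal K^p_k}\le M$; and $u_{\mathcal S}$ is self-similar, that is, $\lambda^{\frac{2+\gamma}{\alpha-1}}u_{\mathcal S}(\lambda^2t,\lambda x)=u_{\mathcal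 S}(t,x)$ for all $\lambda>0$. If moreover (2) holds for some $C,\delta>0$, then for every $\delta'\in(0,\min(\delta,\delta_0)]$ there is a constant $C'>0$ such that $$\|u(t)-u_{\mathcal S}(t)\|_{L^{\tilde p,\infty}_{\tilde k}}\le C't^{-\frac d2(\frac1{q_c}-\frac{\tilde k}d-\frac1{\tilde p})-\delta'},\qquad \|t^{\frac{2+\gamma}{2(\alpha-1)}}u(t,\sqrt t\,\cdot)-u_{\mathcal S}(1,\cdot)\|_{L^{\tilde p,\infty}_{\tilde k}}\le C't^{-\delta'}$$ for all $t>0$ and all admissible $(\tilde k,\tilde p)$. If in addition $\omega$ is not almost everywhere zero, there are $\tilde C,T>0$ with $$\tilde C^{-1}t^{-\frac d2(\frac1{q_c}-\frac{\tilde k}d-\frac1{\tilde p})}\le\|u(t)\|_{L^{\tilde p,\infty}_{\tilde k}}\le\tilde Ct^{-\frac d2(\frac1{q_c}-\frac{\tilde k}d-\frac1{\tilde p})}$$ for all $t\ge T$ and all admissible $(\tilde k,\tilde p)$. **(ii) Linear behavior.** Let $\sigma>\frac{2+\gamma}{\alpha-1}$ and $\frac{\sigma+\gamma}{d\alpha}<\frac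 kd+\frac1p$. There are $\rho,M>0$, depending only on the parameters $d,a,\gamma,\alpha,l,q,k,p,\sigma$ (and the scalar field), such that for all $\varphi$ and $\omega$ with $\|e^{t\Delta}\varphi\|_{\mathcal K^p_k}\le\rho$ and $\|\omega\|_{L^\infty}\le\rho$, equation (1) has exactly one global solution $u$ with $\|u\|_{\mathcal K^p_k}\le M$. If moreover (2) holds for some $C,\delta>0$, then for every $\delta'\in(0,\delta]$ with $$\delta'\le\tfrac{\alpha-1}2\Big(\sigma-\tfrac{2+\gamma}{\alpha-1}\Big)\quad\text{and}\quad\delta'<\tfrac{d\alpha}2\Big(\tfrac kd+\tfrac1p\Big)-\tfrac{\sigma+\gamma}2$$ there is a constant $C'>0$ such that $$\|u(t)-e^{t\Delta}\Phi_\sigma\|_{L^{\tilde p,\infty}_{\tilde k}}\le C't^{-\frac d2(\frac\sigma d-\frac{\tilde k}d-\frac1{\tilde p})-\delta'},\qquad \|t^{\frac\sigma2}u(t,\sqrt t\,\cdot)-e^{\Delta}\Phi_\sigma\|_{L^{\tilde p,\infty}_{\tilde k}}\le C't^{-\delta'}$$ for all $t>0$ and all admissible $(\tilde k,\tilde p)$.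 If in addition $\omega$ is not almost everywhere zero, there are $\tilde C,T>0$ with $$\tilde C^{-1}t^{-\frac d2(\frac\sigma d-\frac{\tilde k}d-\frac1{\tilde p})}\le\|u(t)\|_{L^{\tilde p,\infty}_{\tilde k}}\le\tilde Ct^{-\frac d2(\frac\sigma d-\frac{\tilde k}d-\frac1{\tilde p})}$$ for all $t\ge T$ and all admissible $(\tilde k,\tilde p)$. -/

import Mathlib

open MeasureTheory Set Filter Topology
open scoped ENNReal SchwartzMap

noncomputable section

/-- The Euclidean space `ℝ^d`. -/
abbrev Rd (d : ℕ) : Type := EuclideanSpace ℝ (Fin d)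

/-! ### Exponents -/

/-- `1/p` for an exponent `p ∈ [1,∞]`, with `1/∞ = 0`. -/
def recip (p : ℝ≥0∞) : ℝ := (p⁻¹).toReal

/-- The Fujita exponent `α_F(γ) = 1 + (2+γ)/d`. -/
def fujitaExponent (d : ℕ) (γ : ℝ) : ℝ := 1 + (2 + γ) / d

/-- The reciprocal `1/q_c(γ) = (2+γ)/(d(α-1))` of the critical exponent. -/
def recipCrit (d : ℕ) (γ α : ℝ) : ℝ := (2 + γ) / (d * (α - 1))

/-- The conditions on the exponents `(k,p)` of the auxiliary space, for the weight `l` of the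
critical space. -/
structure AuxPair (d : ℕ) (γ α l k : ℝ) (p : ℝ≥0∞) : Prop where
  one_le : 1 ≤ p
  lt_p : ENNReal.ofReal α < p
  le_k : (l + γ) / α ≤ k
  k_le : k ≤ l
  nonneg : 0 ≤ k / d + recip p
  lower : (2 + γ * α) / (d * α * (α - 1)) < k / d + recip p
  upper : k / d + recip p < min (recipCrit d γ α) ((d + γ) / (d * α))

/-- The conditions on the pairs `(k', p')` in which the asymptotics are measured:
`k' ≤ k`, `p ≤ p'` and `0 ≤ k'/d + 1/p'`. -/
def TargetPair (d : ℕ) (k : ℝ) (p : ℝ≥0∞) (k' : ℝ) (p' : ℝ≥0∞) : Prop :=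
  k' ≤ k ∧ p ≤ p' ∧ 0 ≤ k' / d + recip p'

/-- The exponent `(d/2)(s - k/d - 1/p)` that governs the decay of an `L^{p,∞}_k` norm. -/
def decayExp (d : ℕ) (s k : ℝ) (p : ℝ≥0∞) : ℝ := d / 2 * (s - k / d - recip p)

/-! ### Weighted weak Lebesgue spaces -/

section Lorentz

variable {𝕜 : Type*} [RCLike 𝕜] {d : ℕ}

/-- The distribution function `d_f(λ) = |{x : |f(x)| > λ}|`. -/
def distribFun (f : Rd d → 𝕜) (lam : ℝ≥0∞) : ℝ≥0∞ := volume {x | lam < ‖f x‖ₑ}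

/-- The decreasing rearrangement `f^*(t) = inf {λ > 0 : d_f(λ) ≤ t}`. -/
def rearrangement (f : Rd d → 𝕜) (t : ℝ≥0∞) : ℝ≥0∞ :=
  sInf {lam | 0 < lam ∧ distribFun f lam ≤ t}

/-- The quasi-norm `sup_{t>0} t^{1/p} f^*(t)` of `L^{p,∞}(ℝ^d)`. -/
def weakNorm (p : ℝ≥0∞) (f : Rd d → 𝕜) : ℝ≥0∞ :=
  ⨆ (t : ℝ) (_ : 0 < t), ENNReal.ofReal (t ^ recip p) * rearrangement f (ENNReal.ofReal t)

/-- The quasi-norm `‖ |x|^k f ‖_{L^{p,∞}}` of the weighted space `L^{p,∞}_k(ℝ^d)`. -/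
def wNorm (k : ℝ) (p : ℝ≥0∞) (f : Rd d → 𝕜) : ℝ≥0∞ :=
  weakNorm p (fun x => (‖x‖ ^ k) • f x)

/-- The norm `sup_{t>0} t^{(d/2)(l/d+1/q-k/d-1/p)} ‖u(t)‖_{L^{p,∞}_k}` of the auxiliary
space `𝒦^p_k` (on the whole half line of times). -/
def auxNorm (l : ℝ) (q : ℝ≥0∞) (k : ℝ) (p : ℝ≥0∞) (u : ℝ → Rd d → 𝕜) : ℝ≥0∞ :=
  ⨆ (t : ℝ) (_ : 0 < t),
    ENNReal.ofReal (t ^ decayExp d (l / d + recip q) k p) * wNorm k p (u t)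

end Lorentz

/-! ### The heat semigroup -/

/-- The Gauss kernel `G_t(x) = (4πt)^{-d/2} e^{-|x|²/(4t)}`. -/
def gaussKernel {d : ℕ} (t : ℝ) (x : Rd d) : ℝ :=
  (4 * Real.pi * t) ^ (-(d : ℝ) / 2) * Real.exp (-‖x‖ ^ 2 / (4 * t))

theorem contDiff_gauss (d : ℕ) (b : ℝ) (n : WithTop ℕ∞) :
    ContDiff ℝ n (fun x : Rd d => Real.exp (-b * ‖x‖ ^ 2)) :=
  Real.contDiff_exp.comp (contDiff_const.mul (contDiff_norm_sq ℝ))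

theorem pow_mul_exp_neg_sq_bounded {b : ℝ} (hb : 0 < b) (m : ℕ) :
    ∃ C : ℝ, ∀ r : ℝ, 0 ≤ r → (1 + r) ^ m * Real.exp (-b * r ^ 2) ≤ C := by
  refine ⟨Real.exp (m + m ^ 2 / (4 * b)), fun r hr => ?_⟩
  have h1 : (1 + r) ^ m ≤ Real.exp (m * r) := by
    rw [Real.exp_nat_mul]
    gcongr
    linarith [Real.add_one_le_exp r]
  calc (1 + r) ^ m * Real.exp (-b * r ^ 2)
      ≤ Real.exp (m * r) * Real.exp (-b * r ^ 2) := by gcongr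
    _ = Real.exp (m * r + -b * r ^ 2) := (Real.exp_add _ _).symm
    _ ≤ Real.exp (m + m ^ 2 / (4 * b)) := by
      apply Real.exp_le_exp.2
      have h2 : (m : ℝ) * r + -b * r ^ 2 = m ^ 2 / (4 * b) - (2 * b * r - m) ^ 2 / (4 * b) := by
        field_simp
        ring
      have h3 : 0 ≤ (2 * b * r - m) ^ 2 / (4 * b) := by positivity
      have h4 : (0 : ℝ) ≤ m := by positivity
      linarith

/-- The Gaussian `e^{-b|x|²}`, `b > 0`, as a Schwartz function. -/
def gaussSchwartz (d : ℕ) {b : ℝ} (hb : 0 < b) : 𝓢(Rd d, ℝ) where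
  toFun x := Real.exp (-b * ‖x‖ ^ 2)
  smooth' := contDiff_gauss d b _
  decay' := by
    intro m n
    have htg : Function.HasTemperateGrowth (fun x : Rd d => -b * ‖x‖ ^ 2) :=
      (Function.HasTemperateGrowth.const (-b)).mul (Function.hasTemperateGrowth_norm_sq (Rd d))
    obtain ⟨K, C, hC, hD⟩ := htg.norm_iteratedFDeriv_le_uniform n
    obtain ⟨B, hB⟩ := pow_mul_exp_neg_sq_bounded hb (m + K * n)
    refine ⟨(n.factorial : ℝ) * (1 + C) ^ n * B, fun x => ?_⟩
    have hx : (1 : ℝ) ≤ 1 + ‖x‖ := by linarith [norm_nonneg x]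
    have hD1 : (1 : ℝ) ≤ (1 + C) * (1 + ‖x‖) ^ K :=
      one_le_mul_of_one_le_of_one_le (by linarith) (one_le_pow₀ hx)
    have key := norm_iteratedFDeriv_comp_le (𝕜 := ℝ) (g := Real.exp)
      (f := fun x : Rd d => -b * ‖x‖ ^ 2) (n := n) (N := ⊤)
      Real.contDiff_exp (contDiff_const.mul (contDiff_norm_sq ℝ)) le_top x
      (C := Real.exp (-b * ‖x‖ ^ 2)) (D := (1 + C) * (1 + ‖x‖) ^ K)
      (fun i _ => by
        rw [norm_iteratedFDeriv_eq_norm_iteratedDeriv, iteratedDeriv_eq_iterate,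
          Real.iter_deriv_exp]
        simp)
      (fun i hi hin => (hD i hin x).trans <| by
        calc C * (1 + ‖x‖) ^ K ≤ (1 + C) * (1 + ‖x‖) ^ K := by gcongr; linarith
          _ ≤ ((1 + C) * (1 + ‖x‖) ^ K) ^ i := le_self_pow₀ hD1 (by omega))
    calc ‖x‖ ^ m * ‖iteratedFDeriv ℝ n (fun x : Rd d => Real.exp (-b * ‖x‖ ^ 2)) x‖
        ≤ (1 + ‖x‖) ^ m *
          ((n.factorial : ℝ) * Real.exp (-b * ‖x‖ ^ 2) * ((1 + C) * (1 + ‖x‖) ^ K) ^ n) := by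
          gcongr
          · linarith
          · exact key
      _ = (n.factorial : ℝ) * (1 + C) ^ n * ((1 + ‖x‖) ^ (m + K * n) * Real.exp (-b * ‖x‖ ^ 2)) := by
          rw [mul_pow, ← pow_mul, pow_add]; ring
      _ ≤ (n.factorial : ℝ) * (1 + C) ^ n * B := by
          gcongr
          exact hB _ (norm_nonneg x)

section Heat

variable {𝕜 : Type*} [RCLike 𝕜] {d : ℕ}

/-- The Schwartz function `y ↦ G_t(x - y)` for `t > 0`. -/
def heatTest (𝕜 : Type*) [RCLike 𝕜] {t : ℝ} (ht : 0 < t) (x : Rd d) : 𝓢(Rd d, 𝕜) :=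
  (((4 * Real.pi * t) ^ (-(d : ℝ) / 2) : ℝ) : 𝕜) •
    SchwartzMap.compSubConstCLM 𝕜 x
      (SchwartzMap.postcompCLM (𝕜 := ℝ) (RCLike.ofRealCLM (K := 𝕜))
        (gaussSchwartz d (b := 1 / (4 * t)) (by positivity)))

theorem heatTest_apply {t : ℝ} (ht : 0 < t) (x y : Rd d) :
    heatTest 𝕜 ht x y = ((gaussKernel t (x - y) : ℝ) : 𝕜) := by
  have h : gaussSchwartz d (b := 1 / (4 * t)) (by positivity) (y - x)
      = Real.exp (-‖x - y‖ ^ 2 / (4 * t)) := by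
    change Real.exp (-(1 / (4 * t)) * ‖y - x‖ ^ 2) = _
    rw [norm_sub_rev y x]
    congr 1
    ring
  simp only [heatTest, gaussKernel, smul_apply, SchwartzMap.compSubConstCLM_apply,
    SchwartzMap.postcompCLM_apply, h]
  simp

/-- The heat semigroup on a tempered distribution `φ`: `(e^{tΔ}φ)(x) = ⟨φ, G_t(x - ·)⟩` for
`t > 0` (the value for `t ≤ 0` is a convention and is never used). -/
def heatDist (φ : 𝓢(Rd d, 𝕜) →L[𝕜] 𝕜) (t : ℝ) (x : Rd d) : 𝕜 :=
  if ht : 0 < t then φ (heatTest 𝕜 ht x) else 0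

/-- The heat semigroup on a function: `(e^{tΔ}f)(x) = ∫ G_t(x-y) f(y) dy`. -/
def heatFun (f : Rd d → 𝕜) (t : ℝ) (x : Rd d) : 𝕜 :=
  ∫ y, gaussKernel t (x - y) • f y

/-! ### Solutions -/

/-- The nonlinear term `|x|^γ |v|^{α-1} v`. -/
def nonlin (γ α : ℝ) (v : Rd d → 𝕜) (x : Rd d) : 𝕜 :=
  (‖x‖ ^ γ * ‖v x‖ ^ (α - 1)) • v x

/-- `u`, defined for positive times, is measurable and solves the integral equation
`u(t) = U(t) + a ∫_0^t e^{(t-τ)Δ} {|·|^γ |u(τ)|^{α-1} u(τ)} dτ` for every `t > 0`, almost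
everywhere in `x`, the integral being absolutely convergent. Here `U(t)` is the free evolution
`e^{tΔ}φ` of the initial datum `φ`. -/
structure IsGlobalSolution (a γ α : ℝ) (U u : ℝ → Rd d → 𝕜) : Prop where
  measurable : AEStronglyMeasurable (Function.uncurry u)
    ((volume.restrict (Ioi (0 : ℝ))).prod volume)
  measurable_slice : ∀ t, 0 < t → AEStronglyMeasurable (u t) volume
  integrable : ∀ t, 0 < t → ∀ᵐ x : Rd d,
    Integrable (fun z : ℝ × Rd d => gaussKernel (t - z.1) (x - z.2) • nonlin γ α (u z.1) z.2)
      ((volume.restrict (Ioo 0 t)).prod volume)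
  equation : ∀ t, 0 < t → ∀ᵐ x : Rd d,
    u t x = U t x + a • ∫ τ in Ioo 0 t, heatFun (nonlin γ α (u τ)) (t - τ) x

/-- `u` is the global solution with free evolution `U` that is constructed by the contraction
principle in the ball of radius `M` of the auxiliary space `𝒦^p_k`: it is a solution in this ball,
and it is the only one, up to null sets. -/
structure IsConstructedSolution (a γ α l : ℝ) (q : ℝ≥0∞) (k : ℝ) (p : ℝ≥0∞) (M : ℝ)
    (U u : ℝ → Rd d → 𝕜) : Prop where
  solution : IsGlobalSolution a γ α U u
  norm_le : auxNorm l q k p u ≤ ENNReal.ofReal M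
  unique : ∀ v : ℝ → Rd d → 𝕜, IsGlobalSolution a γ α U v →
    auxNorm l q k p v ≤ ENNReal.ofReal M → ∀ t, 0 < t → v t =ᵐ[volume] u t

/-- Self-similarity: `λ^{(2+γ)/(α-1)} u(λ² t, λ x) = u(t,x)` for all `λ > 0`. -/
def IsSelfSimilar (γ α : ℝ) (u : ℝ → Rd d → 𝕜) : Prop :=
  ∀ lam : ℝ, 0 < lam → ∀ t, 0 < t → ∀ᵐ x : Rd d,
    (lam ^ ((2 + γ) / (α - 1))) • u (lam ^ 2 * t) (lam • x) = u t x

/-! ### Data and conclusions -/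

/-- `ω` is a measurable function, (essentially) homogeneous of degree `0`. -/
def IsHomogeneousZero (ω : Rd d → 𝕜) : Prop :=
  AEStronglyMeasurable ω volume ∧
    ∀ lam : ℝ, 0 < lam → ∀ᵐ x : Rd d, ω (lam • x) = ω x

/-- The homogeneous profile `Φ_σ(x) = ω(x) |x|^{-σ}`. -/
def profile (ω : Rd d → 𝕜) (σ : ℝ) (x : Rd d) : 𝕜 := (‖x‖ ^ (-σ)) • ω x

/-- The decay conditions on the datum `φ` and on its difference to `Φ_σ`. -/
def DecayCondition (σ k : ℝ) (p : ℝ≥0∞) (φ : 𝓢(Rd d, 𝕜) →L[𝕜] 𝕜) (ω : Rd d → 𝕜)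
    (C δ : ℝ) : Prop :=
  ∀ t, 0 < t →
    wNorm k p (heatDist φ t) ≤ ENNReal.ofReal (C * t ^ (-decayExp d (σ / d) k p)) ∧
    wNorm k p (fun x => heatDist φ t x - heatFun (profile ω σ) t x) ≤
      ENNReal.ofReal (C * t ^ (-decayExp d (σ / d) k p - δ))

/-- `u` is asymptotic to `v`, with a gain `t^{-δ}` over the rate `t^{-(d/2)(σ/d-k'/d-1/p')}`, in
`L^{p',∞}_{k'}` for all target pairs `(k',p')`, and the rescaled solution `t^{σ/2} u(t, √t ·)`
converges to `v(1)` at the rate `t^{-δ}`. -/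
def AsymptoticTo (σ δ k : ℝ) (p : ℝ≥0∞) (u v : ℝ → Rd d → 𝕜) : Prop :=
  ∃ C : ℝ, 0 < C ∧ ∀ t, 0 < t → ∀ (k' : ℝ) (p' : ℝ≥0∞), TargetPair d k p k' p' →
    wNorm k' p' (fun x => u t x - v t x) ≤
      ENNReal.ofReal (C * t ^ (-decayExp d (σ / d) k' p' - δ)) ∧
    wNorm k' p' (fun x => (t ^ (σ / 2)) • u t (Real.sqrt t • x) - v 1 x) ≤
      ENNReal.ofReal (C * t ^ (-δ))

/-- The two-sided bound `‖u(t)‖_{L^{p',∞}_{k'}} ∼ t^{-(d/2)(σ/d-k'/d-1/p')}` for large `t` and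
all target pairs `(k',p')`. -/
def SharpDecay (σ k : ℝ) (p : ℝ≥0∞) (u : ℝ → Rd d → 𝕜) : Prop :=
  ∃ C T : ℝ, 0 < C ∧ 0 < T ∧ ∀ t, T ≤ t → ∀ (k' : ℝ) (p' : ℝ≥0∞), TargetPair d k p k' p' →
    ENNReal.ofReal (C⁻¹ * t ^ (-decayExp d (σ / d) k' p')) ≤ wNorm k' p' (u t) ∧
    wNorm k' p' (u t) ≤ ENNReal.ofReal (C * t ^ (-decayExp d (σ / d) k' p'))

end Heat

end

noncomputable section

/-! ### Two forms of the weak Lebesgue norm -/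

section WeakBounds

variable {d : ℕ}

/-- `F` satisfies `∫_E F ≤ A |E|^{1-θ}` for all sets `E` of finite measure. For `θ < 1` the least
such `A` is a norm on `L^{1/θ,∞}`. -/
def MeanBound (θ : ℝ) (A : ℝ≥0∞) (F : Rd d → ℝ≥0∞) : Prop :=
  ∀ E : Set (Rd d), MeasurableSet E → volume E ≠ ∞ →
    ∫⁻ x in E, F x ≤ A * volume E ^ (1 - θ)

/-- `|{F > A s^{-θ}}| ≤ s` for all `s ∈ (0,∞)`. -/
def DistBound (θ : ℝ) (A : ℝ≥0∞) (F : Rd d → ℝ≥0∞) : Prop :=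
  ∀ s : ℝ≥0∞, s ≠ 0 → s ≠ ∞ → volume {x | A * s ^ (-θ) < F x} ≤ s

variable {θ θ₁ θ₂ : ℝ} {A B : ℝ≥0∞} {F G : Rd d → ℝ≥0∞}

theorem MeanBound.mono (h : MeanBound θ A G) (hFG : F ≤ᵐ[volume] G) (hAB : A ≤ B) :
    MeanBound θ B F := fun E hE hE' =>
  ((lintegral_mono_ae (ae_restrict_of_ae hFG)).trans (h E hE hE')).trans (by gcongr)

theorem MeanBound.add (hF : AEMeasurable F volume) (h₁ : MeanBound θ A F) (h₂ : MeanBound θ B G) :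
    MeanBound θ (A + B) (fun x => F x + G x) := fun E hE hE' => by
  rw [lintegral_add_left' hF.restrict, add_mul]
  exact add_le_add (h₁ E hE hE') (h₂ E hE hE')

theorem MeanBound.const_mul (h : MeanBound θ A F) {c : ℝ≥0∞} (hc : c ≠ ∞) :
    MeanBound θ (c * A) (fun x => c * F x) := fun E hE hE' => by
  rw [lintegral_const_mul' _ _ hc, mul_assoc]
  gcongr
  exact h E hE hE'

theorem MeanBound.zero : MeanBound θ A (fun _ : Rd d => 0) := fun E _ _ => by simp

/-- Minkowski's inequality. -/
theorem MeanBound.lintegral {T : Type*} [MeasurableSpace T] {μ : Measure T} [SFinite μ]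
    {H : T → Rd d → ℝ≥0∞} {b : T → ℝ≥0∞} (hθ : θ ≤ 1)
    (hH : AEMeasurable (Function.uncurry H) (μ.prod volume))
    (h : ∀ᵐ τ ∂μ, MeanBound θ (b τ) (H τ)) :
    MeanBound θ (∫⁻ τ, b τ ∂μ) (fun x => ∫⁻ τ, H τ x ∂μ) := fun E hE hE' => by
  have hH' : AEMeasurable (Function.uncurry H) (μ.prod (volume.restrict E)) :=
    hH.mono_measure (Measure.prod_mono le_rfl Measure.restrict_le_self)
  rw [← lintegral_lintegral_swap hH',
    ← lintegral_mul_const' _ _ (ENNReal.rpow_ne_top_of_nonneg (by linarith) hE')]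
  exact lintegral_mono_ae (h.mono fun τ hτ => hτ E hE hE')

theorem MeanBound.tsum {H : ℕ → Rd d → ℝ≥0∞} {b : ℕ → ℝ≥0∞}
    (hH : ∀ n, AEMeasurable (H n) volume) (h : ∀ n, MeanBound θ (b n) (H n)) :
    MeanBound θ (∑' n, b n) (fun x => ∑' n, H n x) := fun E hE hE' => by
  rw [lintegral_tsum fun n => (hH n).restrict, ← ENNReal.tsum_mul_right]
  exact ENNReal.tsum_le_tsum fun n => h n E hE hE'

theorem MeanBound.of_forall_add (hθ : θ ≤ 1)
    (h : ∀ ε : ℝ≥0∞, 0 < ε → ε ≠ ∞ → MeanBound θ (A + ε) F) : MeanBound θ A F :=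
  fun E hE hE' => by
  have hV : volume E ^ (1 - θ) ≠ ∞ := ENNReal.rpow_ne_top_of_nonneg (by linarith) hE'
  have hcont : Tendsto (fun ε : ℝ≥0∞ => (A + ε) * volume E ^ (1 - θ)) (𝓝[>] 0)
      (𝓝 ((A + 0) * volume E ^ (1 - θ))) := by
    refine ENNReal.Tendsto.mul_const ?_ (Or.inr hV)
    exact (tendsto_const_nhds.add tendsto_id).mono_left nhdsWithin_le_nhds
  rw [add_zero] at hcont
  refine ge_of_tendsto hcont ?_
  have : Ioo (0 : ℝ≥0∞) 1 ∈ 𝓝[>] (0 : ℝ≥0∞) := Ioo_mem_nhdsGT zero_lt_one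
  filter_upwards [this] with ε hε
  exact h ε hε.1 (hε.2.trans ENNReal.one_lt_top).ne E hE hE'

theorem MeanBound.ae_lt_top (hF : AEMeasurable F volume) (hθ : θ ≤ 1) (hA : A ≠ ∞)
    (h : MeanBound θ A F) : ∀ᵐ x, F x < ∞ := by
  refine ae_of_forall_measure_lt_top_ae_restrict _ fun E hE hE' => ?_
  refine ae_lt_top' hF.restrict (ne_top_of_le_ne_top ?_ (h E hE hE'.ne))
  exact ENNReal.mul_ne_top hA (ENNReal.rpow_ne_top_of_nonneg (by linarith) hE'.ne)

theorem MeanBound.ae_eq_zero (hF : AEMeasurable F volume) (h : MeanBound θ 0 F) :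
    F =ᵐ[volume] 0 := by
  refine ae_of_forall_measure_lt_top_ae_restrict _ fun E hE hE' => ?_
  have := h E hE hE'.ne
  rw [zero_mul, nonpos_iff_eq_zero] at this
  exact (lintegral_eq_zero_iff' hF.restrict).1 this

theorem MeanBound.distBound (hF : AEMeasurable F volume) (hθ : 0 ≤ θ) (hA : A ≠ ∞)
    (h : MeanBound θ A F) : DistBound θ A F := by
  wlog hFm : Measurable F generalizing F
  · have hm := this hF.measurable_mk.aemeasurable (h.mono hF.ae_eq_mk.symm.le le_rfl)
      hF.measurable_mk
    intro s hs hs'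
    refine le_trans (measure_mono_ae ?_) (hm s hs hs')
    filter_upwards [hF.ae_eq_mk] with x hx hx'
    change _ < _ at hx' ⊢
    rwa [← hx]
  intro s hs hs'
  by_contra! hlt
  obtain ⟨E, hE, hES, hsE, hEtop⟩ :=
    Measure.exists_subset_measure_lt_top (measurableSet_lt measurable_const hFm) hlt
  have hE0 : volume E ≠ 0 := (hs.bot_lt.trans hsE).ne'
  have hle := h E hE hEtop.ne
  have hfin : ∫⁻ _ in E, A * s ^ (-θ) ≠ ∞ := by
    rw [setLIntegral_const]
    refine ENNReal.mul_ne_top (ENNReal.mul_ne_top hA ?_) hEtop.ne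
    exact ENNReal.rpow_ne_top_of_ne_zero hs hs'
  have hstrict := setLIntegral_strict_mono hE hE0 hFm hfin (ae_of_all _ fun x hx => hES hx)
  rw [setLIntegral_const] at hstrict
  refine absurd (hstrict.trans_le hle) (not_lt.2 ?_)
  rw [sub_eq_add_neg, ENNReal.rpow_add _ _ hE0 hEtop.ne, ENNReal.rpow_one, mul_assoc,
    mul_comm (volume E)]
  gcongr A * (?_ * _)
  rw [ENNReal.rpow_neg, ENNReal.rpow_neg]
  gcongr

/-- The constant that compares the two forms of the weak norm. -/
def weakConst (θ : ℝ) : ℝ≥0∞ := 1 + ∑' j : ℕ, 2 * (ENNReal.ofReal (2 ^ (-(1 - θ)))) ^ j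

theorem one_le_weakConst (θ : ℝ) : 1 ≤ weakConst θ := le_self_add

theorem weakConst_ne_top (hθ : θ < 1) : weakConst θ ≠ ∞ := by
  have h : ENNReal.ofReal (2 ^ (-(1 - θ))) < 1 := by
    rw [ENNReal.ofReal_lt_one]
    exact Real.rpow_lt_one_of_one_lt_of_neg (by norm_num) (by linarith)
  rw [weakConst, ENNReal.tsum_mul_left, ENNReal.tsum_geometric]
  refine ENNReal.add_ne_top.2 ⟨ENNReal.one_ne_top, ENNReal.mul_ne_top (by norm_num) ?_⟩
  exact ENNReal.inv_ne_top.2 (tsub_pos_of_lt h).ne'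

theorem weakConst_mono (h : θ₁ ≤ θ₂) : weakConst θ₁ ≤ weakConst θ₂ := by
  unfold weakConst
  gcongr
  norm_num

theorem DistBound.meanBound (hθ1 : θ < 1) (h : DistBound θ A F) :
    MeanBound θ (weakConst θ * A) F := by
  intro E hE hE'
  rcases eq_or_ne (volume E) 0 with hE0 | hE0
  · rw [Measure.restrict_eq_zero.2 hE0]; simp
  set m := volume E with hm
  set s : ℕ → ℝ≥0∞ := fun j => m * (2⁻¹) ^ j with hs
  have hs0 : ∀ j, s j ≠ 0 := fun j =>
    mul_ne_zero hE0 (pow_ne_zero _ (ENNReal.inv_ne_zero.2 (by norm_num)))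
  have hst : ∀ j, s j ≠ ∞ := fun j =>
    ENNReal.mul_ne_top hE' (ENNReal.pow_ne_top (by simp))
  set S : ℕ → Set (Rd d) := fun j => toMeasurable volume {x | A * s j ^ (-θ) < F x} with hS
  have hSm : ∀ j, MeasurableSet (S j) := fun j => measurableSet_toMeasurable _ _
  have hSv : ∀ j, volume (S j) ≤ s j := fun j => by
    rw [hS]; simp only [measure_toMeasurable]; exact h _ (hs0 j) (hst j)
  have hnull : volume (⋂ j, S j) = 0 := by
    refine le_antisymm (ge_of_tendsto (f := s) (x := atTop) ?_ (Eventually.of_forall fun j =>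
      (measure_mono (iInter_subset _ j)).trans (hSv j))) zero_le
    have : Tendsto (fun j : ℕ => (2⁻¹ : ℝ≥0∞) ^ j) atTop (𝓝 0) :=
      ENNReal.tendsto_pow_atTop_nhds_zero_of_lt_one (by simp)
    simpa using ENNReal.Tendsto.const_mul this (Or.inr hE')
  have hpt : ∀ᵐ x, F x ≤ A * s 0 ^ (-θ) +
      ∑' j, (S j).indicator (fun _ => A * s (j + 1) ^ (-θ)) x := by
    have : ∀ᵐ x, x ∉ ⋂ j, S j := measure_eq_zero_iff_ae_notMem.1 hnull
    filter_upwards [this] with x hx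
    classical
    have hex : ∃ j, x ∉ S j := by simpa using hx
    have hnot : F x ≤ A * s (Nat.find hex) ^ (-θ) := by
      by_contra! hcon
      exact Nat.find_spec hex (subset_toMeasurable _ _ hcon)
    rcases hk : Nat.find hex with _ | k
    · rw [hk] at hnot
      exact hnot.trans le_self_add
    · rw [hk] at hnot
      have hxk : x ∈ S k := by
        by_contra hcon
        have := Nat.find_min' hex hcon
        omega
      refine hnot.trans (le_trans ?_ le_add_self)
      refine le_trans ?_ (ENNReal.le_tsum k)
      rw [indicator_of_mem hxk]
  refine (lintegral_mono_ae (ae_restrict_of_ae hpt)).trans ?_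
  rw [lintegral_add_left measurable_const, setLIntegral_const, lintegral_tsum fun j =>
    (measurable_const.indicator (hSm j)).aemeasurable]
  have hone : m ^ (1 - θ) = m ^ (-θ) * m := by
    rw [sub_eq_add_neg, add_comm, ENNReal.rpow_add _ _ hE0 hE', ENNReal.rpow_one]
  have hterm : ∀ j, ∫⁻ x in E, (S j).indicator (fun _ => A * s (j + 1) ^ (-θ)) x
      ≤ A * m ^ (1 - θ) * (2 * (ENNReal.ofReal (2 ^ (-(1 - θ)))) ^ j) := fun j => by
    rw [lintegral_indicator_const (hSm j)]
    have h1 : volume.restrict E (S j) ≤ s j := (Measure.restrict_le_self _).trans (hSv j)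
    refine (mul_le_mul_right h1 _).trans ?_
    have hsplit : s (j + 1) ^ (-θ) = m ^ (-θ) * ENNReal.ofReal ((2 : ℝ) ^ ((j + 1) * θ)) := by
      have h2 : (2⁻¹ : ℝ≥0∞) ^ (j + 1) = ENNReal.ofReal ((2 : ℝ) ^ (-((j : ℝ) + 1))) := by
        rw [← ENNReal.ofReal_rpow_of_pos (by norm_num), ENNReal.rpow_neg, ← ENNReal.inv_rpow]
        rw [show ((j : ℝ) + 1) = ((j + 1 : ℕ) : ℝ) by push_cast; ring, ENNReal.rpow_natCast]
        norm_num
      simp only [hs]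
      rw [ENNReal.mul_rpow_of_ne_top hE' (ENNReal.pow_ne_top (by simp)), h2,
        ENNReal.ofReal_rpow_of_pos (by positivity), ← Real.rpow_mul (by norm_num)]
      congr 3
      ring
    have hsj : s j = m * ENNReal.ofReal ((2 : ℝ) ^ (-(j : ℝ))) := by
      simp only [hs]
      rw [← ENNReal.ofReal_rpow_of_pos (by norm_num), ENNReal.rpow_neg, ← ENNReal.inv_rpow,
        ENNReal.rpow_natCast]
      norm_num
    rw [hsplit, hsj, hone]
    have hnum : ENNReal.ofReal ((2 : ℝ) ^ ((j + 1) * θ)) * ENNReal.ofReal ((2 : ℝ) ^ (-(j : ℝ)))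
        ≤ 2 * (ENNReal.ofReal (2 ^ (-(1 - θ)))) ^ j := by
      rw [← ENNReal.ofReal_mul (by positivity), ← ENNReal.ofReal_pow (by positivity),
        ← Real.rpow_add (by norm_num), ← Real.rpow_natCast, ← Real.rpow_mul (by norm_num)]
      have : (2 : ℝ≥0∞) = ENNReal.ofReal ((2 : ℝ) ^ (1 : ℝ)) := by simp
      rw [this, ← ENNReal.ofReal_mul (by positivity), ← Real.rpow_add (by norm_num)]
      refine ENNReal.ofReal_le_ofReal (Real.rpow_le_rpow_of_exponent_le (by norm_num) ?_)
      nlinarith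
    calc A * (m ^ (-θ) * ENNReal.ofReal ((2 : ℝ) ^ ((j + 1) * θ))) *
          (m * ENNReal.ofReal ((2 : ℝ) ^ (-(j : ℝ))))
        = A * (m ^ (-θ) * m) * (ENNReal.ofReal ((2 : ℝ) ^ ((j + 1) * θ)) *
          ENNReal.ofReal ((2 : ℝ) ^ (-(j : ℝ)))) := by ring
      _ ≤ _ := by gcongr
  refine (add_le_add_right (ENNReal.tsum_le_tsum hterm) _).trans (le_of_eq ?_)
  rw [ENNReal.tsum_mul_left, weakConst, hone]
  simp only [hs, pow_zero, mul_one]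
  ring

theorem DistBound.mul (hA : DistBound θ₁ A F) (hB : DistBound θ₂ B G) :
    DistBound (θ₁ + θ₂) (ENNReal.ofReal (2 ^ (θ₁ + θ₂)) * (A * B)) (fun x => F x * G x) := by
  intro s hs hs'
  have h0 : s / 2 ≠ 0 := ENNReal.div_ne_zero.2 ⟨hs, by norm_num⟩
  have ht : s / 2 ≠ ∞ := ENNReal.div_ne_top hs' (by norm_num)
  have hsub : {x | ENNReal.ofReal (2 ^ (θ₁ + θ₂)) * (A * B) * s ^ (-(θ₁ + θ₂)) < F x * G x} ⊆
      {x | A * (s / 2) ^ (-θ₁) < F x} ∪ {x | B * (s / 2) ^ (-θ₂) < G x} := by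
    intro x hx
    by_contra hcon
    simp only [mem_union, mem_ofPred_eq, not_or, not_lt] at hcon hx
    refine absurd hx (not_lt.2 ((mul_le_mul' hcon.1 hcon.2).trans (le_of_eq ?_)))
    have : (s / 2) ^ (-θ₁) * (s / 2) ^ (-θ₂)
        = ENNReal.ofReal (2 ^ (θ₁ + θ₂)) * s ^ (-(θ₁ + θ₂)) := by
      rw [← ENNReal.rpow_add _ _ h0 ht, ← neg_add, ENNReal.div_eq_inv_mul,
        ENNReal.mul_rpow_of_ne_top (by simp) hs', ENNReal.inv_rpow, ENNReal.rpow_neg 2, inv_inv,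
        ← ENNReal.ofReal_rpow_of_pos (by norm_num)]
      norm_num
    calc _ = A * B * ((s / 2) ^ (-θ₁) * (s / 2) ^ (-θ₂)) := by ring
      _ = _ := by rw [this]; ring
  calc _ ≤ _ := measure_mono hsub
    _ ≤ _ := measure_union_le _ _
    _ ≤ s / 2 + s / 2 := add_le_add (hA _ h0 ht) (hB _ h0 ht)
    _ = s := ENNReal.add_halves s

theorem DistBound.rpow (h : DistBound θ A F) {r : ℝ} (hr : 0 < r) :
    DistBound (r * θ) (A ^ r) (fun x => F x ^ r) := by
  intro s hs hs'
  refine (measure_mono fun x hx => ?_).trans (h s hs hs')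
  have hx' : A ^ r * s ^ (-(r * θ)) < F x ^ r := hx
  rw [show -(r * θ) = -θ * r by ring, ENNReal.rpow_mul,
    ← ENNReal.mul_rpow_of_nonneg _ _ hr.le] at hx'
  exact (ENNReal.rpow_lt_rpow_iff hr).1 hx'

theorem DistBound.congr (h : DistBound θ A F) (hFG : F =ᵐ[volume] G) : DistBound θ A G := by
  intro s hs hs'
  refine le_trans (measure_mono_ae ?_) (h s hs hs')
  filter_upwards [hFG] with x hx hx'
  change _ < _ at hx' ⊢
  rwa [hx]

end WeakBounds

/-! ### Weighted bounds -/

section Weights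

variable {d : ℕ}

/-- The power weight `|x|^k`. -/
def wt (k : ℝ) (x : Rd d) : ℝ≥0∞ := ENNReal.ofReal (‖x‖ ^ k)

theorem measurable_wt (k : ℝ) : Measurable (wt (d := d) k) :=
  (measurable_norm.pow_const k).ennreal_ofReal

theorem wt_ne_top (k : ℝ) (x : Rd d) : wt k x ≠ ∞ := ENNReal.ofReal_ne_top

theorem wt_ne_zero (k : ℝ) {x : Rd d} (hx : x ≠ 0) : wt k x ≠ 0 := by
  have := norm_pos_iff.2 hx
  simp only [wt, ne_eq, ENNReal.ofReal_eq_zero, not_le]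
  positivity

theorem wt_zero (x : Rd d) : wt 0 x = 1 := by simp [wt]

theorem wt_add (k₁ k₂ : ℝ) {x : Rd d} (hx : x ≠ 0) : wt (k₁ + k₂) x = wt k₁ x * wt k₂ x := by
  rw [wt, wt, wt, ← ENNReal.ofReal_mul (by positivity), Real.rpow_add (norm_pos_iff.2 hx)]

theorem wt_rpow (k r : ℝ) {x : Rd d} (hx : x ≠ 0) : wt k x ^ r = wt (k * r) x := by
  have := norm_pos_iff.2 hx
  rw [wt, wt, ENNReal.ofReal_rpow_of_pos (by positivity), Real.rpow_mul (norm_nonneg _)]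

theorem wt_smul (k : ℝ) {c : ℝ} (hc : 0 < c) (x : Rd d) :
    wt k (c • x) = ENNReal.ofReal (c ^ k) * wt k x := by
  rw [wt, wt, norm_smul, Real.norm_of_nonneg hc.le, Real.mul_rpow hc.le (norm_nonneg _),
    ENNReal.ofReal_mul (by positivity)]

theorem ae_ne_zero [NeZero d] : ∀ᵐ x : Rd d, x ≠ 0 := Measure.ae_ne _ _

theorem enorm_rpow_smul {𝕜 : Type*} [RCLike 𝕜] (k : ℝ) (x : Rd d) (z : 𝕜) :
    ‖(‖x‖ ^ k) • z‖ₑ = wt k x * ‖z‖ₑ := by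
  rw [enorm_smul, wt, Real.enorm_of_nonneg (by positivity)]

/-- The bound `‖F‖ ≤ A` in the norm of `L^{1/θ,∞}_k`. -/
def LBound (k θ : ℝ) (A : ℝ≥0∞) (F : Rd d → ℝ≥0∞) : Prop :=
  MeanBound θ A (fun x => wt k x * F x)

variable {k θ k₁ θ₁ : ℝ} {A B : ℝ≥0∞} {F G : Rd d → ℝ≥0∞}

theorem LBound.mono (h : LBound k θ A G) (hFG : F ≤ᵐ[volume] G) (hAB : A ≤ B) :
    LBound k θ B F :=
  MeanBound.mono h (hFG.mono fun _ hx => mul_le_mul_right hx _) hAB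

theorem LBound.add (hF : AEMeasurable F volume) (h₁ : LBound k θ A F) (h₂ : LBound k θ B G) :
    LBound k θ (A + B) (fun x => F x + G x) :=
  (MeanBound.add ((measurable_wt k).aemeasurable.mul hF) h₁ h₂).mono
    (ae_of_all _ fun _ => (mul_add _ _ _).le) le_rfl

theorem LBound.const_mul (h : LBound k θ A F) {c : ℝ≥0∞} (hc : c ≠ ∞) :
    LBound k θ (c * A) (fun x => c * F x) :=
  (MeanBound.const_mul h hc).mono (ae_of_all _ fun _ => (mul_left_comm _ _ _).le) le_rfl

theorem LBound.zero : LBound k θ A (fun _ : Rd d => 0) :=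
  MeanBound.zero.mono (ae_of_all _ fun _ => by simp) le_rfl

theorem LBound.lintegral {T : Type*} [MeasurableSpace T] {μ : Measure T} [SFinite μ]
    {H : T → Rd d → ℝ≥0∞} {b : T → ℝ≥0∞} (hθ : θ ≤ 1)
    (hH : AEMeasurable (Function.uncurry H) (μ.prod volume))
    (h : ∀ᵐ τ ∂μ, LBound k θ (b τ) (H τ)) :
    LBound k θ (∫⁻ τ, b τ ∂μ) (fun x => ∫⁻ τ, H τ x ∂μ) :=
  (MeanBound.lintegral (H := fun τ x => wt k x * H τ x) hθ
    (((measurable_wt k).comp measurable_snd).aemeasurable.mul hH) h).mono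
    (ae_of_all _ fun x => (lintegral_const_mul' _ _ (wt_ne_top k x)).ge) le_rfl

theorem LBound.tsum {H : ℕ → Rd d → ℝ≥0∞} {b : ℕ → ℝ≥0∞}
    (hH : ∀ n, AEMeasurable (H n) volume) (h : ∀ n, LBound k θ (b n) (H n)) :
    LBound k θ (∑' n, b n) (fun x => ∑' n, H n x) :=
  (MeanBound.tsum (fun n => (measurable_wt k).aemeasurable.mul (hH n)) h).mono
    (ae_of_all _ fun _ => ENNReal.tsum_mul_left.ge) le_rfl

theorem LBound.of_forall_add (hθ : θ ≤ 1)
    (h : ∀ ε : ℝ≥0∞, 0 < ε → ε ≠ ∞ → LBound k θ (A + ε) F) : LBound k θ A F :=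
  MeanBound.of_forall_add hθ h

theorem LBound.ae_lt_top [NeZero d] (hF : AEMeasurable F volume) (hθ : θ ≤ 1) (hA : A ≠ ∞)
    (h : LBound k θ A F) : ∀ᵐ x, F x < ∞ := by
  filter_upwards [MeanBound.ae_lt_top ((measurable_wt k).aemeasurable.mul hF) hθ hA h,
    ae_ne_zero] with x hx hx0
  by_contra! hcon
  rw [Pi.mul_apply, top_le_iff.1 hcon, ENNReal.mul_top (wt_ne_zero k hx0)] at hx
  exact lt_irrefl _ hx

theorem LBound.ae_eq_zero [NeZero d] (hF : AEMeasurable F volume) (h : LBound k θ 0 F) :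
    F =ᵐ[volume] 0 := by
  filter_upwards [MeanBound.ae_eq_zero ((measurable_wt k).aemeasurable.mul hF) h,
    ae_ne_zero] with x hx hx0
  exact (mul_eq_zero.1 hx).resolve_left (wt_ne_zero k hx0)

/-- Hölder's inequality for the nonlinear term. -/
theorem LBound.nonlin [NeZero d] {γ α : ℝ} (hα : 1 < α) (hθ : 0 ≤ θ) (hθ₁ : 0 ≤ θ₁)
    (hθ₁θ : θ₁ ≤ θ) (hαθ : α * θ < 1)
    (hF : AEMeasurable F volume) (hG : AEMeasurable G volume) (hA : A ≠ ∞) (hB : B ≠ ∞)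
    (h₁ : LBound k θ A F) (h₂ : LBound k₁ θ₁ B G) :
    LBound ((α - 1) * k - γ + k₁) ((α - 1) * θ + θ₁) (2 * weakConst (α * θ) * (A ^ (α - 1) * B))
      (fun x => wt γ x * F x ^ (α - 1) * G x) := by
  have hsum : (α - 1) * θ + θ₁ ≤ α * θ := by nlinarith
  have hα1 : 0 < α - 1 := by linarith
  have hd₁ := (MeanBound.distBound ((measurable_wt k).aemeasurable.mul hF) hθ hA h₁).rpow hα1
  have hd₂ := MeanBound.distBound ((measurable_wt k₁).aemeasurable.mul hG) hθ₁ hB h₂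
  have hd := (hd₁.mul hd₂).congr (G := fun x => wt ((α - 1) * k - γ + k₁) x *
    (wt γ x * F x ^ (α - 1) * G x)) (by
      filter_upwards [ae_ne_zero] with x hx
      simp only [Pi.mul_apply]
      rw [ENNReal.mul_rpow_of_nonneg _ _ hα1.le, wt_rpow k _ hx,
        show k * (α - 1) = ((α - 1) * k - γ) + γ by ring, wt_add _ γ hx, wt_add _ k₁ hx]
      ring)
  refine (hd.meanBound (by linarith)).mono (ae_of_all _ fun x => le_rfl) ?_
  have h2 : ENNReal.ofReal (2 ^ ((α - 1) * θ + θ₁)) ≤ 2 := by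
    have : (2 : ℝ) ^ ((α - 1) * θ + θ₁) ≤ 2 ^ (1 : ℝ) :=
      Real.rpow_le_rpow_of_exponent_le (by norm_num) (by linarith)
    simpa using ENNReal.ofReal_le_ofReal this
  have h3 := weakConst_mono hsum
  calc weakConst ((α - 1) * θ + θ₁) * (ENNReal.ofReal (2 ^ ((α - 1) * θ + θ₁)) *
        (A ^ (α - 1) * B))
      ≤ weakConst (α * θ) * (2 * (A ^ (α - 1) * B)) := by gcongr
    _ = _ := by ring

end Weights

/-! ### The weak norm -/

section WeakNorm

variable {𝕜 : Type*} [RCLike 𝕜] {d : ℕ}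

theorem weakNorm_le_iff {p : ℝ≥0∞} {A : ℝ≥0∞} {f : Rd d → 𝕜} :
    weakNorm p f ≤ A ↔ DistBound (recip p) A (fun x => ‖f x‖ₑ) := by
  have key : ∀ t : ℝ, 0 < t → ∀ r : ℝ≥0∞, ENNReal.ofReal (t ^ recip p) * r ≤ A ↔
      r ≤ A * ENNReal.ofReal t ^ (-recip p) := fun t ht r => by
    have h0 : ENNReal.ofReal (t ^ recip p) ≠ 0 := by
      simpa using Real.rpow_pos_of_pos ht _
    rw [ENNReal.rpow_neg, ENNReal.ofReal_rpow_of_pos ht, ← div_eq_mul_inv,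
      ENNReal.le_div_iff_mul_le (Or.inl h0) (Or.inl ENNReal.ofReal_ne_top), mul_comm]
  constructor
  · intro h s hs hs'
    have ht : 0 < s.toReal := ENNReal.toReal_pos hs hs'
    have h1 : rearrangement f s ≤ A * s ^ (-recip p) := by
      have := (key _ ht _).1 ((le_iSup₂ (f := fun (t : ℝ) (_ : 0 < t) => ENNReal.ofReal
        (t ^ recip p) * rearrangement f (ENNReal.ofReal t)) _ ht).trans h)
      rwa [ENNReal.ofReal_toReal hs'] at this
    rcases eq_or_ne (rearrangement f s) ∞ with hr | hr
    · rw [hr, top_le_iff] at h1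
      simp [h1]
    refine (measure_mono (t := {x | rearrangement f s < ‖f x‖ₑ})
      fun x hx => h1.trans_lt hx).trans ?_
    obtain ⟨c, hcanti, hcgt, hclim⟩ := exists_seq_strictAnti_tendsto' (x := rearrangement f s)
      (y := ∞) hr.lt_top
    have hU : {x | rearrangement f s < ‖f x‖ₑ} = ⋃ n, {x | c n < ‖f x‖ₑ} := by
      ext x
      simp only [mem_iUnion]
      constructor
      · intro hx
        exact ((tendsto_order.1 hclim).2 _ hx).exists
      · rintro ⟨n, hn⟩
        exact (hcgt n).1.trans hn
    have hmono : Monotone fun n => {x | c n < ‖f x‖ₑ} :=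
      fun m n hmn x hx => lt_of_le_of_lt (hcanti.antitone hmn) hx
    rw [hU, hmono.measure_iUnion]
    refine iSup_le fun n => ?_
    obtain ⟨lam, hlam, hlt⟩ := sInf_lt_iff.1 (hcgt n).1
    exact (measure_mono fun x hx => hlt.trans hx).trans hlam.2
  · intro h
    refine iSup₂_le fun t ht => (key t ht _).2 ?_
    refine le_of_forall_gt_imp_ge_of_dense fun c hc => sInf_le ⟨hc.bot_lt, ?_⟩
    exact (measure_mono fun x hx => hc.trans hx).trans
      (h _ (by simpa using ht) ENNReal.ofReal_ne_top)

theorem wNorm_le_iff {k : ℝ} {p : ℝ≥0∞} {A : ℝ≥0∞} {f : Rd d → 𝕜} :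
    wNorm k p f ≤ A ↔ DistBound (recip p) A (fun x => wt k x * ‖f x‖ₑ) := by
  rw [wNorm, weakNorm_le_iff]
  simp only [enorm_rpow_smul]

theorem recip_nonneg (p : ℝ≥0∞) : 0 ≤ recip p := ENNReal.toReal_nonneg

theorem recip_le_one {p : ℝ≥0∞} (hp : 1 ≤ p) : recip p ≤ 1 := by
  have : p⁻¹ ≤ 1 := ENNReal.inv_le_one.2 hp
  simpa [recip] using ENNReal.toReal_mono ENNReal.one_ne_top this

theorem recip_anti {p p' : ℝ≥0∞} (hp : 1 ≤ p) (h : p ≤ p') : recip p' ≤ recip p :=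
  ENNReal.toReal_mono (ENNReal.inv_ne_top.2 (by positivity)) (ENNReal.inv_le_inv.2 h)

theorem LBound.wNorm_le {k : ℝ} {p : ℝ≥0∞} {A : ℝ≥0∞} {f : Rd d → 𝕜}
    (hf : AEStronglyMeasurable f volume) (h : LBound k (recip p) A (fun x => ‖f x‖ₑ)) :
    wNorm k p f ≤ A := by
  rcases eq_or_ne A ∞ with rfl | hA
  · exact le_top
  exact wNorm_le_iff.2 (MeanBound.distBound ((measurable_wt k).aemeasurable.mul hf.enorm)
    (recip_nonneg p) hA h)

theorem LBound.of_wNorm_le {k : ℝ} {p : ℝ≥0∞} {A : ℝ≥0∞} {f : Rd d → 𝕜} (hp : recip p < 1)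
    (h : wNorm k p f ≤ A) : LBound k (recip p) (weakConst (recip p) * A) (fun x => ‖f x‖ₑ) :=
  (wNorm_le_iff.1 h).meanBound hp

theorem wNorm_congr {k : ℝ} {p : ℝ≥0∞} {f g : Rd d → 𝕜} (h : f =ᵐ[volume] g) :
    wNorm k p f = wNorm k p g := by
  refine eq_of_forall_ge_iff fun A => ?_
  rw [wNorm_le_iff, wNorm_le_iff]
  have h' : (fun x => wt k x * ‖f x‖ₑ) =ᵐ[volume] (fun x => wt k x * ‖g x‖ₑ) :=
    h.mono fun x hx => by simp only [hx]
  exact ⟨fun H => H.congr h', fun H => H.congr h'.symm⟩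

theorem wNorm_add_le {k : ℝ} {p : ℝ≥0∞} (hp : 1 ≤ p) (f g : Rd d → 𝕜) :
    wNorm k p (fun x => f x + g x) ≤ 2 * (wNorm k p f + wNorm k p g) := by
  rw [wNorm_le_iff]
  intro s hs hs'
  have h0 : s / 2 ≠ 0 := ENNReal.div_ne_zero.2 ⟨hs, by norm_num⟩
  have ht : s / 2 ≠ ∞ := ENNReal.div_ne_top hs' (by norm_num)
  have hpow : (s / 2) ^ (-recip p) ≤ 2 * s ^ (-recip p) := by
    rw [ENNReal.div_eq_inv_mul, ENNReal.mul_rpow_of_ne_top (by simp) hs', ENNReal.inv_rpow,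
      ENNReal.rpow_neg 2, inv_inv]
    gcongr
    calc (2 : ℝ≥0∞) ^ recip p ≤ 2 ^ (1 : ℝ) :=
          ENNReal.rpow_le_rpow_of_exponent_le (by norm_num) (recip_le_one hp)
      _ = 2 := ENNReal.rpow_one 2
  have hsub : {x | 2 * (wNorm k p f + wNorm k p g) * s ^ (-recip p) < wt k x * ‖f x + g x‖ₑ} ⊆
      {x | wNorm k p f * (s / 2) ^ (-recip p) < wt k x * ‖f x‖ₑ} ∪
      {x | wNorm k p g * (s / 2) ^ (-recip p) < wt k x * ‖g x‖ₑ} := by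
    intro x hx
    by_contra hcon
    simp only [mem_union, mem_ofPred_eq, not_or, not_lt] at hcon hx
    refine absurd hx (not_lt.2 ?_)
    calc wt k x * ‖f x + g x‖ₑ ≤ wt k x * ‖f x‖ₑ + wt k x * ‖g x‖ₑ := by
          rw [← mul_add]; gcongr; exact enorm_add_le _ _
      _ ≤ wNorm k p f * (s / 2) ^ (-recip p) + wNorm k p g * (s / 2) ^ (-recip p) :=
          add_le_add hcon.1 hcon.2
      _ = (wNorm k p f + wNorm k p g) * (s / 2) ^ (-recip p) := by ring
      _ ≤ (wNorm k p f + wNorm k p g) * (2 * s ^ (-recip p)) := by gcongr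
      _ = _ := by ring
  calc _ ≤ _ := measure_mono hsub
    _ ≤ _ := measure_union_le _ _
    _ ≤ s / 2 + s / 2 := add_le_add (wNorm_le_iff.1 le_rfl _ h0 ht) (wNorm_le_iff.1 le_rfl _ h0 ht)
    _ = s := ENNReal.add_halves s

theorem wNorm_smul_comp_smul_le {k : ℝ} {p : ℝ≥0∞} (f : Rd d → 𝕜) {b c : ℝ} (hb : 0 < b)
    (hc : 0 < c) :
    wNorm k p (fun x => b • f (c • x)) ≤
      ENNReal.ofReal (b * c ^ (-(k + d * recip p))) * wNorm k p f := by
  rw [wNorm_le_iff]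
  intro s hs hs'
  have hcd : 0 < c ^ d := pow_pos hc d
  have hC : ENNReal.ofReal (c ^ d) * s ≠ 0 := mul_ne_zero (by simpa using hcd) hs
  have hC' : ENNReal.ofReal (c ^ d) * s ≠ ∞ := ENNReal.mul_ne_top ENNReal.ofReal_ne_top hs'
  have hset : {x | ENNReal.ofReal (b * c ^ (-(k + d * recip p))) * wNorm k p f * s ^ (-recip p)
        < wt k x * ‖b • f (c • x)‖ₑ} =
      (fun x => c • x) ⁻¹' {y | wNorm k p f * (ENNReal.ofReal (c ^ d) * s) ^ (-recip p)
        < wt k y * ‖f y‖ₑ} := by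
    ext x
    simp only [mem_preimage, mem_ofPred_eq, wt_smul k hc]
    have h1 : 0 < b * c ^ (-k) := by positivity
    have h1' : ENNReal.ofReal (b * c ^ (-k)) ≠ 0 := by simpa using h1
    rw [← ENNReal.mul_lt_mul_iff_right (a := ENNReal.ofReal (b * c ^ (-k))) h1'
      ENNReal.ofReal_ne_top (b := wNorm k p f * _)]
    have e1 : ENNReal.ofReal (b * c ^ (-k)) * (ENNReal.ofReal (c ^ k) * wt k x * ‖f (c • x)‖ₑ)
        = wt k x * ‖b • f (c • x)‖ₑ := by
      rw [enorm_smul, Real.enorm_of_nonneg hb.le]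
      have : ENNReal.ofReal (b * c ^ (-k)) * ENNReal.ofReal (c ^ k) = ENNReal.ofReal b := by
        rw [← ENNReal.ofReal_mul h1.le, mul_assoc, ← Real.rpow_add hc]
        simp
      rw [← mul_assoc, ← mul_assoc, this]
      ring
    have e2 : ENNReal.ofReal (b * c ^ (-k)) * (wNorm k p f *
          (ENNReal.ofReal (c ^ d) * s) ^ (-recip p)) =
        ENNReal.ofReal (b * c ^ (-(k + d * recip p))) * wNorm k p f * s ^ (-recip p) := by
      rw [ENNReal.mul_rpow_of_ne_top ENNReal.ofReal_ne_top hs', ENNReal.ofReal_rpow_of_pos hcd,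
        ← Real.rpow_natCast, ← Real.rpow_mul hc.le]
      have : ENNReal.ofReal (b * c ^ (-k)) * ENNReal.ofReal (c ^ (d * -recip p)) =
          ENNReal.ofReal (b * c ^ (-(k + d * recip p))) := by
        rw [← ENNReal.ofReal_mul h1.le, mul_assoc, ← Real.rpow_add hc]
        congr 3
        ring
      rw [← this]
      ring
    rw [e1, e2]
  rw [hset, Measure.addHaar_preimage_smul _ hc.ne']
  have hfin : Module.finrank ℝ (Rd d) = d := by simp
  rw [hfin, abs_of_pos (by positivity)]
  calc _ ≤ ENNReal.ofReal ((c ^ d)⁻¹) * (ENNReal.ofReal (c ^ d) * s) := by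
        gcongr
        exact wNorm_le_iff.1 le_rfl _ hC hC'
    _ = s := by
        rw [← mul_assoc, ← ENNReal.ofReal_mul (by positivity), inv_mul_cancel₀ hcd.ne']
        simp

end WeakNorm

/-! ### Smoothing by the heat kernel -/

section Smoothing

variable {d : ℕ}

/-- The function `e^{-|x|}` as an extended nonnegative function. -/
def expNorm (x : Rd d) : ℝ≥0∞ := ENNReal.ofReal (Real.exp (-‖x‖))

theorem measurable_expNorm : Measurable (expNorm (d := d)) :=
  (Real.measurable_exp.comp measurable_norm.neg).ennreal_ofReal

theorem expNorm_le_one (x : Rd d) : expNorm x ≤ 1 := by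
  simp [expNorm]

theorem lintegral_expNorm_ne_top : ∫⁻ x : Rd d, expNorm x ≠ ∞ := by
  have hint : Integrable (fun x : Rd d => (1 + ‖x‖) ^ (-((d : ℝ) + 1))) volume :=
    integrable_one_add_norm (by simp)
  have hfin := (hint.const_mul ((d + 1).factorial * Real.exp 1)).lintegral_lt_top
  refine ne_top_of_le_ne_top hfin.ne (lintegral_mono fun x => ENNReal.ofReal_le_ofReal ?_)
  have h1 : 0 < 1 + ‖x‖ := by positivity
  have h := Real.pow_div_factorial_le_exp (1 + ‖x‖) h1.le (d + 1)
  have hpow : (1 + ‖x‖) ^ (-((d : ℝ) + 1)) = ((1 + ‖x‖) ^ (d + 1))⁻¹ := by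
    rw [Real.rpow_neg h1.le]
    congr 1
    exact_mod_cast Real.rpow_natCast (1 + ‖x‖) (d + 1)
  rw [hpow, Real.exp_neg]
  rw [div_le_iff₀ (by positivity), Real.exp_add] at h
  rw [inv_eq_one_div, ← div_eq_mul_inv, div_le_div_iff₀ (by positivity) (by positivity)]
  linarith

variable {k θ k₁ θ₁ : ℝ} {A B : ℝ≥0∞} {F G : Rd d → ℝ≥0∞}

theorem MeanBound.comp_sub (hF : Measurable F) (h : MeanBound θ A F) (z : Rd d) :
    MeanBound θ A (fun x => F (x - z)) := fun E hE hE' => by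
  have hmp : MeasurePreserving (fun x : Rd d => x + z) volume volume :=
    measurePreserving_add_right _ z
  have h1 := hmp.setLIntegral_comp_preimage hE (f := fun x => F (x - z))
    (hF.comp (measurable_id.sub_const z))
  simp only [add_sub_cancel_right] at h1
  rw [← h1, ← hmp.measure_preimage hE.nullMeasurableSet]
  refine h _ (hmp.measurable hE) ?_
  rwa [hmp.measure_preimage hE.nullMeasurableSet]

theorem MeanBound.of_le_const {θ₂ : ℝ} (hθ₂ : 0 ≤ θ₂) (h21 : θ₂ ≤ θ₁)
    (h : MeanBound θ₁ A F) (hle : ∀ x, F x ≤ A) : MeanBound θ₂ A F := fun E hE hE' => by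
  rcases eq_or_ne (volume E) 0 with hE0 | hE0
  · rw [Measure.restrict_eq_zero.2 hE0]; simp
  rcases le_total (volume E) 1 with h1 | h1
  · calc ∫⁻ x in E, F x ≤ ∫⁻ _ in E, A := lintegral_mono hle
      _ = A * volume E ^ (1 : ℝ) := by rw [setLIntegral_const, ENNReal.rpow_one]
      _ ≤ _ := mul_le_mul_right (ENNReal.rpow_le_rpow_of_exponent_ge h1 (by linarith)) _
  · exact (h E hE hE').trans
      (mul_le_mul_right (ENNReal.rpow_le_rpow_of_exponent_le h1 (by linarith)) _)

/-- The convolution with `e^{-|x|}`. -/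
def expConv (F : Rd d → ℝ≥0∞) (x : Rd d) : ℝ≥0∞ := ∫⁻ y, expNorm (x - y) * F y

theorem expConv_eq (F : Rd d → ℝ≥0∞) (x : Rd d) :
    expConv F x = ∫⁻ z, expNorm z * F (x - z) := by
  rw [expConv, ← lintegral_sub_left_eq_self (fun y => expNorm (x - y) * F y) x]
  simp

theorem MeanBound.expConv (hθ : θ ≤ 1) (hF : Measurable F) (h : MeanBound θ A F) :
    MeanBound θ ((∫⁻ z : Rd d, expNorm z) * A) (expConv F) := by
  have hH : Measurable (Function.uncurry fun (z x : Rd d) => expNorm z * F (x - z)) :=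
    (measurable_expNorm.comp measurable_fst).mul (hF.comp (measurable_snd.sub measurable_fst))
  have := MeanBound.lintegral (μ := volume) hθ hH.aemeasurable (ae_of_all _ fun z =>
    (h.comp_sub hF z).const_mul (ENNReal.ofReal_ne_top (r := Real.exp (-‖z‖))))
  refine this.mono (ae_of_all _ fun x => (expConv_eq F x).le) ?_
  exact (lintegral_mul_const _ measurable_expNorm).le

/-- The volume of the unit ball. -/
def ballVol (d : ℕ) : ℝ≥0∞ := volume (Metric.ball (0 : Rd d) 1)

theorem ballVol_ne_zero : ballVol d ≠ 0 := (Metric.measure_ball_pos _ _ one_pos).ne'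

theorem ballVol_ne_top : ballVol d ≠ ∞ := measure_ball_lt_top.ne

theorem volume_ball_one (x : Rd d) : volume (Metric.ball x 1) = ballVol d :=
  Measure.addHaar_ball_center _ x 1

theorem rpow_le_one_add (a : ℝ≥0∞) {r : ℝ} (h0 : 0 ≤ r) (h1 : r ≤ 1) : a ^ r ≤ 1 + a := by
  rcases le_total a 1 with h | h
  · exact (ENNReal.rpow_le_one h h0).trans le_self_add
  · calc a ^ r ≤ a ^ (1 : ℝ) := ENNReal.rpow_le_rpow_of_exponent_le h h1
      _ ≤ 1 + a := by rw [ENNReal.rpow_one]; exact le_add_self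

theorem MeanBound.expConv_le (hθ0 : 0 ≤ θ) (hθ : θ ≤ 1) (hF : Measurable F) (h : MeanBound θ A F)
    (x : Rd d) : _root_.expConv F x ≤
      ENNReal.ofReal (Real.exp 1) * (ballVol d)⁻¹ * (∫⁻ z : Rd d, expNorm z) *
        (1 + ballVol d) * A := by
  set c := ENNReal.ofReal (Real.exp 1) * (ballVol d)⁻¹ with hc
  have hexp : ∀ z : Rd d, expNorm z ≤ c * ∫⁻ w in Metric.ball z 1, expNorm w := fun z => by
    have h1 : ∫⁻ w in Metric.ball z 1, ENNReal.ofReal (Real.exp (-‖z‖ - 1)) ≤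
        ∫⁻ w in Metric.ball z 1, expNorm w := by
      refine setLIntegral_mono' measurableSet_ball fun w hw => ENNReal.ofReal_le_ofReal ?_
      rw [Real.exp_le_exp]
      have h2 : ‖w - z‖ < 1 := by simpa [dist_eq_norm] using hw
      have h3 : ‖w‖ ≤ ‖w - z‖ + ‖z‖ := by simpa using norm_add_le (w - z) z
      linarith
    rw [setLIntegral_const, volume_ball_one] at h1
    calc expNorm z = c * (ENNReal.ofReal (Real.exp (-‖z‖ - 1)) * ballVol d) := by
          rw [hc, mul_comm (ENNReal.ofReal (Real.exp (-‖z‖ - 1))), ← mul_assoc,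
            mul_assoc (ENNReal.ofReal (Real.exp 1)),
            ENNReal.inv_mul_cancel ballVol_ne_zero ballVol_ne_top, mul_one,
            ← ENNReal.ofReal_mul (by positivity), ← Real.exp_add, expNorm]
          ring_nf
      _ ≤ _ := by gcongr
  set ind : Rd d → Rd d → ℝ≥0∞ := fun y w =>
    (Metric.ball (0 : Rd d) 1).indicator (fun _ => (1 : ℝ≥0∞)) (x - y - w) with hind
  have hindm : Measurable (Function.uncurry ind) := by
    refine (measurable_const.indicator measurableSet_ball).comp ?_
    exact (measurable_const.sub measurable_fst).sub measurable_snd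
  have hA : ∀ y, ∫⁻ w in Metric.ball (x - y) 1, expNorm w = ∫⁻ w, ind y w * expNorm w := fun y => by
    rw [← lintegral_indicator measurableSet_ball]
    refine lintegral_congr fun w => ?_
    simp only [hind, indicator, Metric.mem_ball, dist_eq_norm, sub_zero]
    rw [norm_sub_rev w (x - y)]
    split_ifs <;> simp
  have hB : ∀ w, ∫⁻ y, ind y w * F y ≤ A * (1 + ballVol d) := fun w => by
    have : ∫⁻ y, ind y w * F y = ∫⁻ y in Metric.ball (x - w) 1, F y := by
      rw [← lintegral_indicator measurableSet_ball]
      refine lintegral_congr fun y => ?_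
      simp only [hind, indicator, Metric.mem_ball, dist_eq_norm, sub_zero]
      rw [norm_sub_rev y (x - w), sub_right_comm x y w]
      split_ifs <;> simp
    rw [this]
    refine (h _ measurableSet_ball (by rw [volume_ball_one]; exact ballVol_ne_top)).trans ?_
    rw [volume_ball_one]
    gcongr
    exact rpow_le_one_add _ (by linarith) (by linarith)
  calc _root_.expConv F x ≤ ∫⁻ y, c * (∫⁻ w, ind y w * expNorm w) * F y :=
        lintegral_mono fun y => by
          have := hexp (x - y)
          rw [hA] at this
          exact mul_le_mul_left this (F y)
    _ = c * ∫⁻ y, ∫⁻ w, ind y w * expNorm w * F y := by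
        rw [← lintegral_const_mul']
        · refine lintegral_congr fun y => ?_
          have hm : Measurable fun w => ind y w * expNorm w :=
            (hindm.of_uncurry_left (x := y)).mul measurable_expNorm
          rw [mul_assoc, lintegral_mul_const _ hm]
        · exact ENNReal.mul_ne_top ENNReal.ofReal_ne_top (ENNReal.inv_ne_top.2 ballVol_ne_zero)
    _ = c * ∫⁻ w, ∫⁻ y, ind y w * expNorm w * F y := by
        rw [lintegral_lintegral_swap]
        exact ((hindm.mul (measurable_expNorm.comp measurable_snd)).mul
          (hF.comp measurable_fst)).aemeasurable
    _ ≤ c * ∫⁻ w, expNorm w * (A * (1 + ballVol d)) := by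
        gcongr with w
        refine le_trans (le_of_eq ?_) (mul_le_mul_right (hB w) (expNorm w))
        rw [← lintegral_const_mul' (expNorm w) _ ENNReal.ofReal_ne_top]
        exact lintegral_congr fun y => by ring
    _ = c * (∫⁻ z : Rd d, expNorm z) * (1 + ballVol d) * A := by
        rw [lintegral_mul_const _ measurable_expNorm]
        ring

theorem meanBound_expNorm (hθ : 0 ≤ θ) (hθ1 : θ ≤ 1) :
    MeanBound θ (1 + ∫⁻ z : Rd d, expNorm z) (expNorm (d := d)) := by
  refine MeanBound.of_le_const (θ₁ := 1) hθ hθ1 (fun E _ _ => ?_) fun x =>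
    (expNorm_le_one x).trans le_self_add
  simp only [sub_self, ENNReal.rpow_zero, mul_one]
  exact (setLIntegral_le_lintegral _ _).trans le_add_self

/-- `|x|^{-dθ}` belongs to `L^{1/θ,∞}`. -/
theorem distBound_wt [NeZero d] (hθ : 0 ≤ θ) :
    DistBound θ (ballVol d ^ θ) (wt (d := d) (-(d * θ))) := by
  intro s hs hs'
  rcases hθ.eq_or_lt with rfl | hθ
  · simp [wt]
  have hd : (0 : ℝ) < d := by exact_mod_cast Nat.pos_of_ne_zero (NeZero.ne d)
  set r : ℝ := ((s / ballVol d).toReal) ^ (1 / d : ℝ) with hr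
  have hq : s / ballVol d ≠ 0 := ENNReal.div_ne_zero.2 ⟨hs, ballVol_ne_top⟩
  have hq' : s / ballVol d ≠ ∞ := ENNReal.div_ne_top hs' ballVol_ne_zero
  have hr0 : 0 ≤ r := by positivity
  have hrd : ENNReal.ofReal (r ^ d) = s / ballVol d := by
    rw [hr, ← Real.rpow_natCast, ← Real.rpow_mul ENNReal.toReal_nonneg, one_div,
      inv_mul_cancel₀ hd.ne', Real.rpow_one, ENNReal.ofReal_toReal hq']
  have hsub : ∀ᵐ x : Rd d, x ∈ {x | ballVol d ^ θ * s ^ (-θ) < wt (-(d * θ)) x} →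
      x ∈ Metric.ball (0 : Rd d) r := by
    filter_upwards [ae_ne_zero] with x hx hlt
    have hx' := norm_pos_iff.2 hx
    have e1 : ballVol d ^ θ * s ^ (-θ) = (s / ballVol d) ^ (-θ) := by
      rw [ENNReal.rpow_neg, ← ENNReal.inv_rpow, ← ENNReal.mul_rpow_of_nonneg _ _ hθ.le,
        ENNReal.rpow_neg, ← ENNReal.inv_rpow, ENNReal.inv_div (Or.inl ballVol_ne_top)
        (Or.inl ballVol_ne_zero), ENNReal.div_eq_inv_mul, mul_comm]
    have e2 : wt (-(d * θ)) x = (ENNReal.ofReal (‖x‖ ^ d)) ^ (-θ) := by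
      rw [wt, ENNReal.ofReal_rpow_of_pos (by positivity), ← Real.rpow_natCast,
        ← Real.rpow_mul hx'.le]
      congr 2
      ring
    have hlt' : (s / ballVol d) ^ (-θ) < (ENNReal.ofReal (‖x‖ ^ d)) ^ (-θ) := by
      rw [← e1, ← e2]; exact hlt
    rw [ENNReal.rpow_neg, ENNReal.rpow_neg, ENNReal.inv_lt_inv, ENNReal.rpow_lt_rpow_iff hθ,
      ← hrd, ENNReal.ofReal_lt_ofReal_iff_of_nonneg (by positivity)] at hlt'
    rw [mem_ball_zero_iff]
    exact lt_of_pow_lt_pow_left₀ d hr0 hlt'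
  refine (measure_mono_ae (t := Metric.ball (0 : Rd d) r) hsub).trans ?_
  rw [Measure.addHaar_ball _ _ hr0, finrank_euclideanSpace_fin, hrd]
  exact (ENNReal.div_mul_cancel ballVol_ne_zero ballVol_ne_top).le

theorem meanBound_wt [NeZero d] {θm : ℝ} (hθ : 0 ≤ θ) (hθm : θ ≤ θm) (hθm1 : θm < 1) :
    MeanBound θ (weakConst θm * (1 + ballVol d)) (wt (d := d) (-(d * θ))) :=
  ((distBound_wt hθ).meanBound (by linarith)).mono (ae_of_all _ fun _ => le_rfl) <|
    mul_le_mul' (weakConst_mono hθm) (rpow_le_one_add _ hθ (by linarith))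

/-- A function in `L^{1/θ,∞}_k` is integrable over the unit ball. -/
theorem LBound.setLIntegral_closedBall_le [NeZero d] {θm Xm : ℝ} (hθ : 0 ≤ θ) (hθm : θ ≤ θm)
    (hθm1 : θm < 1) (hX : k / d + θ ≤ Xm) (hXm : Xm < 1) (hA : A ≠ ∞)
    (hF : Measurable F) (h : LBound k θ A F) :
    ∫⁻ y in Metric.closedBall 0 1, F y ≤
      (1 + weakConst Xm * 2 * (1 + ballVol d)) * (1 + ballVol d) * A := by
  have hd : (0 : ℝ) < d := by exact_mod_cast Nat.pos_of_ne_zero (NeZero.ne d)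
  have hvol : volume (Metric.closedBall (0 : Rd d) 1) = ballVol d :=
    Measure.addHaar_closedBall_eq_addHaar_ball _ _ _
  have hvt : volume (Metric.closedBall (0 : Rd d) 1) ≠ ∞ := hvol ▸ ballVol_ne_top
  rcases le_total k 0 with hk | hk
  · calc ∫⁻ y in Metric.closedBall 0 1, F y ≤ ∫⁻ y in Metric.closedBall 0 1, wt k y * F y := by
          refine setLIntegral_mono_ae' measurableSet_closedBall ?_
          filter_upwards [ae_ne_zero] with y hy0 hy
          have : 1 ≤ wt k y := by
            rw [wt, ENNReal.one_le_ofReal]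
            exact Real.one_le_rpow_of_pos_of_le_one_of_nonpos (norm_pos_iff.2 hy0)
              (by simpa using hy) hk
          calc F y = 1 * F y := (one_mul _).symm
            _ ≤ _ := by gcongr
      _ ≤ A * ballVol d ^ (1 - θ) := by
          have := h _ measurableSet_closedBall hvt
          rwa [hvol] at this
      _ ≤ 1 * (1 + ballVol d) * A := by
          rw [one_mul, mul_comm]
          gcongr
          exact rpow_le_one_add _ (by linarith) (by linarith)
      _ ≤ _ := by gcongr; exact le_self_add
  · have hkd : 0 ≤ k / d := by positivity
    have hd₁ := distBound_wt (d := d) hkd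
    rw [mul_div_cancel₀ _ hd.ne'] at hd₁
    have hd₂ := MeanBound.distBound ((measurable_wt k).mul hF).aemeasurable hθ hA h
    have hm := (((hd₁.mul hd₂).congr (G := F) (by
      filter_upwards [ae_ne_zero] with y hy
      rw [Pi.mul_apply, ← mul_assoc, ← wt_add _ _ hy, neg_add_cancel, wt_zero, one_mul])).meanBound
      (by linarith)) _ measurableSet_closedBall hvt
    refine hm.trans ?_
    rw [hvol]
    have h2 : ENNReal.ofReal (2 ^ (k / d + θ)) ≤ 2 := by
      have : (2 : ℝ) ^ (k / d + θ) ≤ 2 ^ (1 : ℝ) :=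
        Real.rpow_le_rpow_of_exponent_le (by norm_num) (by linarith)
      simpa using ENNReal.ofReal_le_ofReal this
    have h3 : ballVol d ^ (k / d) ≤ 1 + ballVol d := rpow_le_one_add _ hkd (by linarith)
    have h4 : ballVol d ^ (1 - (k / d + θ)) ≤ 1 + ballVol d :=
      rpow_le_one_add _ (by linarith) (by linarith)
    have h5 := weakConst_mono hX
    calc _ ≤ weakConst Xm * (2 * ((1 + ballVol d) * A)) * (1 + ballVol d) := by gcongr
      _ = weakConst Xm * 2 * (1 + ballVol d) * (1 + ballVol d) * A := by ring
      _ ≤ _ := by gcongr; exact le_add_self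

end Smoothing

section HeatKernel

variable {d : ℕ}

theorem measurable_gaussKernel :
    Measurable (fun z : ℝ × Rd d => gaussKernel z.1 z.2) := by
  unfold gaussKernel
  fun_prop

theorem continuous_gaussKernel (t : ℝ) : Continuous (gaussKernel (d := d) t) := by
  unfold gaussKernel
  fun_prop

theorem gaussKernel_nonneg {t : ℝ} (ht : 0 < t) (x : Rd d) : 0 ≤ gaussKernel t x := by
  unfold gaussKernel
  positivity

theorem gaussKernel_neg (t : ℝ) (x : Rd d) : gaussKernel t (-x) = gaussKernel t x := by
  simp [gaussKernel]

theorem gaussKernel_smul {c t : ℝ} (hc : 0 < c) (ht : 0 < t) (x : Rd d) :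
    gaussKernel (c ^ 2 * t) (c • x) = (c ^ d)⁻¹ * gaussKernel t x := by
  have h1 : (4 * Real.pi * (c ^ 2 * t)) ^ (-(d : ℝ) / 2) =
      (c ^ d)⁻¹ * (4 * Real.pi * t) ^ (-(d : ℝ) / 2) := by
    rw [show 4 * Real.pi * (c ^ 2 * t) = c ^ 2 * (4 * Real.pi * t) by ring,
      Real.mul_rpow (by positivity) (by positivity)]
    congr 1
    rw [← Real.rpow_natCast c 2, ← Real.rpow_mul hc.le, ← Real.rpow_natCast, ← Real.rpow_neg hc.le]
    congr 1
    push_cast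
    ring
  rw [gaussKernel, gaussKernel, h1, norm_smul, Real.norm_of_nonneg hc.le, mul_assoc]
  congr 3
  field_simp

theorem lintegral_comp_smul (F : Rd d → ℝ≥0∞) {c : ℝ} (hc : 0 < c) :
    ∫⁻ x, F (c • x) = ENNReal.ofReal ((c ^ d)⁻¹) * ∫⁻ x, F x := by
  have he : MeasurableEmbedding (fun x : Rd d => c • x) :=
    (Homeomorph.smulOfNeZero c hc.ne').measurableEmbedding
  have h := Measure.map_addHaar_smul (volume : Measure (Rd d)) hc.ne'
  rw [← he.lintegral_map, h, lintegral_smul_measure, finrank_euclideanSpace_fin,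
    abs_of_nonneg (by positivity), smul_eq_mul]

theorem gaussKernel_mul_gaussKernel {s r : ℝ} (hs : 0 < s) (hr : 0 < r) (x y w : Rd d) :
    gaussKernel s (x - w) * gaussKernel r (w - y) = gaussKernel (s + r) (x - y) *
      gaussKernel (s * r / (s + r)) (w - (s + r)⁻¹ • (r • x + s • y)) := by
  have hsr : 0 < s + r := by positivity
  have hc : (4 * Real.pi * s) ^ (-(d : ℝ) / 2) * (4 * Real.pi * r) ^ (-(d : ℝ) / 2) =
      (4 * Real.pi * (s + r)) ^ (-(d : ℝ) / 2) *
        (4 * Real.pi * (s * r / (s + r))) ^ (-(d : ℝ) / 2) := by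
    rw [← Real.mul_rpow (by positivity) (by positivity), ← Real.mul_rpow (by positivity)
      (by positivity)]
    congr 1
    field_simp
  have he : -‖x - w‖ ^ 2 / (4 * s) + -‖w - y‖ ^ 2 / (4 * r) = -‖x - y‖ ^ 2 / (4 * (s + r)) +
      -‖w - (s + r)⁻¹ • (r • x + s • y)‖ ^ 2 / (4 * (s * r / (s + r))) := by
    set a := x - w with ha
    set b := w - y with hb
    have h1 : x - y = a + b := by rw [ha, hb]; abel
    have h2 : w - (s + r)⁻¹ • (r • x + s • y) = (s + r)⁻¹ • (s • b - r • a) := by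
      have : w = (s + r)⁻¹ • ((s + r) • w) := by
        rw [smul_smul, inv_mul_cancel₀ hsr.ne', one_smul]
      conv_lhs => rw [this]
      rw [← smul_sub]
      congr 1
      rw [ha, hb, smul_sub, smul_sub, add_smul]
      abel
    rw [h1, h2, norm_smul, mul_pow, norm_add_sq_real, norm_sub_sq_real (s • b) (r • a),
      norm_smul, norm_smul, real_inner_smul_left, real_inner_smul_right, real_inner_comm a b,
      Real.norm_of_nonneg hs.le, Real.norm_of_nonneg hr.le,
      Real.norm_of_nonneg (inv_pos.2 hsr).le]
    field_simp
    ring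
  calc gaussKernel s (x - w) * gaussKernel r (w - y)
      = ((4 * Real.pi * s) ^ (-(d : ℝ) / 2) * (4 * Real.pi * r) ^ (-(d : ℝ) / 2)) *
        Real.exp (-‖x - w‖ ^ 2 / (4 * s) + -‖w - y‖ ^ 2 / (4 * r)) := by
        rw [Real.exp_add, gaussKernel, gaussKernel]; ring
    _ = _ := by rw [hc, he, Real.exp_add, gaussKernel, gaussKernel]; ring

theorem integral_gaussKernel {t : ℝ} (ht : 0 < t) : ∫ x : Rd d, gaussKernel t x = 1 := by
  have h : ∀ x : Rd d, gaussKernel t x =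
      (4 * Real.pi * t) ^ (-(d : ℝ) / 2) * Real.exp (-(4 * t)⁻¹ * ‖x‖ ^ 2) := fun x => by
    rw [gaussKernel]
    congr 2
    ring
  simp_rw [h]
  rw [integral_const_mul, GaussianFourier.integral_rexp_neg_mul_sq_norm (by positivity),
    finrank_euclideanSpace_fin, div_inv_eq_mul,
    show Real.pi * (4 * t) = 4 * Real.pi * t by ring, ← Real.rpow_add (by positivity)]
  simp [neg_div]

theorem integrable_gaussKernel {t : ℝ} (ht : 0 < t) : Integrable (gaussKernel (d := d) t) := by
  by_contra h
  have := integral_gaussKernel (d := d) ht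
  rw [integral_undef h] at this
  norm_num at this

theorem lintegral_gaussKernel {t : ℝ} (ht : 0 < t) :
    ∫⁻ x : Rd d, ENNReal.ofReal (gaussKernel t x) = 1 := by
  rw [← ofReal_integral_eq_lintegral_ofReal (integrable_gaussKernel ht)
    (ae_of_all _ (gaussKernel_nonneg ht)), integral_gaussKernel ht, ENNReal.ofReal_one]

theorem integral_gaussKernel_mul {s r : ℝ} (hs : 0 < s) (hr : 0 < r) (x y : Rd d) :
    ∫ w, gaussKernel s (x - w) * gaussKernel r (w - y) = gaussKernel (s + r) (x - y) := by
  simp_rw [gaussKernel_mul_gaussKernel hs hr]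
  rw [integral_const_mul, integral_sub_right_eq_self (fun w => gaussKernel (s * r / (s + r)) w),
    integral_gaussKernel (by positivity), mul_one]

theorem lintegral_gaussKernel_mul {s r : ℝ} (hs : 0 < s) (hr : 0 < r) (x y : Rd d) :
    ∫⁻ w, ENNReal.ofReal (gaussKernel s (x - w)) * ENNReal.ofReal (gaussKernel r (w - y)) =
      ENNReal.ofReal (gaussKernel (s + r) (x - y)) := by
  simp_rw [← ENNReal.ofReal_mul (gaussKernel_nonneg hs _), gaussKernel_mul_gaussKernel hs hr,
    ENNReal.ofReal_mul (gaussKernel_nonneg (add_pos hs hr) _)]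
  rw [lintegral_const_mul' _ _ ENNReal.ofReal_ne_top, lintegral_sub_right_eq_self
    (fun w => ENNReal.ofReal (gaussKernel (s * r / (s + r)) w)),
    lintegral_gaussKernel (by positivity), mul_one]

/-- The heat semigroup on extended nonnegative functions. -/
def heatP (t : ℝ) (F : Rd d → ℝ≥0∞) (x : Rd d) : ℝ≥0∞ :=
  ∫⁻ y, ENNReal.ofReal (gaussKernel t (x - y)) * F y

theorem heatP_mono {F G : Rd d → ℝ≥0∞} (h : F ≤ᵐ[volume] G) (t : ℝ) (x : Rd d) :
    heatP t F x ≤ heatP t G x :=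
  lintegral_mono_ae (h.mono fun _ hy => mul_le_mul_right hy _)

theorem heatP_congr {F G : Rd d → ℝ≥0∞} (h : F =ᵐ[volume] G) (t : ℝ) (x : Rd d) :
    heatP t F x = heatP t G x :=
  lintegral_congr_ae (h.mono fun _ hy => congrArg (_ * ·) hy)

theorem measurable_gauss_sub (t : ℝ) :
    Measurable (fun z : Rd d × Rd d => gaussKernel t (z.1 - z.2)) :=
  measurable_gaussKernel.comp (measurable_const.prodMk (measurable_fst.sub measurable_snd))

theorem measurable_gauss_left (t : ℝ) (x : Rd d) :
    Measurable (fun y : Rd d => ENNReal.ofReal (gaussKernel t (x - y))) :=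
  ((measurable_gauss_sub t).comp (measurable_const.prodMk measurable_id)).ennreal_ofReal

theorem heatP_const_mul {F : Rd d → ℝ≥0∞} {c : ℝ≥0∞} (hc : c ≠ ∞) (t : ℝ) (x : Rd d) :
    heatP t (fun y => c * F y) x = c * heatP t F x := by
  unfold heatP
  rw [← lintegral_const_mul' _ _ hc]
  exact lintegral_congr fun y => by ring

theorem aemeasurable_heatP {F : Rd d → ℝ≥0∞} (hF : AEMeasurable F volume) (t : ℝ) :
    Measurable (heatP t F) := by
  have : heatP t F = heatP t (hF.mk F) := funext (heatP_congr hF.ae_eq_mk t)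
  rw [this]
  exact Measurable.lintegral_prod_right ((measurable_gauss_sub t).ennreal_ofReal.mul
    (hF.measurable_mk.comp measurable_snd))

theorem heatP_heatP {s r : ℝ} (hs : 0 < s) (hr : 0 < r) {F : Rd d → ℝ≥0∞}
    (hF : AEMeasurable F volume) (x : Rd d) : heatP s (heatP r F) x = heatP (s + r) F x := by
  wlog hFm : Measurable F generalizing F
  · have e : heatP r F = heatP r (hF.mk F) := funext (heatP_congr hF.ae_eq_mk r)
    rw [e, this hF.measurable_mk.aemeasurable hF.measurable_mk, heatP_congr hF.ae_eq_mk]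
  unfold heatP
  simp_rw [← lintegral_const_mul' _ _ (ENNReal.ofReal_ne_top (r := gaussKernel s _))]
  rw [lintegral_lintegral_swap]
  · refine lintegral_congr fun y => ?_
    rw [← lintegral_gaussKernel_mul hs hr, ← lintegral_mul_const]
    · exact lintegral_congr fun w => by ring
    · exact (measurable_gauss_left s x).mul ((measurable_gauss_sub r).comp
        (measurable_id.prodMk measurable_const)).ennreal_ofReal
  · refine Measurable.aemeasurable ?_
    exact ((measurable_gauss_left s x).comp measurable_fst).mul
      ((measurable_gauss_sub r).ennreal_ofReal.mul (hFm.comp measurable_snd))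

theorem heatP_smul {c t : ℝ} (hc : 0 < c) (ht : 0 < t) (F : Rd d → ℝ≥0∞) (x : Rd d) :
    heatP (c ^ 2 * t) F (c • x) = heatP t (fun y => F (c • y)) x := by
  have hcd : 0 < c ^ d := by positivity
  have h := lintegral_comp_smul
    (fun y => ENNReal.ofReal (gaussKernel (c ^ 2 * t) (c • x - y)) * F y) hc
  have h' : ∀ y, ENNReal.ofReal (gaussKernel (c ^ 2 * t) (c • x - c • y)) * F (c • y) =
      ENNReal.ofReal ((c ^ d)⁻¹) * (ENNReal.ofReal (gaussKernel t (x - y)) * F (c • y)) := fun y => by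
    rw [← smul_sub, gaussKernel_smul hc ht, ENNReal.ofReal_mul (by positivity), mul_assoc]
  simp_rw [h'] at h
  rw [lintegral_const_mul' _ _ ENNReal.ofReal_ne_top] at h
  have h0 : ENNReal.ofReal ((c ^ d)⁻¹) ≠ 0 := by simpa using hcd
  exact ((ENNReal.mul_right_inj h0 ENNReal.ofReal_ne_top).1 h).symm

theorem enorm_heatFun_le {𝕜 : Type*} [RCLike 𝕜] (f : Rd d → 𝕜) {t : ℝ} (ht : 0 < t) (x : Rd d) :
    ‖heatFun f t x‖ₑ ≤ heatP t (fun y => ‖f y‖ₑ) x := by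
  refine (enorm_integral_le_lintegral_enorm _).trans (le_of_eq ?_)
  refine lintegral_congr fun y => ?_
  rw [enorm_smul, Real.enorm_of_nonneg (gaussKernel_nonneg ht _)]

variable {k θ : ℝ} {A : ℝ≥0∞} {F : Rd d → ℝ≥0∞}

theorem LBound.comp_smul (h : LBound k θ A F) (hθ : θ ≤ 1) {c : ℝ} (hc : 0 < c) :
    LBound k θ (ENNReal.ofReal (c ^ (-(k + d * θ))) * A) (fun x => F (c • x)) := by
  intro E hE hE'
  have hcd : 0 < c ^ d := by positivity
  have he : MeasurableEmbedding (fun x : Rd d => c • x) :=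
    (Homeomorph.smulOfNeZero c hc.ne').measurableEmbedding
  set E' : Set (Rd d) := (fun x => c⁻¹ • x) ⁻¹' E with hE'def
  have hEm : MeasurableSet E' := (measurable_const_smul c⁻¹) hE
  have hvol : volume E' = ENNReal.ofReal (c ^ d) * volume E := by
    rw [hE'def, Measure.addHaar_preimage_smul _ (inv_pos.2 hc).ne', finrank_euclideanSpace_fin,
      inv_pow, inv_inv, abs_of_pos hcd]
  have h1 := h E' hEm (by rw [hvol]; exact ENNReal.mul_ne_top ENNReal.ofReal_ne_top hE')
  have h2 := lintegral_comp_smul (E'.indicator fun x => wt k x * F x) hc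
  have h3 : ∀ x, (E'.indicator fun x => wt k x * F x) (c • x) =
      ENNReal.ofReal (c ^ k) * E.indicator (fun x => wt k x * F (c • x)) x := fun x => by
    have : c • x ∈ E' ↔ x ∈ E := by
      rw [hE'def, mem_preimage, smul_smul, inv_mul_cancel₀ hc.ne', one_smul]
    by_cases hx : x ∈ E
    · rw [indicator_of_mem (this.2 hx), indicator_of_mem hx, wt_smul k hc, mul_assoc]
    · rw [indicator_of_notMem (mt this.1 hx), indicator_of_notMem hx, mul_zero]
  simp_rw [h3] at h2
  rw [lintegral_const_mul' _ _ ENNReal.ofReal_ne_top, lintegral_indicator hE,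
    lintegral_indicator hEm] at h2
  have hck : ENNReal.ofReal (c ^ (-k)) * ENNReal.ofReal (c ^ k) = 1 := by
    rw [← ENNReal.ofReal_mul (by positivity), ← Real.rpow_add hc]
    simp
  calc ∫⁻ x in E, wt k x * F (c • x)
      = ENNReal.ofReal (c ^ (-k)) * (ENNReal.ofReal (c ^ k) * ∫⁻ x in E, wt k x * F (c • x)) := by
        rw [← mul_assoc, hck, one_mul]
    _ = ENNReal.ofReal (c ^ (-k)) * (ENNReal.ofReal ((c ^ d)⁻¹) *
          ∫⁻ x in E', wt k x * F x) := by rw [h2]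
    _ ≤ ENNReal.ofReal (c ^ (-k)) * (ENNReal.ofReal ((c ^ d)⁻¹) *
          (A * (ENNReal.ofReal (c ^ d) * volume E) ^ (1 - θ))) := by
        rw [← hvol]
        gcongr
    _ = _ := by
        rw [ENNReal.mul_rpow_of_nonneg _ _ (by linarith), ENNReal.ofReal_rpow_of_pos hcd]
        have : ENNReal.ofReal (c ^ (-k)) * ENNReal.ofReal ((c ^ d)⁻¹) *
            ENNReal.ofReal ((c ^ d) ^ (1 - θ)) = ENNReal.ofReal (c ^ (-(k + d * θ))) := by
          rw [← ENNReal.ofReal_mul (by positivity), ← ENNReal.ofReal_mul (by positivity)]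
          congr 1
          rw [← Real.rpow_natCast, ← Real.rpow_neg hc.le, ← Real.rpow_mul hc.le,
            ← Real.rpow_add hc, ← Real.rpow_add hc]
          congr 1
          ring
        rw [← this]
        ring

end HeatKernel

section SmoothingEstimate

variable {d : ℕ}

theorem gaussKernel_one_le {K : ℝ} (z : Rd d) :
    gaussKernel 1 z ≤ Real.exp ((K + 1) ^ 2) * Real.exp (-(K + 1) * ‖z‖) := by
  rw [gaussKernel, ← Real.exp_add]
  have h1 : (4 * Real.pi * 1) ^ (-(d : ℝ) / 2) ≤ 1 := by
    refine Real.rpow_le_one_of_one_le_of_nonpos ?_ ?_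
    · nlinarith [Real.pi_gt_three]
    · have : (0 : ℝ) ≤ d := by positivity
      linarith
  calc _ ≤ 1 * Real.exp ((K + 1) ^ 2 + -(K + 1) * ‖z‖) := by
        gcongr
        nlinarith [sq_nonneg (K + 1 - ‖z‖ / 2)]
    _ = _ := one_mul _

theorem div_norm_rpow_le {K k : ℝ} (hk : |k| ≤ K) {x y : Rd d} (hx : 1 ≤ ‖x‖) (hy : 1 ≤ ‖y‖) :
    ‖x‖ ^ k * ‖y‖ ^ (-k) ≤ Real.exp (K * ‖x - y‖) := by
  have hx0 : 0 < ‖x‖ := by linarith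
  have hy0 : 0 < ‖y‖ := by linarith
  have key : ∀ u v : Rd d, 1 ≤ ‖v‖ → ‖u‖ ≤ ‖v‖ * Real.exp ‖u - v‖ := fun u v hv => by
    have h1 : ‖u‖ ≤ ‖u - v‖ + ‖v‖ := by simpa using norm_add_le (u - v) v
    have h2 := Real.add_one_le_exp ‖u - v‖
    nlinarith [norm_nonneg (u - v)]
  rw [Real.rpow_neg hy0.le, ← div_eq_mul_inv, ← Real.div_rpow hx0.le hy0.le]
  have hexp : ∀ m : ℝ, |m| = |k| → 0 ≤ m → Real.exp ‖x - y‖ ^ m ≤ Real.exp (K * ‖x - y‖) :=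
    fun m hm hm0 => by
      rw [← Real.exp_mul, Real.exp_le_exp, mul_comm]
      gcongr
      rw [← abs_of_nonneg hm0, hm]
      exact hk
  rcases le_total 0 k with h0 | h0
  · refine (Real.rpow_le_rpow (by positivity) ?_ h0).trans (hexp k rfl h0)
    rw [div_le_iff₀ hy0, mul_comm]
    exact key x y hy
  · rw [← neg_neg k, Real.rpow_neg_eq_inv_rpow, inv_div]
    refine (Real.rpow_le_rpow (by positivity) ?_ (by linarith)).trans
      (hexp (-k) (abs_neg k) (by linarith))
    rw [div_le_iff₀ hx0, mul_comm, norm_sub_rev]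
    exact key y x hx

/-- The kernel at a source point outside the unit ball. -/
theorem gaussKernel_mul_wt_le_expNorm {K k₁ k₂ : ℝ} (hk₁ : |k₁| ≤ K) (hk : k₂ ≤ k₁) {x y : Rd d}
    (hy : 1 ≤ ‖y‖) :
    (if ‖x‖ ≤ 1 then 1 else wt k₂ x) * (ENNReal.ofReal (gaussKernel 1 (x - y)) * wt (-k₁) y) ≤
      ENNReal.ofReal (Real.exp ((K + 1) ^ 2)) * expNorm (x - y) := by
  have hK : 0 ≤ K := (abs_nonneg _).trans hk₁
  have hG := gaussKernel_one_le (K := K) (x - y)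
  have hy0 : 0 < ‖y‖ := by linarith
  set r := ‖x - y‖ with hr
  have hsplit : Real.exp (K * r) * Real.exp (-(K + 1) * r) = Real.exp (-r) := by
    rw [← Real.exp_add]; ring_nf
  have main : ∀ m : ℝ, 0 ≤ m → m * ‖y‖ ^ (-k₁) ≤ Real.exp (K * r) →
      ENNReal.ofReal m * (ENNReal.ofReal (gaussKernel 1 (x - y)) * wt (-k₁) y) ≤
      ENNReal.ofReal (Real.exp ((K + 1) ^ 2)) * expNorm (x - y) := fun m hm h => by
    rw [wt, expNorm, ← ENNReal.ofReal_mul (gaussKernel_nonneg one_pos _), ← ENNReal.ofReal_mul hm,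
      ← ENNReal.ofReal_mul (by positivity)]
    refine ENNReal.ofReal_le_ofReal ?_
    calc m * (gaussKernel 1 (x - y) * ‖y‖ ^ (-k₁))
        = (m * ‖y‖ ^ (-k₁)) * gaussKernel 1 (x - y) := by ring
      _ ≤ Real.exp (K * r) * (Real.exp ((K + 1) ^ 2) * Real.exp (-(K + 1) * r)) := by
          gcongr
          exact gaussKernel_nonneg one_pos _
      _ = Real.exp ((K + 1) ^ 2) * (Real.exp (K * r) * Real.exp (-(K + 1) * r)) := by ring
      _ = _ := by rw [hsplit]
  split_ifs with hx
  · have h := main 1 zero_le_one (by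
      rw [one_mul]
      have h1 : ‖y‖ ≤ Real.exp r := by
        have h1 : ‖y‖ ≤ ‖x - y‖ + ‖x‖ := by
          rw [norm_sub_rev]; simpa using norm_add_le (y - x) x
        have h2 := Real.add_one_le_exp r
        linarith
      calc ‖y‖ ^ (-k₁) ≤ ‖y‖ ^ K :=
            Real.rpow_le_rpow_of_exponent_le hy ((neg_le_abs k₁).trans hk₁)
        _ ≤ Real.exp r ^ K := by gcongr
        _ = Real.exp (K * r) := by rw [← Real.exp_mul, mul_comm])
    rwa [ENNReal.ofReal_one] at h
  · have hx1 : 1 ≤ ‖x‖ := (not_le.1 hx).le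
    refine main (‖x‖ ^ k₂) (by positivity) ?_
    refine le_trans ?_ (div_norm_rpow_le hk₁ hx1 hy)
    gcongr

/-- The kernel at a source point in the unit ball. -/
theorem gaussKernel_le_exp_norm {K : ℝ} (hK : 0 ≤ K) {x y : Rd d} (hy : ‖y‖ ≤ 1) :
    gaussKernel 1 (x - y) ≤ Real.exp ((K + 1) ^ 2 + (K + 1)) * Real.exp (-(K + 1) * ‖x‖) := by
  refine (gaussKernel_one_le (K := K) (x - y)).trans ?_
  rw [← Real.exp_add, ← Real.exp_add, Real.exp_le_exp]
  have h1 : ‖x‖ ≤ ‖x - y‖ + ‖y‖ := by simpa using norm_add_le (x - y) y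
  nlinarith

theorem wt_mul_exp_le_expNorm {K k : ℝ} (hk : |k| ≤ K) {x : Rd d} (hx : 1 ≤ ‖x‖) :
    wt k x * ENNReal.ofReal (Real.exp (-(K + 1) * ‖x‖)) ≤ expNorm x := by
  rw [wt, expNorm, ← ENNReal.ofReal_mul (by positivity)]
  refine ENNReal.ofReal_le_ofReal ?_
  have hK : 0 ≤ K := (abs_nonneg _).trans hk
  calc ‖x‖ ^ k * Real.exp (-(K + 1) * ‖x‖) ≤ Real.exp (K * ‖x‖) * Real.exp (-(K + 1) * ‖x‖) := by
        gcongr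
        calc ‖x‖ ^ k ≤ ‖x‖ ^ K :=
              Real.rpow_le_rpow_of_exponent_le hx ((le_abs_self k).trans hk)
          _ ≤ Real.exp ‖x‖ ^ K := by
              gcongr
              linarith [Real.add_one_le_exp ‖x‖]
          _ = Real.exp (K * ‖x‖) := by rw [← Real.exp_mul, mul_comm]
    _ = Real.exp (-‖x‖) := by rw [← Real.exp_add]; ring_nf

/-- Conditions on a source pair `(k₁,θ₁)` and a target pair `(k₂,θ₂)` under which the heat semigroup
is smoothing, with constants depending only on `K`, `θm`, `Xm`. -/
structure SmoothingPair (d : ℕ) (K θm Xm k₁ θ₁ k₂ θ₂ : ℝ) : Prop where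
  abs_source : |k₁| ≤ K
  abs_target : |k₂| ≤ K
  weight_le : k₂ ≤ k₁
  nonneg : 0 ≤ θ₂
  le : θ₂ ≤ θ₁
  le_max : θ₁ ≤ θm
  target_nonneg : 0 ≤ k₂ / d + θ₂
  source_le : k₁ / d + θ₁ ≤ Xm

theorem exists_smoothing_one [NeZero d] {K θm Xm : ℝ} (hθm : θm < 1) (hXm : Xm < 1) :
    ∃ C : ℝ≥0∞, C ≠ ∞ ∧ ∀ (k₁ θ₁ k₂ θ₂ : ℝ) (F : Rd d → ℝ≥0∞) (A : ℝ≥0∞),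
      SmoothingPair d K θm Xm k₁ θ₁ k₂ θ₂ → Measurable F → A ≠ ∞ → LBound k₁ θ₁ A F →
      LBound k₂ θ₂ (C * A) (heatP 1 F) := by
  set c₁ := ∫⁻ z : Rd d, expNorm z with hc₁
  have hc₁t : c₁ ≠ ∞ := lintegral_expNorm_ne_top
  set v := ballVol d with hv
  have hvt : v ≠ ∞ := ballVol_ne_top
  set c₂ := (1 + weakConst Xm * 2 * (1 + v)) * (1 + v) with hc₂
  set c₃ := ENNReal.ofReal (Real.exp 1) * v⁻¹ * c₁ * (1 + v) with hc₃
  set E := ENNReal.ofReal (Real.exp ((K + 1) ^ 2)) with hE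
  set E' := ENNReal.ofReal (Real.exp ((K + 1) ^ 2 + (K + 1))) with hE'
  have h1v : 1 + v ≠ ∞ := ENNReal.add_ne_top.2 ⟨ENNReal.one_ne_top, hvt⟩
  have hc₂t : c₂ ≠ ∞ := ENNReal.mul_ne_top (ENNReal.add_ne_top.2 ⟨ENNReal.one_ne_top,
    ENNReal.mul_ne_top (ENNReal.mul_ne_top (weakConst_ne_top hXm) (by norm_num)) h1v⟩) h1v
  have hc₃t : c₃ ≠ ∞ := ENNReal.mul_ne_top (ENNReal.mul_ne_top (ENNReal.mul_ne_top
    ENNReal.ofReal_ne_top (ENNReal.inv_ne_top.2 ballVol_ne_zero)) hc₁t) h1v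
  have hEt : E ≠ ∞ := ENNReal.ofReal_ne_top
  have hE't : E' ≠ ∞ := ENNReal.ofReal_ne_top
  have hw : weakConst θm * (1 + v) ≠ ∞ := ENNReal.mul_ne_top (weakConst_ne_top hθm) h1v
  refine ⟨(E' * c₂ + E * c₃) * (weakConst θm * (1 + v)) + E' * c₂ * (1 + c₁) + E * (c₁ + c₃),
    ?_, fun k₁ θ₁ k₂ θ₂ F A hp hF hA h => ?_⟩
  · finiteness
  have hK : 0 ≤ K := (abs_nonneg _).trans hp.abs_source
  have hθ₁0 : 0 ≤ θ₁ := hp.nonneg.trans hp.le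
  have hθ₁1 : θ₁ < 1 := hp.le_max.trans_lt hθm
  set g : Rd d → ℝ≥0∞ := fun y => wt k₁ y * F y with hg
  have hgm : Measurable g := (measurable_wt k₁).mul hF
  have hgb : MeanBound θ₁ A g := h
  set H := expConv g with hH
  have hHle : ∀ x, H x ≤ c₃ * A := fun x => hgb.expConv_le hθ₁0 hθ₁1.le hgm x
  have hHm : Measurable H := Measurable.lintegral_prod_right
    ((measurable_expNorm.comp (measurable_fst.sub measurable_snd)).mul (hgm.comp measurable_snd))
  have hHb : MeanBound θ₂ ((c₁ + c₃) * A) H := by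
    have h1 : MeanBound θ₁ ((c₁ + c₃) * A) H :=
      (hgb.expConv hθ₁1.le hgm).mono (ae_of_all _ fun _ => le_rfl) (by gcongr; exact le_self_add)
    refine h1.of_le_const hp.nonneg hp.le fun x => (hHle x).trans (by gcongr; exact le_add_self)
  have hin := h.setLIntegral_closedBall_le hθ₁0 hp.le_max hθm hp.source_le hXm hA hF
  set B := Metric.closedBall (0 : Rd d) 1 with hB
  have hI1 : ∀ x, ∫⁻ y in B, ENNReal.ofReal (gaussKernel 1 (x - y)) * F y ≤
      E' * ENNReal.ofReal (Real.exp (-(K + 1) * ‖x‖)) * (c₂ * A) := fun x => by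
    calc _ ≤ ∫⁻ y in B, E' * ENNReal.ofReal (Real.exp (-(K + 1) * ‖x‖)) * F y := by
          refine setLIntegral_mono' measurableSet_closedBall fun y hy => ?_
          gcongr
          rw [← ENNReal.ofReal_mul (by positivity)]
          exact ENNReal.ofReal_le_ofReal (gaussKernel_le_exp_norm hK (by simpa [hB] using hy))
      _ = E' * ENNReal.ofReal (Real.exp (-(K + 1) * ‖x‖)) * ∫⁻ y in B, F y := by
          rw [lintegral_const_mul' _ _ (by finiteness)]
      _ ≤ _ := by gcongr
  have hI2 : ∀ x, (if ‖x‖ ≤ 1 then 1 else wt k₂ x) *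
      ∫⁻ y in Bᶜ, ENNReal.ofReal (gaussKernel 1 (x - y)) * F y ≤ E * H x := fun x => by
    rw [← lintegral_const_mul' _ _ (by split_ifs; exacts [ENNReal.one_ne_top, wt_ne_top _ _])]
    calc _ ≤ ∫⁻ y in Bᶜ, E * (expNorm (x - y) * g y) := by
          refine setLIntegral_mono' measurableSet_closedBall.compl fun y hy => ?_
          have hy1 : 1 < ‖y‖ := by simpa [hB] using hy
          have hy0 : y ≠ 0 := norm_pos_iff.1 (by linarith)
          have hFg : F y = wt (-k₁) y * g y := by
            rw [hg, ← mul_assoc, ← wt_add _ _ hy0, neg_add_cancel, wt_zero, one_mul]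
          rw [hFg]
          calc _ = (if ‖x‖ ≤ 1 then 1 else wt k₂ x) *
                (ENNReal.ofReal (gaussKernel 1 (x - y)) * wt (-k₁) y) * g y := by ring
            _ ≤ E * expNorm (x - y) * g y := mul_le_mul_left
                (gaussKernel_mul_wt_le_expNorm hp.abs_source hp.weight_le hy1.le) _
            _ = _ := by ring
      _ ≤ ∫⁻ y, E * (expNorm (x - y) * g y) := setLIntegral_le_lintegral _ _
      _ = E * H x := lintegral_const_mul' _ _ hEt
  have hsplit : ∀ x, heatP 1 F x =
      (∫⁻ y in B, ENNReal.ofReal (gaussKernel 1 (x - y)) * F y) +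
      ∫⁻ y in Bᶜ, ENNReal.ofReal (gaussKernel 1 (x - y)) * F y := fun x =>
    (lintegral_add_compl _ measurableSet_closedBall).symm
  have hd : (0 : ℝ) < d := by exact_mod_cast Nat.pos_of_ne_zero (NeZero.ne d)
  have hpt : ∀ᵐ x, wt k₂ x * heatP 1 F x ≤ (E' * c₂ + E * c₃) * A * wt (-(d * θ₂)) x +
      E' * c₂ * A * expNorm x + E * H x := by
    filter_upwards [ae_ne_zero] with x hx0
    have hx0' := norm_pos_iff.2 hx0
    rw [hsplit]
    by_cases hx : ‖x‖ ≤ 1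
    · refine le_trans ?_ (le_self_add.trans le_self_add)
      have h2 := hI2 x
      rw [if_pos hx, one_mul] at h2
      have hwt : wt k₂ x ≤ wt (-(d * θ₂)) x := by
        refine ENNReal.ofReal_le_ofReal (Real.rpow_le_rpow_of_exponent_ge hx0' hx ?_)
        have := hp.target_nonneg
        rw [div_add' _ _ _ hd.ne', le_div_iff₀ hd] at this
        linarith
      have hexp : ENNReal.ofReal (Real.exp (-(K + 1) * ‖x‖)) ≤ 1 := by
        rw [ENNReal.ofReal_le_one, Real.exp_le_one_iff]
        nlinarith
      calc _ ≤ wt (-(d * θ₂)) x * (E' * 1 * (c₂ * A) + E * (c₃ * A)) := by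
            gcongr
            · exact (hI1 x).trans (by gcongr)
            · exact h2.trans (by gcongr; exact hHle x)
        _ = _ := by ring
    · have h2 := hI2 x
      rw [if_neg hx] at h2
      rw [mul_add, add_assoc]
      refine le_trans ?_ le_add_self
      refine add_le_add ?_ h2
      calc _ ≤ wt k₂ x * (E' * ENNReal.ofReal (Real.exp (-(K + 1) * ‖x‖)) * (c₂ * A)) := by
            gcongr; exact hI1 x
        _ = E' * c₂ * A * (wt k₂ x * ENNReal.ofReal (Real.exp (-(K + 1) * ‖x‖))) := by ring
        _ ≤ _ := by gcongr; exact wt_mul_exp_le_expNorm hp.abs_target (not_le.1 hx).le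
  have hθ₂m : θ₂ ≤ θm := hp.le.trans hp.le_max
  have m1 := (meanBound_wt (d := d) hp.nonneg hθ₂m hθm).const_mul
    (c := (E' * c₂ + E * c₃) * A) (by finiteness)
  have m2 := (meanBound_expNorm (d := d) hp.nonneg (by linarith)).const_mul
    (c := E' * c₂ * A) (by finiteness)
  have m3 := hHb.const_mul hEt
  have hm1 : Measurable fun x : Rd d => (E' * c₂ + E * c₃) * A * wt (-(d * θ₂)) x :=
    (measurable_wt _).const_mul _
  have hm2 : Measurable fun x : Rd d => E' * c₂ * A * expNorm x := measurable_expNorm.const_mul _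
  refine MeanBound.mono (((m1.add hm1.aemeasurable m2).add (hm1.add hm2).aemeasurable m3)) hpt ?_
  refine le_of_eq ?_
  ring

/-- The smoothing estimate for the heat semigroup between weighted weak Lebesgue spaces. -/
theorem exists_smoothing [NeZero d] (K : ℝ) {θm Xm : ℝ} (hθm : θm < 1) (hXm : Xm < 1) :
    ∃ C : ℝ≥0∞, C ≠ ∞ ∧ ∀ (k₁ θ₁ k₂ θ₂ : ℝ) (F : Rd d → ℝ≥0∞) (A : ℝ≥0∞) (t : ℝ), 0 < t →
      SmoothingPair d K θm Xm k₁ θ₁ k₂ θ₂ → AEMeasurable F volume → A ≠ ∞ → LBound k₁ θ₁ A F →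
      LBound k₂ θ₂ (C * ENNReal.ofReal (t ^ (-(d / 2 * ((k₁ / d + θ₁) - (k₂ / d + θ₂))))) * A)
        (heatP t F) := by
  obtain ⟨C, hC, h⟩ := exists_smoothing_one (d := d) (K := K) hθm hXm
  refine ⟨C, hC, fun k₁ θ₁ k₂ θ₂ F A t ht hp hF hA hb => ?_⟩
  have hd : (0 : ℝ) < d := by exact_mod_cast Nat.pos_of_ne_zero (NeZero.ne d)
  wlog hFm : Measurable F generalizing F
  · have e : heatP t F = heatP t (hF.mk F) := funext (heatP_congr hF.ae_eq_mk t)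
    rw [e]
    exact this _ hF.measurable_mk.aemeasurable (hb.mono hF.ae_eq_mk.symm.le le_rfl)
      hF.measurable_mk
  have hs : 0 < Real.sqrt t := Real.sqrt_pos.2 ht
  have hθ₁1 : θ₁ ≤ 1 := hp.le_max.trans hθm.le
  have h1 := h _ _ _ _ _ _ hp (hFm.comp (measurable_const_smul (Real.sqrt t)))
    (ENNReal.mul_ne_top ENNReal.ofReal_ne_top hA) (hb.comp_smul hθ₁1 hs)
  have h2 := h1.comp_smul (hp.le.trans hθ₁1) (inv_pos.2 hs)
  have e : (fun x : Rd d => heatP 1 (F ∘ fun x => Real.sqrt t • x) ((Real.sqrt t)⁻¹ • x)) =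
      heatP t F := by
    funext x
    have := heatP_smul hs one_pos F ((Real.sqrt t)⁻¹ • x)
    rw [Real.sq_sqrt ht.le, mul_one, smul_smul, mul_inv_cancel₀ hs.ne', one_smul] at this
    exact this.symm
  rw [← e]
  refine h2.mono (ae_of_all _ fun _ => le_rfl) (le_of_eq ?_)
  have hpow : ENNReal.ofReal ((Real.sqrt t)⁻¹ ^ (-(k₂ + d * θ₂))) *
      ENNReal.ofReal (Real.sqrt t ^ (-(k₁ + d * θ₁))) =
      ENNReal.ofReal (t ^ (-(d / 2 * ((k₁ / d + θ₁) - (k₂ / d + θ₂))))) := by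
    rw [← ENNReal.ofReal_mul (by positivity), Real.inv_rpow hs.le, Real.rpow_neg hs.le, inv_inv,
      ← Real.rpow_add hs, Real.sqrt_eq_rpow, ← Real.rpow_mul ht.le]
    congr 2
    field_simp
    ring
  rw [← hpow]
  ring

end SmoothingEstimate

/-! ### Time integrals -/

section TimeIntegrals

theorem setLIntegral_rpow_sub {a s t : ℝ} (ha : a < 1) (hst : s ≤ t) :
    ∫⁻ τ in Ioo s t, ENNReal.ofReal ((t - τ) ^ (-a)) =
      ENNReal.ofReal ((t - s) ^ (1 - a) / (1 - a)) := by
  have hint : IntervalIntegrable (fun τ => (t - τ) ^ (-a)) volume s t := by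
    have := (intervalIntegral.intervalIntegrable_rpow' (a := t - s) (b := 0)
      (r := -a) (by linarith)).comp_sub_left t
    simpa using this
  rw [restrict_Ioo_eq_restrict_Ioc, ← ofReal_integral_eq_lintegral_ofReal
    ((intervalIntegrable_iff_integrableOn_Ioc_of_le hst).1 hint)]
  · rw [← intervalIntegral.integral_of_le hst,
      intervalIntegral.integral_comp_sub_left (fun x => x ^ (-a)) t,
      integral_rpow (Or.inl (by linarith))]
    congr 1
    rw [sub_self, show -a + 1 = 1 - a by ring, Real.zero_rpow (by linarith), sub_zero]
  · refine (ae_restrict_iff' measurableSet_Ioc).2 (ae_of_all _ fun τ hτ => ?_)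
    exact Real.rpow_nonneg (by linarith [hτ.2]) _

theorem setLIntegral_rpow {c t : ℝ} (hc : c < 1) (ht : 0 ≤ t) :
    ∫⁻ τ in Ioo 0 t, ENNReal.ofReal (τ ^ (-c)) = ENNReal.ofReal (t ^ (1 - c) / (1 - c)) := by
  rw [restrict_Ioo_eq_restrict_Ioc, ← ofReal_integral_eq_lintegral_ofReal
    ((intervalIntegrable_iff_integrableOn_Ioc_of_le ht).1
      (intervalIntegral.intervalIntegrable_rpow' (by linarith)))]
  · rw [← intervalIntegral.integral_of_le ht, integral_rpow (Or.inl (by linarith))]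
    congr 1
    rw [show -c + 1 = 1 - c by ring, Real.zero_rpow (by linarith), sub_zero]
  · refine (ae_restrict_iff' measurableSet_Ioc).2 (ae_of_all _ fun τ hτ => ?_)
    exact Real.rpow_nonneg hτ.1.le _

theorem setLIntegral_beta_le {a c cm t : ℝ} (ha0 : 0 ≤ a) (ha : a < 1) (hc0 : 0 ≤ c)
    (hcm : c ≤ cm) (hcm1 : cm < 1) (ht : 0 < t) :
    ∫⁻ τ in Ioo 0 t, ENNReal.ofReal ((t - τ) ^ (-a) * τ ^ (-c)) ≤
      ENNReal.ofReal (2 * ((1 - cm)⁻¹ + (1 - a)⁻¹) * t ^ (1 - a - c)) := by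
  have ht2 : 0 < t / 2 := by positivity
  have hpt : ∀ τ ∈ Ioo 0 t, ENNReal.ofReal ((t - τ) ^ (-a) * τ ^ (-c)) ≤
      ENNReal.ofReal ((t / 2) ^ (-a)) * ENNReal.ofReal (τ ^ (-c)) +
      ENNReal.ofReal ((t / 2) ^ (-c)) * ENNReal.ofReal ((t - τ) ^ (-a)) := fun τ hτ => by
    have h1 : 0 < τ := hτ.1
    have h2 : 0 < t - τ := by linarith [hτ.2]
    rw [← ENNReal.ofReal_mul (by positivity), ← ENNReal.ofReal_mul (by positivity),
      ← ENNReal.ofReal_add (by positivity) (by positivity)]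
    refine ENNReal.ofReal_le_ofReal ?_
    rcases le_total τ (t / 2) with h | h
    · have : (t - τ) ^ (-a) ≤ (t / 2) ^ (-a) :=
        Real.rpow_le_rpow_of_nonpos ht2 (by linarith) (by linarith)
      have h3 : 0 ≤ (t / 2) ^ (-c) * (t - τ) ^ (-a) := by positivity
      have h4 : 0 ≤ τ ^ (-c) := by positivity
      nlinarith
    · have : τ ^ (-c) ≤ (t / 2) ^ (-c) :=
        Real.rpow_le_rpow_of_nonpos ht2 h (by linarith)
      have h3 : 0 ≤ (t / 2) ^ (-a) * τ ^ (-c) := by positivity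
      have h4 : 0 ≤ (t - τ) ^ (-a) := by positivity
      nlinarith
  refine (setLIntegral_mono' measurableSet_Ioo hpt).trans ?_
  have hm : Measurable fun τ : ℝ => ENNReal.ofReal ((t / 2) ^ (-a)) * ENNReal.ofReal (τ ^ (-c)) :=
    ((measurable_id.pow_const _).ennreal_ofReal).const_mul _
  rw [lintegral_add_left hm, lintegral_const_mul' _ _ ENNReal.ofReal_ne_top,
    lintegral_const_mul' _ _ ENNReal.ofReal_ne_top, setLIntegral_rpow (by linarith) ht.le,
    setLIntegral_rpow_sub ha ht.le, ← ENNReal.ofReal_mul (by positivity),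
    ← ENNReal.ofReal_mul (by positivity), sub_zero]
  have h1c : 0 < 1 - c := by linarith
  have h1m : 0 < 1 - cm := by linarith
  have h1a : 0 < 1 - a := by linarith
  rw [← ENNReal.ofReal_add (by positivity) (by positivity)]
  refine ENNReal.ofReal_le_ofReal ?_
  have hhalf : ∀ r : ℝ, 0 ≤ r → r ≤ 1 → (t / 2) ^ (-r) ≤ 2 * t ^ (-r) := fun r h0 h1 => by
    rw [Real.div_rpow ht.le (by norm_num), div_eq_mul_inv, ← Real.rpow_neg (by norm_num), neg_neg,
      mul_comm]
    gcongr
    calc (2 : ℝ) ^ r ≤ 2 ^ (1 : ℝ) := Real.rpow_le_rpow_of_exponent_le (by norm_num) h1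
      _ = 2 := Real.rpow_one 2
  have e1 : t ^ (-a) * t ^ (1 - c) = t ^ (1 - a - c) := by
    rw [← Real.rpow_add ht]; congr 1; ring
  have e2 : t ^ (-c) * t ^ (1 - a) = t ^ (1 - a - c) := by
    rw [← Real.rpow_add ht]; congr 1; ring
  calc (t / 2) ^ (-a) * (t ^ (1 - c) / (1 - c)) + (t / 2) ^ (-c) * (t ^ (1 - a) / (1 - a))
      ≤ (2 * t ^ (-a)) * (t ^ (1 - c) / (1 - cm)) + (2 * t ^ (-c)) * (t ^ (1 - a) / (1 - a)) := by
        gcongr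
        · exact hhalf a ha0 ha.le
        · exact hhalf c hc0 (by linarith)
    _ = 2 * ((1 - cm)⁻¹ * (t ^ (-a) * t ^ (1 - c)) + (1 - a)⁻¹ * (t ^ (-c) * t ^ (1 - a))) := by
        ring
    _ = _ := by rw [e1, e2]; ring

theorem setLIntegral_tail_le {a am c cm t : ℝ} (ham : a ≤ am) (ham1 : am < 1)
    (hc0 : 0 ≤ c) (hcm : c ≤ cm) (ht : 0 < t) :
    ∫⁻ τ in Ioo (t / 2) t, ENNReal.ofReal ((t - τ) ^ (-a) * τ ^ (-c)) ≤
      ENNReal.ofReal (2 ^ cm * (1 - am)⁻¹ * t ^ (1 - a - c)) := by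
  have ht2 : 0 < t / 2 := by positivity
  have hpt : ∀ τ ∈ Ioo (t / 2) t, ENNReal.ofReal ((t - τ) ^ (-a) * τ ^ (-c)) ≤
      ENNReal.ofReal ((t / 2) ^ (-c)) * ENNReal.ofReal ((t - τ) ^ (-a)) := fun τ hτ => by
    rw [← ENNReal.ofReal_mul (by positivity)]
    refine ENNReal.ofReal_le_ofReal ?_
    rw [mul_comm]
    have : 0 ≤ t - τ := by linarith [hτ.2]
    gcongr ?_ * _
    exact Real.rpow_le_rpow_of_nonpos ht2 hτ.1.le (by linarith)
  refine (setLIntegral_mono' measurableSet_Ioo hpt).trans ?_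
  rw [lintegral_const_mul' _ _ ENNReal.ofReal_ne_top, setLIntegral_rpow_sub (by linarith)
    (by linarith), ← ENNReal.ofReal_mul (by positivity)]
  refine ENNReal.ofReal_le_ofReal ?_
  have h1a : 0 < 1 - a := by linarith
  have h1m : 0 < 1 - am := by linarith
  have e : (t / 2) ^ (-c) = 2 ^ c * t ^ (-c) := by
    rw [Real.div_rpow ht.le (by norm_num), div_eq_mul_inv, ← Real.rpow_neg (by norm_num), neg_neg,
      mul_comm]
  have e1 : t ^ (-c) * t ^ (1 - a) = t ^ (1 - a - c) := by
    rw [← Real.rpow_add ht]; congr 1; ring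
  rw [e, sub_half]
  calc 2 ^ c * t ^ (-c) * ((t / 2) ^ (1 - a) / (1 - a))
      ≤ 2 ^ cm * t ^ (-c) * (t ^ (1 - a) / (1 - am)) := by
        gcongr
        · norm_num
        · linarith
    _ = 2 ^ cm * (1 - am)⁻¹ * (t ^ (-c) * t ^ (1 - a)) := by ring
    _ = _ := by rw [e1]

end TimeIntegrals

/-! ### Duhamel integrals of extended nonnegative functions -/

section Duhamel

variable {d : ℕ}

/-- `∫_s^t e^{(t-τ)Δ} h(τ) dτ`. -/
def duhP (s t : ℝ) (h : ℝ → Rd d → ℝ≥0∞) (x : Rd d) : ℝ≥0∞ :=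
  ∫⁻ τ in Ioo s t, heatP (t - τ) (h τ) x

theorem measurable_heatP_uncurry {h : ℝ → Rd d → ℝ≥0∞} (hh : Measurable (Function.uncurry h))
    (t : ℝ) : Measurable (Function.uncurry fun τ x => heatP (t - τ) (h τ) x) := by
  have h1 : Measurable fun z : (ℝ × Rd d) × Rd d =>
      ENNReal.ofReal (gaussKernel (t - z.1.1) (z.1.2 - z.2)) * h z.1.1 z.2 :=
    (measurable_gaussKernel.comp ((measurable_const.sub measurable_fst.fst).prodMk
      (measurable_fst.snd.sub measurable_snd))).ennreal_ofReal.mul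
      (hh.comp (measurable_fst.fst.prodMk measurable_snd))
  exact h1.lintegral_prod_right'

theorem aemeasurable_heatP_uncurry {h : ℝ → Rd d → ℝ≥0∞} {μ : Measure ℝ} [SFinite μ]
    (hh : AEMeasurable (Function.uncurry h) (μ.prod volume)) (t : ℝ) :
    AEMeasurable (Function.uncurry fun τ x => heatP (t - τ) (h τ) x) (μ.prod volume) := by
  refine ⟨_, measurable_heatP_uncurry (h := fun τ x => hh.mk _ (τ, x)) hh.measurable_mk t, ?_⟩
  have h1 : ∀ᵐ τ ∂μ, h τ =ᵐ[volume] fun x => hh.mk _ (τ, x) :=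
    Measure.ae_ae_of_ae_prod hh.ae_eq_mk
  filter_upwards [Measure.quasiMeasurePreserving_fst.ae h1] with z hz
  exact heatP_congr hz _ _

theorem measurable_duhP {s t : ℝ} {h : ℝ → Rd d → ℝ≥0∞}
    (hh : AEMeasurable (Function.uncurry h) ((volume.restrict (Ioo s t)).prod volume)) :
    Measurable (duhP s t h) := by
  have h1 : ∀ᵐ τ ∂(volume.restrict (Ioo s t)), h τ =ᵐ[volume] fun x => hh.mk _ (τ, x) :=
    Measure.ae_ae_of_ae_prod hh.ae_eq_mk
  have h2 : duhP s t h = fun x => ∫⁻ τ in Ioo s t, heatP (t - τ) (fun x => hh.mk _ (τ, x)) x := by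
    funext x
    exact lintegral_congr_ae (h1.mono fun τ hτ => heatP_congr hτ _ _)
  rw [h2]
  exact (measurable_heatP_uncurry (h := fun τ x => hh.mk _ (τ, x)) hh.measurable_mk
    t).lintegral_prod_left'

/-- `(k + dθ)/2`, half of the homogeneity of `L^{1/θ,∞}_k`. -/
def homExp (d : ℕ) (k θ : ℝ) : ℝ := (k + d * θ) / 2

theorem half_mul_eq_homExp [NeZero d] (k θ : ℝ) : (d : ℝ) / 2 * (k / d + θ) = homExp d k θ := by
  have : (d : ℝ) ≠ 0 := by exact_mod_cast NeZero.ne d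
  rw [homExp]
  field_simp

/-- The exponents of the auxiliary space. -/
structure Params (d : ℕ) (γ α k θ : ℝ) : Prop where
  one_lt : 1 < α
  nonneg : 0 ≤ θ
  mul_lt_one : α * θ < 1
  weight : γ ≤ (α - 1) * k
  hom_nonneg : 0 ≤ homExp d k θ
  source : α * homExp d k θ - γ / 2 < d / 2
  crit : (α - 1) * homExp d k θ - γ / 2 < 1
  lower : α * ((2 + γ) / (2 * (α - 1)) - homExp d k θ) < 1

/-- The rate `β` of the auxiliary norm. -/
def rate (d : ℕ) (γ α k θ : ℝ) : ℝ := (2 + γ) / (2 * (α - 1)) - homExp d k θ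

/-- Pairs of exponents in which regularity is gained. -/
structure Target (d : ℕ) (k θ k' θ' : ℝ) : Prop where
  weight_le : k' ≤ k
  nonneg : 0 ≤ θ'
  le : θ' ≤ θ
  hom_nonneg : 0 ≤ homExp d k' θ'

variable {γ α k θ : ℝ}

theorem Params.sub_one_pos (P : Params d γ α k θ) : 0 < α - 1 := by linarith [P.one_lt]

theorem Params.rate_eq (P : Params d γ α k θ) :
    (α - 1) * rate d γ α k θ = 1 + γ / 2 - (α - 1) * homExp d k θ := by
  have := P.sub_one_pos
  rw [rate]
  field_simp

theorem Params.mul_rate_pos (P : Params d γ α k θ) : 0 < (α - 1) * rate d γ α k θ := by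
  rw [P.rate_eq]
  linarith [P.crit]

theorem Params.rate_pos (P : Params d γ α k θ) : 0 < rate d γ α k θ :=
  pos_of_mul_pos_right P.mul_rate_pos P.sub_one_pos.le

theorem Params.hom_mul_nonneg (P : Params d γ α k θ) :
    0 ≤ (α - 1) * homExp d k θ - γ / 2 := by
  have h1 : 0 ≤ (α - 1) * (d * θ) :=
    mul_nonneg P.sub_one_pos.le (mul_nonneg (Nat.cast_nonneg d) P.nonneg)
  have := P.weight
  rw [homExp]
  nlinarith

theorem Params.mul_rate_le_one (P : Params d γ α k θ) : (α - 1) * rate d γ α k θ ≤ 1 := by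
  rw [P.rate_eq]
  linarith [P.hom_mul_nonneg]

theorem Params.theta_lt_one (P : Params d γ α k θ) : θ < 1 := by
  nlinarith [P.one_lt, P.nonneg, P.mul_lt_one]

theorem Params.target_self (P : Params d γ α k θ) : Target d k θ k θ :=
  ⟨le_rfl, P.nonneg, le_rfl, P.hom_nonneg⟩

/-- A bound for the weights that occur. -/
def weightMax (d : ℕ) (γ α k : ℝ) : ℝ := |k| + d + |(α - 1) * k - γ|

theorem Target.abs_weight_le {k' θ' : ℝ} (P : Params d γ α k θ) (T : Target d k θ k' θ') :
    |k'| ≤ |k| + d := by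
  have h1 := T.hom_nonneg
  rw [homExp] at h1
  have h2 : (d : ℝ) * θ' ≤ d := by
    have : θ' ≤ 1 := T.le.trans P.theta_lt_one.le
    nlinarith [(Nat.cast_nonneg d : (0 : ℝ) ≤ d)]
  have hd : (0 : ℝ) ≤ d := Nat.cast_nonneg d
  rw [abs_le]
  constructor
  · linarith [abs_nonneg k]
  · linarith [le_abs_self k, T.weight_le]

theorem Target.smoothingPair [NeZero d] {k₁ θ₁ k₂ θ₂ : ℝ} (P : Params d γ α k θ)
    (T₁ : Target d k θ k₁ θ₁) (T₂ : Target d k θ k₂ θ₂) (hk : k₂ ≤ k₁) (hθ : θ₂ ≤ θ₁) :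
    SmoothingPair d (weightMax d γ α k) (α * θ) (2 / d * (α * homExp d k θ - γ / 2)) k₁ θ₁ k₂ θ₂ := by
  have hd : (0 : ℝ) < d := by exact_mod_cast Nat.pos_of_ne_zero (NeZero.ne d)
  have h0 := abs_nonneg ((α - 1) * k - γ)
  have e : ∀ k θ : ℝ, k / d + θ = 2 / d * homExp d k θ := fun k θ => by
    rw [homExp]; field_simp
  refine ⟨?_, ?_, hk, T₂.nonneg, hθ, ?_, ?_, ?_⟩
  · exact (T₁.abs_weight_le P).trans (by rw [weightMax]; linarith)
  · exact (T₂.abs_weight_le P).trans (by rw [weightMax]; linarith)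
  · nlinarith [T₁.le, P.one_lt, P.nonneg]
  · rw [e]
    exact mul_nonneg (by positivity) T₂.hom_nonneg
  · rw [e]
    gcongr
    have h1 : homExp d k₁ θ₁ ≤ homExp d k θ := by
      rw [homExp, homExp]
      have := T₁.weight_le
      have := T₁.le
      gcongr
    linarith [P.hom_mul_nonneg]

theorem Target.smoothingPair_nonlin [NeZero d] {k₁ θ₁ k₂ θ₂ : ℝ} (P : Params d γ α k θ)
    (T₁ : Target d k θ k₁ θ₁) (T₂ : Target d k θ k₂ θ₂) (hk : k₂ ≤ k₁) (hθ : θ₂ ≤ θ₁) :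
    SmoothingPair d (weightMax d γ α k) (α * θ) (2 / d * (α * homExp d k θ - γ / 2))
      ((α - 1) * k - γ + k₁) ((α - 1) * θ + θ₁) k₂ θ₂ := by
  have hd : (0 : ℝ) < d := by exact_mod_cast Nat.pos_of_ne_zero (NeZero.ne d)
  have h0 := abs_nonneg ((α - 1) * k - γ)
  have e : ∀ k θ : ℝ, k / d + θ = 2 / d * homExp d k θ := fun k θ => by
    rw [homExp]; field_simp
  have hθ' : 0 ≤ (α - 1) * θ := mul_nonneg P.sub_one_pos.le P.nonneg
  refine ⟨?_, ?_, ?_, T₂.nonneg, ?_, ?_, ?_, ?_⟩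
  · refine (abs_add_le _ _).trans ?_
    rw [weightMax]
    linarith [T₁.abs_weight_le P]
  · exact (T₂.abs_weight_le P).trans (by rw [weightMax]; linarith)
  · linarith [P.weight]
  · linarith
  · linarith [T₁.le]
  · rw [e]
    exact mul_nonneg (by positivity) T₂.hom_nonneg
  · rw [e]
    gcongr
    have h1 : homExp d k₁ θ₁ ≤ homExp d k θ := by
      rw [homExp, homExp]
      have := T₁.weight_le
      have := T₁.le
      gcongr
    have h2 : homExp d ((α - 1) * k - γ + k₁) ((α - 1) * θ + θ₁) =
        (α - 1) * homExp d k θ - γ / 2 + homExp d k₁ θ₁ := by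
      rw [homExp, homExp, homExp]; ring
    rw [h2]
    linarith

theorem Params.source_lt_one [NeZero d] (P : Params d γ α k θ) :
    2 / d * (α * homExp d k θ - γ / 2) < 1 := by
  have hd : (0 : ℝ) < d := by exact_mod_cast Nat.pos_of_ne_zero (NeZero.ne d)
  have := P.source
  rw [div_mul_eq_mul_div, div_lt_one hd]
  linarith

/-- The nonlinear expression `|x|^γ w^{α-1} v`. -/
def pot (γ α : ℝ) (w v : ℝ → Rd d → ℝ≥0∞) (τ : ℝ) (x : Rd d) : ℝ≥0∞ :=
  wt γ x * w τ x ^ (α - 1) * v τ x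

/-- `‖u(t)‖ ≤ A t^{-b}` for all `t > 0` in the norm of `L^{1/θ,∞}_k`. -/
def RateBound (k θ A b : ℝ) (u : ℝ → Rd d → ℝ≥0∞) : Prop :=
  ∀ t, 0 < t → LBound k θ (ENNReal.ofReal (A * t ^ (-b))) (u t)

theorem aemeasurable_pot {w v : ℝ → Rd d → ℝ≥0∞} {μ : Measure ℝ}
    (hw : AEMeasurable (Function.uncurry w) (μ.prod volume))
    (hv : AEMeasurable (Function.uncurry v) (μ.prod volume)) :
    AEMeasurable (Function.uncurry (pot γ α w v)) (μ.prod volume) :=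
  (((measurable_wt γ).comp measurable_snd).aemeasurable.mul (hw.pow_const _)).mul hv

/-- The smoothing estimate applied to a Duhamel integral of the nonlinear expression. -/
theorem exists_duhP_pot_bound [NeZero d] (P : Params d γ α k θ) :
    ∃ C : ℝ, 0 < C ∧ ∀ (k₁ θ₁ k₂ θ₂ : ℝ), Target d k θ k₁ θ₁ → Target d k θ k₂ θ₂ → k₂ ≤ k₁ →
      θ₂ ≤ θ₁ → ∀ (w v : ℝ → Rd d → ℝ≥0∞) (W V ω e s t : ℝ), 0 ≤ W → 0 ≤ V → 0 ≤ s →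
      (∀ t, 0 < t → AEMeasurable (w t) volume) → (∀ t, 0 < t → AEMeasurable (v t) volume) →
      AEMeasurable (Function.uncurry w) ((volume.restrict (Ioo s t)).prod volume) →
      AEMeasurable (Function.uncurry v) ((volume.restrict (Ioo s t)).prod volume) →
      RateBound k θ W ω w → RateBound k₁ θ₁ V e v →
      LBound k₂ θ₂ (ENNReal.ofReal (C * (W ^ (α - 1) * V)) * ∫⁻ τ in Ioo s t, ENNReal.ofReal
        ((t - τ) ^ (-(1 - (α - 1) * rate d γ α k θ + (homExp d k₁ θ₁ - homExp d k₂ θ₂))) *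
          τ ^ (-((α - 1) * ω + e)))) (duhP s t (pot γ α w v)) := by
  obtain ⟨C, hC, h⟩ := exists_smoothing (d := d) (weightMax d γ α k) P.mul_lt_one P.source_lt_one
  have hw1 : weakConst (α * θ) ≠ ∞ := weakConst_ne_top P.mul_lt_one
  have hCw : C * (2 * weakConst (α * θ)) ≠ ∞ := by finiteness
  refine ⟨(C * (2 * weakConst (α * θ))).toReal + 1, by positivity,
    fun k₁ θ₁ k₂ θ₂ T₁ T₂ hk hθ w v W V ω e s t hW hV hs hwm hvm hwj hvj hwb hvb => ?_⟩
  have hθ1 : θ₂ ≤ 1 := T₂.le.trans P.theta_lt_one.le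
  have hα := P.sub_one_pos
  set r := 1 - (α - 1) * rate d γ α k θ + (homExp d k₁ θ₁ - homExp d k₂ θ₂) with hr
  have hexp : (d : ℝ) / 2 * ((((α - 1) * k - γ + k₁) / d + ((α - 1) * θ + θ₁)) - (k₂ / d + θ₂)) =
      r := by
    rw [mul_sub, half_mul_eq_homExp, half_mul_eq_homExp, hr, P.rate_eq]
    simp only [homExp]
    ring
  refine (LBound.lintegral hθ1 (aemeasurable_heatP_uncurry (aemeasurable_pot hwj hvj) t)
    (b := fun τ => C * ENNReal.ofReal ((t - τ) ^ (-r)) *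
      (2 * weakConst (α * θ) * (ENNReal.ofReal (W * τ ^ (-ω)) ^ (α - 1) *
        ENNReal.ofReal (V * τ ^ (-e))))) ?_).mono (ae_of_all _ fun _ => le_rfl) ?_
  · refine (ae_restrict_iff' measurableSet_Ioo).2 (ae_of_all _ fun τ hτ => ?_)
    have hτ0 : 0 < τ := hs.trans_lt hτ.1
    have hn := LBound.nonlin (γ := γ) P.one_lt P.nonneg T₁.nonneg T₁.le P.mul_lt_one
      (hwm τ hτ0) (hvm τ hτ0) ENNReal.ofReal_ne_top ENNReal.ofReal_ne_top (hwb τ hτ0) (hvb τ hτ0)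
    have := h _ _ _ _ _ _ (t - τ) (by linarith [hτ.2]) (T₁.smoothingPair_nonlin P T₂ hk hθ)
      (((measurable_wt γ).aemeasurable.mul ((hwm τ hτ0).pow_const _)).mul (hvm τ hτ0))
      (by finiteness) hn
    rw [hexp] at this
    exact this
  · rw [← lintegral_const_mul' _ _ ENNReal.ofReal_ne_top]
    refine setLIntegral_mono' measurableSet_Ioo fun τ hτ => ?_
    have hτ0 : 0 < τ := hs.trans_lt hτ.1
    have htτ : 0 ≤ t - τ := by linarith [hτ.2]
    have e1 : (W * τ ^ (-ω)) ^ (α - 1) * (V * τ ^ (-e)) =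
        W ^ (α - 1) * V * τ ^ (-((α - 1) * ω + e)) := by
      rw [Real.mul_rpow hW (by positivity), ← Real.rpow_mul hτ0.le,
        show -((α - 1) * ω + e) = -ω * (α - 1) + -e by ring, Real.rpow_add hτ0]
      ring
    rw [ENNReal.ofReal_rpow_of_nonneg (by positivity) hα.le, ← ENNReal.ofReal_mul (by positivity),
      e1]
    have hle : C * (2 * weakConst (α * θ)) ≤
        ENNReal.ofReal ((C * (2 * weakConst (α * θ))).toReal + 1) := by
      conv_lhs => rw [← ENNReal.ofReal_toReal hCw]
      exact ENNReal.ofReal_le_ofReal (by linarith)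
    calc _ = C * (2 * weakConst (α * θ)) * (ENNReal.ofReal ((t - τ) ^ (-r)) *
          ENNReal.ofReal (W ^ (α - 1) * V * τ ^ (-((α - 1) * ω + e)))) := by ring
      _ ≤ ENNReal.ofReal ((C * (2 * weakConst (α * θ))).toReal + 1) *
          (ENNReal.ofReal ((t - τ) ^ (-r)) *
          ENNReal.ofReal (W ^ (α - 1) * V * τ ^ (-((α - 1) * ω + e)))) := by gcongr
      _ = _ := by
          rw [← ENNReal.ofReal_mul (by positivity), ← ENNReal.ofReal_mul (by positivity),
            ← ENNReal.ofReal_mul (by positivity)]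
          congr 1
          ring

/-- The Duhamel integral over `(0,t)` in the auxiliary space. -/
theorem exists_duhP_bound [NeZero d] (P : Params d γ α k θ) {cm : ℝ} (hcm : cm < 1) :
    ∃ C : ℝ, 0 < C ∧ ∀ (w v : ℝ → Rd d → ℝ≥0∞) (W V ω e : ℝ), 0 ≤ W → 0 ≤ V →
      0 ≤ (α - 1) * ω + e → (α - 1) * ω + e ≤ cm →
      (∀ t, 0 < t → AEMeasurable (w t) volume) → (∀ t, 0 < t → AEMeasurable (v t) volume) →
      (∀ t, 0 < t → AEMeasurable (Function.uncurry w) ((volume.restrict (Ioo 0 t)).prod volume)) →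
      (∀ t, 0 < t → AEMeasurable (Function.uncurry v) ((volume.restrict (Ioo 0 t)).prod volume)) →
      RateBound k θ W ω w → RateBound k θ V e v →
      RateBound k θ (C * (W ^ (α - 1) * V)) (e - (α - 1) * (rate d γ α k θ - ω))
        (fun t => duhP 0 t (pot γ α w v)) := by
  obtain ⟨C, hC, h⟩ := exists_duhP_pot_bound P
  have ha1 := P.mul_rate_pos
  have ha0 := P.mul_rate_le_one
  have hcm' : 0 < 1 - cm := by linarith
  refine ⟨C * (2 * ((1 - cm)⁻¹ + (1 - (1 - (α - 1) * rate d γ α k θ))⁻¹)), ?_,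
    fun w v W V ω e hW hV h0 h1 hwm hvm hwj hvj hwb hvb t ht => ?_⟩
  · have : 0 < 1 - (1 - (α - 1) * rate d γ α k θ) := by linarith
    positivity
  refine (h k θ k θ P.target_self P.target_self le_rfl le_rfl w v W V ω e 0 t hW hV le_rfl hwm hvm
    (hwj t ht) (hvj t ht) hwb hvb).mono (ae_of_all _ fun _ => le_rfl) ?_
  rw [sub_self, add_zero]
  refine (mul_le_mul_right (setLIntegral_beta_le (by linarith) (by linarith) h0 h1 hcm ht) _).trans
    (le_of_eq ?_)
  rw [← ENNReal.ofReal_mul (by positivity)]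
  congr 1
  rw [show 1 - (1 - (α - 1) * rate d γ α k θ) - ((α - 1) * ω + e) =
    -(e - (α - 1) * (rate d γ α k θ - ω)) by ring]
  ring

/-- The Duhamel integral over `(t/2,t)` between two target pairs. -/
theorem exists_duhP_tail_bound [NeZero d] (P : Params d γ α k θ) (cm : ℝ) :
    ∃ C : ℝ, 0 < C ∧ ∀ (k₁ θ₁ k₂ θ₂ : ℝ), Target d k θ k₁ θ₁ → Target d k θ k₂ θ₂ → k₂ ≤ k₁ →
      θ₂ ≤ θ₁ → homExp d k₁ θ₁ - homExp d k₂ θ₂ ≤ (α - 1) * rate d γ α k θ / 2 →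
      ∀ (w v : ℝ → Rd d → ℝ≥0∞) (W V ω e : ℝ), 0 ≤ W → 0 ≤ V →
      0 ≤ (α - 1) * ω + e → (α - 1) * ω + e ≤ cm →
      (∀ t, 0 < t → AEMeasurable (w t) volume) → (∀ t, 0 < t → AEMeasurable (v t) volume) →
      (∀ t, 0 < t → AEMeasurable (Function.uncurry w) ((volume.restrict (Ioo 0 t)).prod volume)) →
      (∀ t, 0 < t → AEMeasurable (Function.uncurry v) ((volume.restrict (Ioo 0 t)).prod volume)) →
      RateBound k θ W ω w → RateBound k₁ θ₁ V e v →
      RateBound k₂ θ₂ (C * (W ^ (α - 1) * V))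
        (e - (α - 1) * (rate d γ α k θ - ω) + (homExp d k₁ θ₁ - homExp d k₂ θ₂))
        (fun t => duhP (t / 2) t (pot γ α w v)) := by
  obtain ⟨C, hC, h⟩ := exists_duhP_pot_bound P
  have ha1 := P.mul_rate_pos
  have ha0 := P.mul_rate_le_one
  refine ⟨C * (2 ^ cm * (1 - (1 - (α - 1) * rate d γ α k θ / 2))⁻¹), ?_,
    fun k₁ θ₁ k₂ θ₂ T₁ T₂ hk hθ hgain w v W V ω e hW hV h0 h1 hwm hvm hwj hvj hwb hvb t ht => ?_⟩
  · have : 0 < 1 - (1 - (α - 1) * rate d γ α k θ / 2) := by linarith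
    positivity
  have hsub : (volume.restrict (Ioo (t / 2) t)).prod (volume : Measure (Rd d)) ≤
      (volume.restrict (Ioo 0 t)).prod volume :=
    Measure.prod_mono (Measure.restrict_mono (Ioo_subset_Ioo_left (by linarith)) le_rfl) le_rfl
  refine (h k₁ θ₁ k₂ θ₂ T₁ T₂ hk hθ w v W V ω e (t / 2) t hW hV (by linarith) hwm hvm
    ((hwj t ht).mono_measure hsub) ((hvj t ht).mono_measure hsub) hwb hvb).mono
    (ae_of_all _ fun _ => le_rfl) ?_
  refine (mul_le_mul_right (setLIntegral_tail_le (am := 1 - (α - 1) * rate d γ α k θ / 2)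
    (by linarith) (by linarith) h0 h1 ht) _).trans (le_of_eq ?_)
  rw [← ENNReal.ofReal_mul (by positivity)]
  congr 1
  rw [show 1 - (1 - (α - 1) * rate d γ α k θ + (homExp d k₁ θ₁ - homExp d k₂ θ₂)) -
    ((α - 1) * ω + e) = -(e - (α - 1) * (rate d γ α k θ - ω) +
      (homExp d k₁ θ₁ - homExp d k₂ θ₂)) by ring]
  ring

end Duhamel

/-! ### The nonlinear term -/

section Nonlinearity

variable {𝕜 : Type*} [RCLike 𝕜] {d : ℕ} {γ α : ℝ}

theorem rpow_sub_rpow_le {α r s : ℝ} (hα : 1 ≤ α) (hs : 0 ≤ s) (hsr : s ≤ r) :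
    r ^ α - s ^ α ≤ α * r ^ (α - 1) * (r - s) := by
  rcases hs.eq_or_lt with rfl | hs0
  · rcases hsr.eq_or_lt with rfl | hr
    · simp
    · rw [Real.zero_rpow (by linarith), sub_zero, sub_zero, mul_assoc,
        ← Real.rpow_add_one hr.ne', sub_add_cancel]
      nlinarith [Real.rpow_pos_of_pos hr α]
  have hr : 0 < r := hs0.trans_le hsr
  have h := one_add_mul_self_le_rpow_one_add (s := s / r - 1) (by
    have : 0 < s / r := by positivity
    linarith) hα
  rw [add_sub_cancel, Real.div_rpow hs hr.le, le_div_iff₀ (by positivity)] at h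
  have e : r ^ α = r ^ (α - 1) * r := by rw [← Real.rpow_add_one hr.ne', sub_add_cancel]
  have e2 : (1 + α * (s / r - 1)) * r ^ α = r ^ α + α * r ^ (α - 1) * (s - r) := by
    rw [e]
    field_simp
  rw [e2] at h
  linarith

theorem norm_rpow_smul_sub_le (hα : 1 < α) (a b : 𝕜) :
    ‖(‖a‖ ^ (α - 1)) • a - (‖b‖ ^ (α - 1)) • b‖ ≤
      (1 + α) * ((‖a‖ + ‖b‖) ^ (α - 1) * ‖a - b‖) := by
  wlog hab : ‖b‖ ≤ ‖a‖ generalizing a b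
  · have := this b a (le_of_not_ge hab)
    rwa [norm_sub_rev, add_comm ‖b‖, norm_sub_rev b a] at this
  have h1 : (‖a‖ ^ (α - 1)) • a - (‖b‖ ^ (α - 1)) • b =
      (‖a‖ ^ (α - 1)) • (a - b) + (‖a‖ ^ (α - 1) - ‖b‖ ^ (α - 1)) • b := by
    rw [smul_sub, sub_smul]; abel
  have hp : ‖b‖ ^ (α - 1) ≤ ‖a‖ ^ (α - 1) :=
    Real.rpow_le_rpow (norm_nonneg _) hab (by linarith)
  have e : ∀ r : ℝ, 0 ≤ r → r ^ (α - 1) * r = r ^ α := fun r hr => by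
    rcases hr.eq_or_lt with rfl | hr
    · rw [mul_zero, Real.zero_rpow (by linarith)]
    · rw [← Real.rpow_add_one hr.ne', sub_add_cancel]
  have h2 : (‖a‖ ^ (α - 1) - ‖b‖ ^ (α - 1)) * ‖b‖ ≤ α * ‖a‖ ^ (α - 1) * ‖a - b‖ := by
    calc (‖a‖ ^ (α - 1) - ‖b‖ ^ (α - 1)) * ‖b‖
        ≤ ‖a‖ ^ α - ‖b‖ ^ α := by
          rw [sub_mul, e _ (norm_nonneg b), ← e _ (norm_nonneg a)]
          gcongr
      _ ≤ α * ‖a‖ ^ (α - 1) * (‖a‖ - ‖b‖) := rpow_sub_rpow_le hα.le (norm_nonneg _) hab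
      _ ≤ _ := by
          gcongr
          exact norm_sub_norm_le a b
  have h3 : ‖a‖ ^ (α - 1) ≤ (‖a‖ + ‖b‖) ^ (α - 1) :=
    Real.rpow_le_rpow (norm_nonneg _) (by linarith [norm_nonneg b]) (by linarith)
  calc _ ≤ ‖a‖ ^ (α - 1) * ‖a - b‖ + (‖a‖ ^ (α - 1) - ‖b‖ ^ (α - 1)) * ‖b‖ := by
        rw [h1]
        refine (norm_add_le _ _).trans (le_of_eq ?_)
        rw [norm_smul, norm_smul, Real.norm_of_nonneg (by positivity),
          Real.norm_of_nonneg (sub_nonneg.2 hp)]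
    _ ≤ ‖a‖ ^ (α - 1) * ‖a - b‖ + α * ‖a‖ ^ (α - 1) * ‖a - b‖ := by gcongr
    _ = (1 + α) * (‖a‖ ^ (α - 1) * ‖a - b‖) := by ring
    _ ≤ _ := by gcongr

theorem enorm_nonlin (hα : 1 < α) (v : Rd d → 𝕜) (x : Rd d) :
    ‖nonlin γ α v x‖ₑ = wt γ x * ‖v x‖ₑ ^ (α - 1) * ‖v x‖ₑ := by
  rw [nonlin, enorm_smul, Real.enorm_of_nonneg (by positivity), ENNReal.ofReal_mul (by positivity),
    wt, ← ofReal_norm (v x), ENNReal.ofReal_rpow_of_nonneg (norm_nonneg _) (by linarith)]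

theorem enorm_nonlin_sub_le (hα : 1 < α) (u v : Rd d → 𝕜) (x : Rd d) :
    ‖nonlin γ α u x - nonlin γ α v x‖ₑ ≤
      ENNReal.ofReal (1 + α) * (wt γ x * (‖u x‖ₑ + ‖v x‖ₑ) ^ (α - 1) * ‖u x - v x‖ₑ) := by
  have h : nonlin γ α u x - nonlin γ α v x =
      (‖x‖ ^ γ) • ((‖u x‖ ^ (α - 1)) • u x - (‖v x‖ ^ (α - 1)) • v x) := by
    rw [nonlin, nonlin, smul_sub, smul_smul, smul_smul]
  rw [h, enorm_rpow_smul, ← ofReal_norm (u x), ← ofReal_norm (v x), ← ofReal_norm (u x - v x),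
    ← ENNReal.ofReal_add (norm_nonneg _) (norm_nonneg _),
    ENNReal.ofReal_rpow_of_nonneg (by positivity) (by linarith)]
  calc wt γ x * ‖(‖u x‖ ^ (α - 1)) • u x - (‖v x‖ ^ (α - 1)) • v x‖ₑ
      ≤ wt γ x * ENNReal.ofReal ((1 + α) * ((‖u x‖ + ‖v x‖) ^ (α - 1) * ‖u x - v x‖)) := by
        rw [← ofReal_norm]
        gcongr
        exact norm_rpow_smul_sub_le hα _ _
    _ = _ := by
        rw [ENNReal.ofReal_mul (by linarith), ENNReal.ofReal_mul (by positivity)]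
        ring

theorem aestronglyMeasurable_nonlin (hα : 1 < α) {u : ℝ → Rd d → 𝕜} {μ : Measure (ℝ × Rd d)}
    (hu : AEStronglyMeasurable (Function.uncurry u) μ) :
    AEStronglyMeasurable (fun z : ℝ × Rd d => nonlin γ α (u z.1) z.2) μ := by
  unfold nonlin
  have h1 : AEStronglyMeasurable (fun z : ℝ × Rd d => ‖z.2‖ ^ γ) μ :=
    (measurable_norm.comp measurable_snd |>.pow_const γ).aestronglyMeasurable
  have h2 : AEStronglyMeasurable (fun z : ℝ × Rd d => ‖u z.1 z.2‖ ^ (α - 1)) μ :=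
    (Real.continuous_rpow_const (by linarith)).comp_aestronglyMeasurable hu.norm
  exact (h1.mul h2).smul hu

theorem stronglyMeasurable_nonlin (hα : 1 < α) {u : ℝ → Rd d → 𝕜}
    (hu : StronglyMeasurable (Function.uncurry u)) :
    StronglyMeasurable (fun z : ℝ × Rd d => nonlin γ α (u z.1) z.2) := by
  unfold nonlin
  have h1 : StronglyMeasurable (fun z : ℝ × Rd d => ‖z.2‖ ^ γ) :=
    (measurable_norm.comp measurable_snd |>.pow_const γ).stronglyMeasurable
  have h2 : StronglyMeasurable (fun z : ℝ × Rd d => ‖u z.1 z.2‖ ^ (α - 1)) :=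
    (Real.continuous_rpow_const (by linarith)).comp_stronglyMeasurable hu.norm
  exact (h1.mul h2).smul hu

/-! ### The Duhamel term -/

/-- `∫_s^t e^{(t-τ)Δ} {|·|^γ |u(τ)|^{α-1} u(τ)} dτ`. -/
def duh (γ α : ℝ) (u : ℝ → Rd d → 𝕜) (s t : ℝ) (x : Rd d) : 𝕜 :=
  ∫ z, gaussKernel (t - z.1) (x - z.2) • nonlin γ α (u z.1) z.2
    ∂((volume.restrict (Ioo s t)).prod volume)

/-- Pointwise sizes. -/
def size (u : ℝ → Rd d → 𝕜) (t : ℝ) (x : Rd d) : ℝ≥0∞ := ‖u t x‖ₑ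

theorem measurable_gauss_duh (t : ℝ) (x : Rd d) :
    Measurable fun z : ℝ × Rd d => gaussKernel (t - z.1) (x - z.2) :=
  measurable_gaussKernel.comp ((measurable_const.sub measurable_fst).prodMk
    (measurable_const.sub measurable_snd))

theorem lintegral_gauss_enorm {s t : ℝ} {f : ℝ × Rd d → 𝕜}
    (hf : AEStronglyMeasurable f ((volume.restrict (Ioo s t)).prod volume)) (x : Rd d) :
    ∫⁻ z, ‖gaussKernel (t - z.1) (x - z.2) • f z‖ₑ ∂((volume.restrict (Ioo s t)).prod volume) =
      duhP s t (fun τ y => ‖f (τ, y)‖ₑ) x := by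
  have hm : AEMeasurable (fun z : ℝ × Rd d => ‖gaussKernel (t - z.1) (x - z.2) • f z‖ₑ)
      ((volume.restrict (Ioo s t)).prod volume) :=
    ((measurable_gauss_duh t x).aestronglyMeasurable.smul hf).enorm
  rw [lintegral_prod _ hm]
  refine setLIntegral_congr_fun measurableSet_Ioo fun τ hτ => lintegral_congr fun y => ?_
  simp only
  rw [enorm_smul, Real.enorm_of_nonneg (gaussKernel_nonneg (sub_pos.2 hτ.2) _)]

theorem integrable_duh (hα : 1 < α) {u : ℝ → Rd d → 𝕜} {s t : ℝ} {x : Rd d}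
    (hu : AEStronglyMeasurable (Function.uncurry u) ((volume.restrict (Ioo s t)).prod volume))
    (h : duhP s t (pot γ α (size u) (size u)) x < ∞) :
    Integrable (fun z : ℝ × Rd d => gaussKernel (t - z.1) (x - z.2) • nonlin γ α (u z.1) z.2)
      ((volume.restrict (Ioo s t)).prod volume) := by
  have hm := aestronglyMeasurable_nonlin (γ := γ) hα hu
  refine ⟨(measurable_gauss_duh t x).aestronglyMeasurable.smul hm, ?_⟩
  rw [hasFiniteIntegral_iff_enorm, lintegral_gauss_enorm hm]
  simp only [enorm_nonlin hα]
  exact h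

theorem enorm_duh_le (hα : 1 < α) {u : ℝ → Rd d → 𝕜} {s t : ℝ}
    (hu : AEStronglyMeasurable (Function.uncurry u) ((volume.restrict (Ioo s t)).prod volume))
    (x : Rd d) : ‖duh γ α u s t x‖ₑ ≤ duhP s t (pot γ α (size u) (size u)) x := by
  refine (enorm_integral_le_lintegral_enorm _).trans ?_
  rw [lintegral_gauss_enorm (aestronglyMeasurable_nonlin (γ := γ) hα hu)]
  simp only [enorm_nonlin hα]
  rfl

theorem duhP_mono {s t : ℝ} {h₁ h₂ : ℝ → Rd d → ℝ≥0∞} (h : ∀ τ y, h₁ τ y ≤ h₂ τ y) (x : Rd d) :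
    duhP s t h₁ x ≤ duhP s t h₂ x :=
  lintegral_mono fun τ => heatP_mono (ae_of_all _ (h τ)) _ _

theorem duhP_const_mul {s t : ℝ} {h : ℝ → Rd d → ℝ≥0∞} {c : ℝ≥0∞} (hc : c ≠ ∞) (x : Rd d) :
    duhP s t (fun τ y => c * h τ y) x = c * duhP s t h x := by
  unfold duhP
  rw [← lintegral_const_mul' _ _ hc]
  exact lintegral_congr fun τ => heatP_const_mul hc _ _

theorem enorm_duh_sub_le (hα : 1 < α) {u v : ℝ → Rd d → 𝕜} {s t : ℝ} {x : Rd d}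
    (hu : AEStronglyMeasurable (Function.uncurry u) ((volume.restrict (Ioo s t)).prod volume))
    (hv : AEStronglyMeasurable (Function.uncurry v) ((volume.restrict (Ioo s t)).prod volume))
    (hux : duhP s t (pot γ α (size u) (size u)) x < ∞)
    (hvx : duhP s t (pot γ α (size v) (size v)) x < ∞) :
    ‖duh γ α u s t x - duh γ α v s t x‖ₑ ≤ ENNReal.ofReal (1 + α) *
      duhP s t (pot γ α (fun τ y => size u τ y + size v τ y) (size (u - v))) x := by
  have e : duh γ α u s t x - duh γ α v s t x = ∫ z, gaussKernel (t - z.1) (x - z.2) •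
      (nonlin γ α (u z.1) z.2 - nonlin γ α (v z.1) z.2)
      ∂((volume.restrict (Ioo s t)).prod volume) := by
    rw [duh, duh, ← integral_sub (integrable_duh hα hu hux) (integrable_duh hα hv hvx)]
    simp only [smul_sub]
  rw [e, ← duhP_const_mul ENNReal.ofReal_ne_top]
  refine (enorm_integral_le_lintegral_enorm _).trans ?_
  have hm : AEStronglyMeasurable (fun z : ℝ × Rd d => nonlin γ α (u z.1) z.2 -
      nonlin γ α (v z.1) z.2) ((volume.restrict (Ioo s t)).prod volume) :=
    (aestronglyMeasurable_nonlin (γ := γ) hα hu).sub (aestronglyMeasurable_nonlin (γ := γ) hα hv)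
  rw [lintegral_gauss_enorm hm]
  exact duhP_mono (fun τ y => enorm_nonlin_sub_le hα _ _ _) x

theorem duh_zero (s t : ℝ) (x : Rd d) : duh γ α (0 : ℝ → Rd d → 𝕜) s t x = 0 := by
  simp [duh, nonlin]

theorem duh_eq_integral {u : ℝ → Rd d → 𝕜} {t : ℝ} {x : Rd d}
    (h : Integrable (fun z : ℝ × Rd d => gaussKernel (t - z.1) (x - z.2) •
      nonlin γ α (u z.1) z.2) ((volume.restrict (Ioo 0 t)).prod volume)) :
    duh γ α u 0 t x = ∫ τ in Ioo 0 t, heatFun (nonlin γ α (u τ)) (t - τ) x :=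
  integral_prod _ h

theorem stronglyMeasurable_duh (hα : 1 < α) {u : ℝ → Rd d → 𝕜}
    (hu : StronglyMeasurable (Function.uncurry u)) :
    StronglyMeasurable (Function.uncurry (duh γ α u 0)) := by
  have e : Function.uncurry (duh γ α u 0) = fun p : ℝ × Rd d => ∫ z : ℝ × Rd d,
      ({q : (ℝ × Rd d) × (ℝ × Rd d) | 0 < q.2.1 ∧ q.2.1 < q.1.1}.indicator fun q =>
        gaussKernel (q.1.1 - q.2.1) (q.1.2 - q.2.2) • nonlin γ α (u q.2.1) q.2.2) (p, z) := by
    funext p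
    have hr : (volume.restrict (Ioo 0 p.1)).prod (volume : Measure (Rd d)) =
        (volume : Measure (ℝ × Rd d)).restrict (Ioo 0 p.1 ×ˢ univ) := by
      rw [← Measure.restrict_univ (μ := (volume : Measure (Rd d))), Measure.prod_restrict]
      simp [Measure.volume_eq_prod]
    change duh γ α u 0 p.1 p.2 = _
    rw [duh, hr, ← integral_indicator (measurableSet_Ioo.prod MeasurableSet.univ)]
    refine integral_congr_ae (ae_of_all _ fun z => ?_)
    simp only [indicator, mem_prod, mem_Ioo, mem_univ, and_true, mem_ofPred_eq]
  rw [e]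
  refine StronglyMeasurable.integral_prod_right' (f := fun q => _) ?_
  refine StronglyMeasurable.indicator ?_ ?_
  · refine StronglyMeasurable.smul ?_ ?_
    · exact (measurable_gaussKernel.comp ((measurable_fst.fst.sub measurable_snd.fst).prodMk
        (measurable_fst.snd.sub measurable_snd.snd))).stronglyMeasurable
    · exact (stronglyMeasurable_nonlin hα hu).comp_measurable measurable_snd
  · exact (measurableSet_lt measurable_const measurable_snd.fst).inter
      (measurableSet_lt measurable_snd.fst measurable_fst.fst)

end Nonlinearity

/-! ### Rates -/

section Rates

variable {𝕜 : Type*} [RCLike 𝕜] {d : ℕ} {γ α k θ A B b : ℝ} {F G : ℝ → Rd d → ℝ≥0∞}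

theorem RateBound.mono (h : RateBound k θ A b G)
    (hFG : ∀ t, 0 < t → F t ≤ᵐ[volume] G t) (hAB : A ≤ B) : RateBound k θ B b F := fun t ht =>
  (h t ht).mono (hFG t ht) (ENNReal.ofReal_le_ofReal (by gcongr))

theorem RateBound.add (hA : 0 ≤ A) (hB : 0 ≤ B) (hF : ∀ t, 0 < t → AEMeasurable (F t) volume)
    (h₁ : RateBound k θ A b F) (h₂ : RateBound k θ B b G) :
    RateBound k θ (A + B) b (fun t x => F t x + G t x) := fun t ht =>
  ((h₁ t ht).add (hF t ht) (h₂ t ht)).mono (ae_of_all _ fun _ => le_rfl) (by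
    rw [← ENNReal.ofReal_add (by positivity) (by positivity), add_mul])

theorem RateBound.const_mul {c : ℝ} (hc : 0 ≤ c) (h : RateBound k θ A b F) :
    RateBound k θ (c * A) b (fun t x => ENNReal.ofReal c * F t x) := fun t ht =>
  ((h t ht).const_mul ENNReal.ofReal_ne_top).mono (ae_of_all _ fun _ => le_rfl) (by
    rw [← ENNReal.ofReal_mul hc, mul_assoc])

theorem LBound.of_tendsto {k θ : ℝ} {A : ℝ≥0∞} {F : Rd d → ℝ≥0∞} {ε : ℕ → ℝ≥0∞} (hθ : θ ≤ 1)
    (hε : Tendsto ε atTop (𝓝 0)) (h : ∀ n, LBound k θ (A + ε n) F) : LBound k θ A F := by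
  refine LBound.of_forall_add hθ fun δ hδ _ => ?_
  obtain ⟨n, hn⟩ := ((tendsto_order.1 hε).2 δ hδ).exists
  exact (h n).mono (ae_of_all _ fun _ => le_rfl) (by gcongr)

theorem tendsto_ofReal_half_pow (A c : ℝ) :
    Tendsto (fun n : ℕ => ENNReal.ofReal (A / 2 ^ n * c)) atTop (𝓝 0) := by
  have h : Tendsto (fun n : ℕ => A / 2 ^ n * c) atTop (𝓝 0) := by
    have h1 := (tendsto_pow_atTop_nhds_zero_of_lt_one (r := (2 : ℝ)⁻¹) (by norm_num)
      (by norm_num)).const_mul (A * c)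
    rw [mul_zero] at h1
    refine h1.congr fun n => ?_
    rw [inv_pow]
    ring
  simpa using ENNReal.tendsto_ofReal h

/-- Measurability of a time dependent function. -/
structure TimeMeasurable (u : ℝ → Rd d → 𝕜) : Prop where
  slice : ∀ t, 0 < t → AEStronglyMeasurable (u t) volume
  joint : ∀ t, 0 < t →
    AEStronglyMeasurable (Function.uncurry u) ((volume.restrict (Ioo 0 t)).prod volume)

variable {u v : ℝ → Rd d → 𝕜}

theorem TimeMeasurable.of_stronglyMeasurable (h : StronglyMeasurable (Function.uncurry u)) :
    TimeMeasurable u :=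
  ⟨fun t _ => (h.comp_measurable (measurable_const.prodMk measurable_id :
    Measurable fun x : Rd d => (t, x))).aestronglyMeasurable, fun _ _ => h.aestronglyMeasurable⟩

theorem TimeMeasurable.sub (hu : TimeMeasurable u) (hv : TimeMeasurable v) :
    TimeMeasurable (u - v) :=
  ⟨fun t ht => (hu.slice t ht).sub (hv.slice t ht), fun t ht => (hu.joint t ht).sub (hv.joint t ht)⟩

theorem TimeMeasurable.zero : TimeMeasurable (0 : ℝ → Rd d → 𝕜) :=
  .of_stronglyMeasurable stronglyMeasurable_zero

theorem TimeMeasurable.size_slice (hu : TimeMeasurable u) (t : ℝ) (ht : 0 < t) :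
    AEMeasurable (size u t) volume := (hu.slice t ht).enorm

theorem TimeMeasurable.size_joint (hu : TimeMeasurable u) (t : ℝ) (ht : 0 < t) :
    AEMeasurable (Function.uncurry (size u)) ((volume.restrict (Ioo 0 t)).prod volume) :=
  (hu.joint t ht).enorm

theorem RateBound.zero : RateBound k θ A b (size (0 : ℝ → Rd d → 𝕜)) :=
  fun t _ => LBound.zero.mono (ae_of_all _ fun x => by simp [size]) le_rfl

end Rates

/-! ### The contraction principle -/

section Contraction

variable {𝕜 : Type*} [RCLike 𝕜] {d : ℕ}

/-- The Duhamel map contracts differences, in the ball of radius `M` of the auxiliary space and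
for all rates `b` up to `cm`. -/
def Contracts (𝕜 : Type*) [RCLike 𝕜] (d : ℕ) (a γ α k θ cm M : ℝ) : Prop :=
  ∀ (u v : ℝ → Rd d → 𝕜), TimeMeasurable u → TimeMeasurable v →
    RateBound k θ M (rate d γ α k θ) (size u) → RateBound k θ M (rate d γ α k θ) (size v) →
    (∀ t, 0 < t → ∀ᵐ x, duhP 0 t (pot γ α (size u) (size u)) x < ∞) ∧
    ∀ A b : ℝ, 0 ≤ A → 0 ≤ b → (α - 1) * rate d γ α k θ + b ≤ cm →
      RateBound k θ A b (size (u - v)) →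
      RateBound k θ (A / 2) b (size fun t x => a • (duh γ α u 0 t x - duh γ α v 0 t x))

theorem exists_contracts [NeZero d] {γ α k θ : ℝ} (P : Params d γ α k θ) (a : ℝ) {cm : ℝ}
    (hcm : cm < 1) (hβ : α * rate d γ α k θ ≤ cm) :
    ∃ M : ℝ, 0 < M ∧ ∀ M', 0 ≤ M' → M' ≤ M → Contracts 𝕜 d a γ α k θ cm M' := by
  obtain ⟨C, hC, h⟩ := exists_duhP_bound P hcm
  have hα := P.sub_one_pos
  have hr := P.rate_pos
  set c : ℝ := |a| * (1 + α) * C with hc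
  have hc0 : 0 ≤ c := by have := P.one_lt; positivity
  obtain ⟨M, hM, hMc⟩ : ∃ M : ℝ, 0 < M ∧ c * (M + M) ^ (α - 1) ≤ 1 / 2 := by
    have hlim : Tendsto (fun M : ℝ => c * (M + M) ^ (α - 1)) (𝓝 0) (𝓝 (c * (0 + 0) ^ (α - 1))) :=
      ((Real.continuous_rpow_const hα.le).comp (continuous_id.add continuous_id)).tendsto 0
        |>.const_mul c
    rw [add_zero, Real.zero_rpow hα.ne', mul_zero] at hlim
    have h1 : ∀ᶠ M in 𝓝[>] (0 : ℝ), c * (M + M) ^ (α - 1) < 1 / 2 :=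
      nhdsWithin_le_nhds ((tendsto_order.1 hlim).2 _ (by norm_num))
    obtain ⟨M, hM, hM0⟩ := (h1.and self_mem_nhdsWithin).exists
    exact ⟨M, hM0, hM.le⟩
  refine ⟨M, hM, fun M' hM' hMM u v hum hvm hu hv => ?_⟩
  have hM'c : c * (M' + M') ^ (α - 1) ≤ 1 / 2 := le_trans (by gcongr) hMc
  have hbr : (α - 1) * rate d γ α k θ + rate d γ α k θ = α * rate d γ α k θ := by ring
  have hself : ∀ w : ℝ → Rd d → 𝕜, TimeMeasurable w →
      RateBound k θ M' (rate d γ α k θ) (size w) →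
      ∀ t, 0 < t → ∀ᵐ x, duhP 0 t (pot γ α (size w) (size w)) x < ∞ := fun w hwm hw t ht => by
    have hb := h (size w) (size w) M' M' _ _ hM' hM' (by rw [hbr]; positivity [P.one_lt])
      (by rw [hbr]; exact hβ) hwm.size_slice hwm.size_slice hwm.size_joint hwm.size_joint hw hw t ht
    exact LBound.ae_lt_top (measurable_duhP (aemeasurable_pot (hwm.size_joint t ht)
      (hwm.size_joint t ht))).aemeasurable P.theta_lt_one.le ENNReal.ofReal_ne_top hb
  refine ⟨hself u hum hu, fun A b hA hb0 hb hD => ?_⟩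
  have hsum : RateBound k θ (M' + M') (rate d γ α k θ) (fun t x => size u t x + size v t x) :=
    hu.add hM' hM' hum.size_slice hv
  have hDm := hum.sub hvm
  have hmain := (h _ _ (M' + M') A _ b (by positivity) hA
    (by positivity) hb (fun t ht => (hum.size_slice t ht).add (hvm.size_slice t ht))
    hDm.size_slice (fun t ht => (hum.size_joint t ht).add (hvm.size_joint t ht)) hDm.size_joint
    hsum hD).const_mul (c := |a| * (1 + α)) (by have := P.one_lt; positivity)
  rw [sub_self, mul_zero, sub_zero] at hmain
  refine hmain.mono (fun t ht => ?_) ?_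
  · filter_upwards [hself u hum hu t ht, hself v hvm hv t ht] with x hux hvx
    rw [size, enorm_smul, ENNReal.ofReal_mul (abs_nonneg a), mul_assoc, ← Real.norm_eq_abs,
      ofReal_norm]
    gcongr
    exact enorm_duh_sub_le P.one_lt (hum.joint t ht) (hvm.joint t ht) hux hvx
  · calc |a| * (1 + α) * (C * ((M' + M') ^ (α - 1) * A))
        = c * (M' + M') ^ (α - 1) * A := by rw [hc]; ring
      _ ≤ 1 / 2 * A := by gcongr
      _ = A / 2 := by ring

variable {a γ α k θ cm M : ℝ}

/-- The Picard iterates for the integral equation with free evolution `U`. -/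
def picard (a γ α : ℝ) (U : ℝ → Rd d → 𝕜) : ℕ → ℝ → Rd d → 𝕜
  | 0 => 0
  | n + 1 => fun t x => U t x + a • duh γ α (picard a γ α U n) 0 t x

theorem stronglyMeasurable_picard (hα : 1 < α) {U : ℝ → Rd d → 𝕜}
    (hU : StronglyMeasurable (Function.uncurry U)) (n : ℕ) :
    StronglyMeasurable (Function.uncurry (picard a γ α U n)) := by
  induction n with
  | zero => exact stronglyMeasurable_zero
  | succ n ih => exact hU.add ((stronglyMeasurable_duh hα ih).const_smul a)

theorem timeMeasurable_picard (hα : 1 < α) {U : ℝ → Rd d → 𝕜}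
    (hU : StronglyMeasurable (Function.uncurry U)) (n : ℕ) : TimeMeasurable (picard a γ α U n) :=
  .of_stronglyMeasurable (stronglyMeasurable_picard hα hU n)

theorem picard_rateBound (P : Params d γ α k θ) (hcm : α * rate d γ α k θ ≤ cm)
    (hM : 0 ≤ M) (hc : Contracts 𝕜 d a γ α k θ cm M) {U : ℝ → Rd d → 𝕜}
    (hU : StronglyMeasurable (Function.uncurry U))
    (hUM : RateBound k θ (M / 2) (rate d γ α k θ) (size U)) (n : ℕ) :
    RateBound k θ M (rate d γ α k θ) (size (picard a γ α U n)) := by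
  induction n with
  | zero => exact RateBound.zero
  | succ n ih =>
    have hr := P.rate_pos
    have h1 := (hc _ 0 (timeMeasurable_picard P.one_lt hU n) .zero ih .zero).2 M
      (rate d γ α k θ) hM hr.le (by linarith) (by rwa [sub_zero])
    refine (hUM.add (by positivity) (by positivity)
      (TimeMeasurable.of_stronglyMeasurable hU).size_slice h1).mono (fun t ht => ae_of_all _ fun x => ?_)
      (by linarith)
    refine (enorm_add_le _ _).trans (le_of_eq ?_)
    simp only [size, duh_zero, sub_zero]

/-- Two solutions differ by at most twice the difference of their free evolutions. -/
theorem picard_sub_rateBound (P : Params d γ α k θ) (hcm : α * rate d γ α k θ ≤ cm)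
    (hM : 0 ≤ M) (hc : Contracts 𝕜 d a γ α k θ cm M) {U V : ℝ → Rd d → 𝕜}
    (hU : StronglyMeasurable (Function.uncurry U))
    (hUM : RateBound k θ (M / 2) (rate d γ α k θ) (size U))
    (hV : StronglyMeasurable (Function.uncurry V))
    (hVM : RateBound k θ (M / 2) (rate d γ α k θ) (size V)) {A b : ℝ} (hA : 0 ≤ A)
    (hb : 0 ≤ b) (hbc : (α - 1) * rate d γ α k θ + b ≤ cm)
    (hUV : RateBound k θ A b (size (U - V))) (n : ℕ) :
    RateBound k θ (2 * A) b (size (picard a γ α U n - picard a γ α V n)) := by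
  induction n with
  | zero => rw [picard, picard, sub_zero]; exact RateBound.zero
  | succ n ih =>
    have h1 := (hc _ _ (timeMeasurable_picard P.one_lt hU n) (timeMeasurable_picard P.one_lt hV n)
      (picard_rateBound P hcm hM hc hU hUM n) (picard_rateBound P hcm hM hc hV hVM n)).2 (2 * A) b
      (by positivity) hb hbc ih
    refine (hUV.add hA (by positivity) ((TimeMeasurable.of_stronglyMeasurable hU).sub
      (.of_stronglyMeasurable hV)).size_slice h1).mono (fun t ht => ae_of_all _ fun x => ?_)
      (by linarith)
    refine le_trans (le_of_eq ?_) (enorm_add_le _ _)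
    simp only [size, picard, Pi.sub_apply, smul_sub]
    congr 1
    abel

theorem picard_succ_sub_rateBound (P : Params d γ α k θ) (hcm : α * rate d γ α k θ ≤ cm)
    (hM : 0 ≤ M) (hc : Contracts 𝕜 d a γ α k θ cm M) {U : ℝ → Rd d → 𝕜}
    (hU : StronglyMeasurable (Function.uncurry U))
    (hUM : RateBound k θ (M / 2) (rate d γ α k θ) (size U)) (n : ℕ) :
    RateBound k θ (M / 2 ^ n) (rate d γ α k θ)
      (size (picard a γ α U (n + 1) - picard a γ α U n)) := by
  induction n with
  | zero =>
    rw [pow_zero, div_one, picard, sub_zero]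
    exact picard_rateBound P hcm hM hc hU hUM 1
  | succ n ih =>
    have hr := P.rate_pos
    have h1 := (hc _ _ (timeMeasurable_picard P.one_lt hU (n + 1))
      (timeMeasurable_picard P.one_lt hU n) (picard_rateBound P hcm hM hc hU hUM _)
      (picard_rateBound P hcm hM hc hU hUM _)).2 _ (rate d γ α k θ)
      (by positivity) hr.le (by linarith) ih
    refine h1.mono (fun t ht => ae_of_all _ fun x => le_of_eq ?_)
      (by rw [pow_succ, div_div])
    simp only [size, picard, Pi.sub_apply, smul_sub]
    congr 1
    abel

/-- The limit of the Picard iterates. -/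
def picardLimit (a γ α : ℝ) (U : ℝ → Rd d → 𝕜) (t : ℝ) (x : Rd d) : 𝕜 :=
  limUnder atTop fun n => picard a γ α U n t x

theorem stronglyMeasurable_picardLimit (hα : 1 < α) {U : ℝ → Rd d → 𝕜}
    (hU : StronglyMeasurable (Function.uncurry U)) :
    StronglyMeasurable (Function.uncurry (picardLimit a γ α U)) :=
  StronglyMeasurable.limUnder (f := fun n => Function.uncurry (picard a γ α U n))
    fun n => stronglyMeasurable_picard hα hU n

theorem tsum_half_pow (M c : ℝ) (hM : 0 ≤ M) (hc : 0 ≤ c) (n : ℕ) :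
    ∑' m : ℕ, ENNReal.ofReal (M / 2 ^ (n + m) * c) = ENNReal.ofReal (2 * M / 2 ^ n * c) := by
  have h : ∀ m : ℕ, ENNReal.ofReal (M / 2 ^ (n + m) * c) =
      ENNReal.ofReal (M / 2 ^ n * c) * (2⁻¹) ^ m := fun m => by
    have : (2⁻¹ : ℝ≥0∞) ^ m = ENNReal.ofReal ((2⁻¹ : ℝ) ^ m) := by
      rw [ENNReal.ofReal_pow (by norm_num), ENNReal.ofReal_inv_of_pos (by norm_num)]
      norm_num
    rw [this, ← ENNReal.ofReal_mul (by positivity), pow_add, inv_pow]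
    congr 1
    field_simp
  simp_rw [h]
  rw [ENNReal.tsum_mul_left, ENNReal.tsum_geometric, ENNReal.one_sub_inv_two, inv_inv]
  have : (2 : ℝ≥0∞) = ENNReal.ofReal 2 := by norm_num
  rw [this, ← ENNReal.ofReal_mul (by positivity)]
  congr 1
  ring

theorem picardLimit_spec [NeZero d] (P : Params d γ α k θ) (hcm : α * rate d γ α k θ ≤ cm)
    (hM : 0 ≤ M) (hc : Contracts 𝕜 d a γ α k θ cm M) {U : ℝ → Rd d → 𝕜}
    (hU : StronglyMeasurable (Function.uncurry U))
    (hUM : RateBound k θ (M / 2) (rate d γ α k θ) (size U)) {t : ℝ} (ht : 0 < t) :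
    ∀ᵐ x, Tendsto (fun n => picard a γ α U n t x) atTop (𝓝 (picardLimit a γ α U t x)) ∧
      ∀ n, size (picardLimit a γ α U - picard a γ α U n) t x ≤
        ∑' m, size (picard a γ α U (n + m + 1) - picard a γ α U (n + m)) t x := by
  have hr := picard_succ_sub_rateBound P hcm hM hc hU hUM
  have hm : ∀ n, AEMeasurable (size (picard a γ α U (n + 1) - picard a γ α U n) t) volume :=
    fun n => ((timeMeasurable_picard P.one_lt hU (n + 1)).sub
      (timeMeasurable_picard P.one_lt hU n)).size_slice t ht
  have hsum := LBound.tsum hm fun n => hr n t ht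
  have hfin : ∀ᵐ x, ∑' n, size (picard a γ α U (n + 1) - picard a γ α U n) t x < ∞ := by
    refine LBound.ae_lt_top (AEMeasurable.tsum hm) P.theta_lt_one.le ?_ hsum
    have := tsum_half_pow M (t ^ (-rate d γ α k θ)) hM (by positivity) 0
    simp only [zero_add] at this
    rw [this]
    exact ENNReal.ofReal_ne_top
  filter_upwards [hfin] with x hx
  have hed : ∀ n, edist (picard a γ α U n t x) (picard a γ α U (n + 1) t x) ≤
      size (picard a γ α U (n + 1) - picard a γ α U n) t x := fun n => by
    rw [edist_comm, edist_eq_enorm_sub]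
    rfl
  have hcau := cauchySeq_of_edist_le_of_tsum_ne_top _ hed hx.ne
  have hlim := hcau.tendsto_limUnder
  refine ⟨hlim, fun n => ?_⟩
  have := edist_le_tsum_of_edist_le_of_tendsto _ hed hlim n
  rw [edist_comm, edist_eq_enorm_sub] at this
  exact this

theorem picardLimit_sub_rateBound [NeZero d] (P : Params d γ α k θ)
    (hcm : α * rate d γ α k θ ≤ cm)
    (hM : 0 ≤ M) (hc : Contracts 𝕜 d a γ α k θ cm M) {U : ℝ → Rd d → 𝕜}
    (hU : StronglyMeasurable (Function.uncurry U))
    (hUM : RateBound k θ (M / 2) (rate d γ α k θ) (size U)) (n : ℕ) :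
    RateBound k θ (2 * M / 2 ^ n) (rate d γ α k θ)
      (size (picardLimit a γ α U - picard a γ α U n)) := fun t ht => by
  have hr := picard_succ_sub_rateBound P hcm hM hc hU hUM
  have hm : ∀ n, AEMeasurable (size (picard a γ α U (n + 1) - picard a γ α U n) t) volume :=
    fun n => ((timeMeasurable_picard P.one_lt hU (n + 1)).sub
      (timeMeasurable_picard P.one_lt hU n)).size_slice t ht
  refine (LBound.tsum (fun m => hm (n + m)) fun m => hr (n + m) t ht).mono ?_
    (tsum_half_pow M _ hM (by positivity) n).le
  filter_upwards [picardLimit_spec P hcm hM hc hU hUM ht] with x hx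
  exact hx.2 n

/-- Bounds for the iterates pass to the limit. -/
theorem picardLimit_sub_le [NeZero d] (P : Params d γ α k θ) (hcm : α * rate d γ α k θ ≤ cm)
    (hM : 0 ≤ M) (hc : Contracts 𝕜 d a γ α k θ cm M) {U V : ℝ → Rd d → 𝕜}
    (hU : StronglyMeasurable (Function.uncurry U))
    (hUM : RateBound k θ (M / 2) (rate d γ α k θ) (size U))
    (hV : StronglyMeasurable (Function.uncurry V))
    (hVM : RateBound k θ (M / 2) (rate d γ α k θ) (size V)) {A b : ℝ} (hA : 0 ≤ A)
    (hb : 0 ≤ b) (hbc : (α - 1) * rate d γ α k θ + b ≤ cm)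
    (hUV : RateBound k θ A b (size (U - V))) :
    RateBound k θ (2 * A) b (size (picardLimit a γ α U - picardLimit a γ α V)) := fun t ht => by
  have hmU := TimeMeasurable.of_stronglyMeasurable
    (stronglyMeasurable_picardLimit (a := a) (γ := γ) P.one_lt hU)
  have hmV := TimeMeasurable.of_stronglyMeasurable
    (stronglyMeasurable_picardLimit (a := a) (γ := γ) P.one_lt hV)
  have hlim := (tendsto_ofReal_half_pow (2 * M) (t ^ (-rate d γ α k θ))).add
    (tendsto_ofReal_half_pow (2 * M) (t ^ (-rate d γ α k θ)))
  rw [add_zero] at hlim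
  refine LBound.of_tendsto P.theta_lt_one.le hlim fun n => ?_
  have hpU := timeMeasurable_picard (a := a) (γ := γ) P.one_lt hU n
  have hpV := timeMeasurable_picard (a := a) (γ := γ) P.one_lt hV n
  have h1 := picardLimit_sub_rateBound P hcm hM hc hU hUM n t ht
  have h2 := picardLimit_sub_rateBound P hcm hM hc hV hVM n t ht
  have h3 := picard_sub_rateBound P hcm hM hc hU hUM hV hVM hA hb hbc hUV n t ht
  refine (h3.add ((hpU.sub hpV).size_slice t ht) (h1.add ((hmU.sub hpU).size_slice t ht) h2)).mono
    (ae_of_all _ fun x => ?_) le_rfl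
  have e : (picardLimit a γ α U - picardLimit a γ α V) t x =
      (picard a γ α U n - picard a γ α V n) t x + ((picardLimit a γ α U - picard a γ α U n) t x -
        (picardLimit a γ α V - picard a γ α V n) t x) := by
    simp only [Pi.sub_apply]
    abel
  rw [size, e]
  exact (enorm_add_le _ _).trans (add_le_add le_rfl enorm_sub_le)

theorem picardLimit_zero : picardLimit a γ α (0 : ℝ → Rd d → 𝕜) = 0 := by
  have h : ∀ n, picard a γ α (0 : ℝ → Rd d → 𝕜) n = 0 := fun n => by
    induction n with
    | zero => rfl
    | succ n ih => funext t x; simp [picard, ih, duh_zero]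
  funext t x
  simp only [picardLimit, h]
  exact tendsto_const_nhds.limUnder_eq

theorem picardLimit_rateBound [NeZero d] (P : Params d γ α k θ) (hcm : α * rate d γ α k θ ≤ cm)
    (hM : 0 ≤ M) (hc : Contracts 𝕜 d a γ α k θ cm M) {U : ℝ → Rd d → 𝕜}
    (hU : StronglyMeasurable (Function.uncurry U))
    (hUM : RateBound k θ (M / 2) (rate d γ α k θ) (size U)) {A b : ℝ} (hA : 0 ≤ A)
    (hb : 0 ≤ b) (hbc : (α - 1) * rate d γ α k θ + b ≤ cm) (hUA : RateBound k θ A b (size U)) :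
    RateBound k θ (2 * A) b (size (picardLimit a γ α U)) := by
  have := picardLimit_sub_le P hcm hM hc hU hUM (V := 0) stronglyMeasurable_zero .zero hA hb hbc
    (by rwa [sub_zero])
  rwa [picardLimit_zero, sub_zero] at this

theorem picardLimit_isGlobalSolution [NeZero d] (P : Params d γ α k θ)
    (hcm : α * rate d γ α k θ ≤ cm)
    (hM : 0 ≤ M) (hc : Contracts 𝕜 d a γ α k θ cm M) {U : ℝ → Rd d → 𝕜}
    (hU : StronglyMeasurable (Function.uncurry U))
    (hUM : RateBound k θ (M / 2) (rate d γ α k θ) (size U)) :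
    IsGlobalSolution a γ α U (picardLimit a γ α U) := by
  set u := picardLimit a γ α U with hu
  have hus := stronglyMeasurable_picardLimit (a := a) (γ := γ) P.one_lt hU
  have hum := TimeMeasurable.of_stronglyMeasurable hus
  have hr := P.rate_pos
  have hrc : (α - 1) * rate d γ α k θ + rate d γ α k θ ≤ cm := by linarith
  have hub : RateBound k θ M (rate d γ α k θ) (size u) :=
    (picardLimit_rateBound P hcm hM hc hU hUM (by positivity) hr.le hrc hUM).mono
      (fun _ _ => .rfl) (by linarith)
  have hfin := (hc u u hum hum hub hub).1
  have hint : ∀ t, 0 < t → ∀ᵐ x : Rd d, Integrable (fun z : ℝ × Rd d =>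
      gaussKernel (t - z.1) (x - z.2) • nonlin γ α (u z.1) z.2)
      ((volume.restrict (Ioo (0 : ℝ) t)).prod volume) := fun t ht => by
    filter_upwards [hfin t ht] with x hx
    exact integrable_duh P.one_lt (hum.joint t ht) hx
  refine ⟨hus.aestronglyMeasurable, hum.slice, hint, fun t ht => ?_⟩
  have hz : LBound k θ 0 (fun x => ‖u t x - (U t x + a • duh γ α u 0 t x)‖ₑ) := by
    have hlim := (tendsto_ofReal_half_pow M (t ^ (-rate d γ α k θ))).add
      (tendsto_ofReal_half_pow M (t ^ (-rate d γ α k θ)))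
    rw [add_zero] at hlim
    refine LBound.of_tendsto P.theta_lt_one.le hlim fun n => ?_
    have hpm := timeMeasurable_picard (a := a) (γ := γ) P.one_lt hU
    have h1 := picardLimit_sub_rateBound P hcm hM hc hU hUM (n + 1) t ht
    have h2 := (hc _ _ hum (hpm n) hub (picard_rateBound P hcm hM hc hU hUM n)).2 _ _
      (by positivity) hr.le hrc (picardLimit_sub_rateBound P hcm hM hc hU hUM n) t ht
    have e1 : 2 * M / 2 ^ (n + 1) = M / 2 ^ n := by rw [pow_succ]; field_simp
    have e2 : 2 * M / 2 ^ n / 2 = M / 2 ^ n := by field_simp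
    rw [e1] at h1
    rw [e2] at h2
    rw [zero_add]
    refine (h1.add ((hum.sub (hpm (n + 1))).size_slice t ht) h2).mono
      (ae_of_all _ fun x => ?_) le_rfl
    have e : u t x - (U t x + a • duh γ α u 0 t x) = (u - picard a γ α U (n + 1)) t x -
        a • (duh γ α u 0 t x - duh γ α (picard a γ α U n) 0 t x) := by
      simp only [Pi.sub_apply, picard, smul_sub]
      abel
    exact (congrArg (‖·‖ₑ) e).le.trans enorm_sub_le
  have hmeas : AEMeasurable (fun x => ‖u t x - (U t x + a • duh γ α u 0 t x)‖ₑ) volume := by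
    have hd := (TimeMeasurable.of_stronglyMeasurable
      (stronglyMeasurable_duh (γ := γ) P.one_lt hus)).slice t ht
    exact ((hum.slice t ht).sub (((TimeMeasurable.of_stronglyMeasurable hU).slice t ht).add
      (hd.const_smul a))).enorm
  filter_upwards [LBound.ae_eq_zero hmeas hz, hint t ht] with x hx hix
  rw [← duh_eq_integral hix]
  exact sub_eq_zero.1 (enorm_eq_zero.1 hx)

theorem _root_.IsGlobalSolution.timeMeasurable {U u : ℝ → Rd d → 𝕜}
    (h : IsGlobalSolution a γ α U u) : TimeMeasurable u :=
  ⟨h.measurable_slice, fun _ _ => h.measurable.mono_measure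
    (Measure.prod_mono (Measure.restrict_mono Ioo_subset_Ioi_self le_rfl) le_rfl)⟩

theorem _root_.IsGlobalSolution.equation_duh {U u : ℝ → Rd d → 𝕜}
    (h : IsGlobalSolution a γ α U u) {t : ℝ} (ht : 0 < t) :
    ∀ᵐ x, u t x = U t x + a • duh γ α u 0 t x := by
  filter_upwards [h.equation t ht, h.integrable t ht] with x hx hi
  rw [hx, duh_eq_integral hi]

theorem _root_.IsGlobalSolution.eq_of_rateBound [NeZero d] (P : Params d γ α k θ)
    (hcm : α * rate d γ α k θ ≤ cm) (hM : 0 ≤ M)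
    (hc : Contracts 𝕜 d a γ α k θ cm M) {U u v : ℝ → Rd d → 𝕜}
    (hu : IsGlobalSolution a γ α U u) (hv : IsGlobalSolution a γ α U v)
    (huM : RateBound k θ M (rate d γ α k θ) (size u))
    (hvM : RateBound k θ M (rate d γ α k θ) (size v)) {t : ℝ} (ht : 0 < t) :
    u t =ᵐ[volume] v t := by
  have hr := P.rate_pos
  have hum := hu.timeMeasurable
  have hvm := hv.timeMeasurable
  have hn : ∀ n : ℕ, RateBound k θ (2 * M / 2 ^ n) (rate d γ α k θ) (size (u - v)) := fun n => by
    induction n with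
    | zero =>
      refine (huM.add hM hM hum.size_slice hvM).mono
        (fun t ht => ae_of_all _ fun x => ?_) (by rw [pow_zero]; linarith)
      exact enorm_sub_le
    | succ n ih =>
      refine ((hc u v hum hvm huM hvM).2 _ _ (by positivity) hr.le (by linarith) ih).mono
        (fun t ht => ?_) (by rw [pow_succ, div_div])
      filter_upwards [hu.equation_duh ht, hv.equation_duh ht] with x h1 h2
      refine le_of_eq ?_
      rw [size, size, Pi.sub_apply, Pi.sub_apply, h1, h2, smul_sub]
      congr 1
      abel
  have h0 : LBound k θ 0 (size (u - v) t) :=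
    LBound.of_tendsto P.theta_lt_one.le (tendsto_ofReal_half_pow (2 * M) (t ^ (-rate d γ α k θ)))
      fun n => by rw [zero_add]; exact hn n t ht
  filter_upwards [LBound.ae_eq_zero ((hum.sub hvm).size_slice t ht) h0] with x hx
  exact sub_eq_zero.1 (enorm_eq_zero.1 hx)

end Contraction

/-! ### The heat semigroup on tempered distributions -/

section Averages

variable {d : ℕ} {V : Type*} [NormedAddCommGroup V] [NormedSpace ℝ V]

theorem fderiv_integral_smul_comp_sub {h : Rd d → ℝ} (hh : Integrable h) {f : Rd d → V}
    (hf : ContDiff ℝ 1 f) {B B' : ℝ} (hB : ∀ y, ‖f y‖ ≤ B) (hB' : ∀ y, ‖fderiv ℝ f y‖ ≤ B')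
    (y : Rd d) :
    fderiv ℝ (fun y => ∫ z, h z • f (y - z)) y = ∫ z, h z • fderiv ℝ f (y - z) := by
  have hfd : Continuous (fderiv ℝ f) := hf.continuous_fderiv one_ne_zero
  refine (hasFDerivAt_integral_of_dominated_of_fderiv_le (𝕜 := ℝ) (s := univ)
    (F := fun y z => h z • f (y - z)) (F' := fun y z => h z • fderiv ℝ f (y - z))
    (bound := fun z => ‖h z‖ * B') univ_mem
    (Eventually.of_forall fun y => hh.aestronglyMeasurable.smul
      (hf.continuous.comp (continuous_const.sub continuous_id)).aestronglyMeasurable) ?_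
    (hh.aestronglyMeasurable.smul
      (hfd.comp (continuous_const.sub continuous_id)).aestronglyMeasurable)
    (ae_of_all _ fun z y _ => ?_) (hh.norm.mul_const B') (ae_of_all _ fun z y _ => ?_)).fderiv
  · exact hh.smul_bdd B
      (hf.continuous.comp (continuous_const.sub continuous_id)).aestronglyMeasurable
      (ae_of_all _ fun z => hB _)
  · rw [norm_smul]
    gcongr
    exact hB' _
  · have := ((hf.differentiable one_ne_zero (y - z)).hasFDerivAt.comp y
      ((hasFDerivAt_id y).sub_const z)).const_smul (h z)
    rw [ContinuousLinearMap.comp_id] at this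
    exact this

theorem iteratedFDeriv_integral_smul_comp_sub {𝕜 : Type*} [RCLike 𝕜] {h : Rd d → ℝ}
    (hh : Integrable h) (g : 𝓢(Rd d, 𝕜)) (n : ℕ) :
    iteratedFDeriv ℝ n (fun y => ∫ z, h z • g (y - z)) =
      fun y => ∫ z, h z • iteratedFDeriv ℝ n g (y - z) := by
  have hb : ∀ n, ∃ B, ∀ y, ‖iteratedFDeriv ℝ n g y‖ ≤ B := fun n => by
    obtain ⟨B, hB⟩ := g.decay' 0 n
    exact ⟨B, fun y => by have := hB y; rwa [pow_zero, one_mul] at this⟩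
  induction n with
  | zero =>
    funext y
    rw [iteratedFDeriv_zero_eq_comp, Function.comp_apply]
    have := ((continuousMultilinearCurryFin0 ℝ (Rd d) 𝕜).symm.toContinuousLinearEquiv).integral_comp_comm
      (μ := volume) (fun z => h z • g (y - z))
    exact this.symm
  | succ n ih =>
    funext y
    obtain ⟨B, hB⟩ := hb n
    obtain ⟨B', hB'⟩ := hb (n + 1)
    rw [iteratedFDeriv_succ_eq_comp_left, Function.comp_apply, ih,
      fderiv_integral_smul_comp_sub hh ((g.smooth ⊤).iteratedFDeriv_right (m := 1)
        (by exact_mod_cast le_top)) hB (B' := B')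
        (fun y => by rw [norm_fderiv_iteratedFDeriv]; exact hB' y)]
    exact (ContinuousLinearEquiv.integral_comp_comm (𝕜 := ℝ) (μ := volume)
      ((continuousMultilinearCurryLeftEquiv ℝ (fun _ : Fin (n + 1) => Rd d)
        𝕜).symm.toContinuousLinearEquiv : _ ≃L[ℝ] _)
      (fun z => h z • fderiv ℝ (iteratedFDeriv ℝ n g) (y - z))).symm

end Averages

section Jets

variable {𝕜 : Type*} [RCLike 𝕜] {d : ℕ}

open scoped BoundedContinuousFunction

/-- The function `y ↦ |y|^m D^n g(y)`. -/
def weightedDeriv (m n : ℕ) : 𝓢(Rd d, 𝕜) →ₗ[𝕜] (Rd d →ᵇ (Rd d [×n]→L[ℝ] 𝕜)) where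
  toFun g := BoundedContinuousFunction.ofNormedAddCommGroup
    (fun y => ‖y‖ ^ m • iteratedFDeriv ℝ n g y)
    ((continuous_norm.pow m).smul ((g.smooth n).continuous_iteratedFDeriv le_rfl))
    (SchwartzMap.seminorm 𝕜 m n g) (fun y => by
      rw [norm_smul, norm_pow, norm_norm]
      exact g.le_seminorm 𝕜 m n y)
  map_add' f g := by
    ext1 y
    have h : iteratedFDeriv ℝ n (⇑(f + g)) y = iteratedFDeriv ℝ n f y + iteratedFDeriv ℝ n g y :=
      iteratedFDeriv_add_apply (f.smooth n).contDiffAt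
        (g.smooth n).contDiffAt
    simp only [BoundedContinuousFunction.coe_ofNormedAddCommGroup, h,
      BoundedContinuousFunction.coe_add, Pi.add_apply, smul_add]
  map_smul' c f := by
    ext1 y
    have h : iteratedFDeriv ℝ n (⇑(c • f)) y = c • iteratedFDeriv ℝ n f y :=
      iteratedFDeriv_const_smul_apply (f.smooth n).contDiffAt
    simp only [BoundedContinuousFunction.coe_ofNormedAddCommGroup, h, RingHom.id_apply,
      BoundedContinuousFunction.coe_smul]
    exact smul_comm _ _ _

/-- The Banach space that contains the families of functions `y ↦ |y|^m D^n g(y)`. -/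
def JetSpace (𝕜 : Type*) [RCLike 𝕜] (d : ℕ) (s : Finset (ℕ × ℕ)) : Type _ :=
  ∀ i : s, Rd d →ᵇ (Rd d [×i.1.2]→L[ℝ] 𝕜)

namespace JetSpace

variable {s : Finset (ℕ × ℕ)}

instance : NormedAddCommGroup (JetSpace 𝕜 d s) :=
  inferInstanceAs (NormedAddCommGroup (∀ i : s, Rd d →ᵇ (Rd d [×i.1.2]→L[ℝ] 𝕜)))

instance : NormedSpace ℝ (JetSpace 𝕜 d s) :=
  inferInstanceAs (NormedSpace ℝ (∀ i : s, Rd d →ᵇ (Rd d [×i.1.2]→L[ℝ] 𝕜)))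

instance : NormedSpace 𝕜 (JetSpace 𝕜 d s) :=
  inferInstanceAs (NormedSpace 𝕜 (∀ i : s, Rd d →ᵇ (Rd d [×i.1.2]→L[ℝ] 𝕜)))

instance : CompleteSpace (JetSpace 𝕜 d s) :=
  inferInstanceAs (CompleteSpace (∀ i : s, Rd d →ᵇ (Rd d [×i.1.2]→L[ℝ] 𝕜)))

theorem norm_le_iff {C : ℝ} (hC : 0 ≤ C) (J : JetSpace 𝕜 d s) :
    ‖J‖ ≤ C ↔ ∀ (i : s) (y : Rd d), ‖J i y‖ ≤ C :=
  (pi_norm_le_iff_of_nonneg hC).trans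
    (forall_congr' fun _ => BoundedContinuousFunction.norm_le hC)

theorem norm_apply_le (J : JetSpace 𝕜 d s) (i : s) (y : Rd d) : ‖J i y‖ ≤ ‖J‖ :=
  (norm_le_iff (norm_nonneg J) J).1 le_rfl i y

/-- Evaluation of a component at a point. -/
def eval (i : s) (y : Rd d) : JetSpace 𝕜 d s →L[ℝ] (Rd d [×i.1.2]→L[ℝ] 𝕜) :=
  LinearMap.mkContinuous
    { toFun J := J i y
      map_add' _ _ := rfl
      map_smul' _ _ := rfl } 1 (fun J => by
        rw [one_mul]
        exact norm_apply_le J i y)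

theorem eval_apply (i : s) (y : Rd d) (J : JetSpace 𝕜 d s) : eval i y J = J i y := rfl

instance : IsScalarTower ℝ 𝕜 (JetSpace 𝕜 d s) :=
  ⟨fun r c J => by
    refine funext fun i => BoundedContinuousFunction.ext fun y => ?_
    change (r • c) • J i y = r • c • J i y
    exact smul_assoc _ _ _⟩

end JetSpace

/-- The finite families of functions `y ↦ |y|^m D^n g(y)`. -/
def jets (s : Finset (ℕ × ℕ)) : 𝓢(Rd d, 𝕜) →ₗ[𝕜] JetSpace 𝕜 d s where
  toFun g := fun i => weightedDeriv i.1.1 i.1.2 g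
  map_add' f g := funext fun i => map_add (weightedDeriv (𝕜 := 𝕜) i.1.1 i.1.2) f g
  map_smul' c g := funext fun i => map_smul (weightedDeriv (𝕜 := 𝕜) i.1.1 i.1.2) c g

theorem jets_apply (s : Finset (ℕ × ℕ)) (g : 𝓢(Rd d, 𝕜)) (i : s) (y : Rd d) :
    jets s g i y = ‖y‖ ^ i.1.1 • iteratedFDeriv ℝ i.1.2 g y := rfl

theorem exists_extension_of_norm_le {X E : Type*} [AddCommGroup X] [Module 𝕜 X]
    [NormedAddCommGroup E] [NormedSpace 𝕜 E] (J : X →ₗ[𝕜] E) (φ : X →ₗ[𝕜] 𝕜) (C : ℝ)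
    (hle : ∀ f, ‖φ f‖ ≤ C * ‖J f‖) : ∃ Ψ : E →L[𝕜] 𝕜, ∀ f, φ f = Ψ (J f) := by
  have hker : LinearMap.ker J ≤ LinearMap.ker φ := fun f hf => by
    have := hle f
    rw [LinearMap.mem_ker.1 hf, norm_zero, mul_zero] at this
    exact LinearMap.mem_ker.2 (norm_le_zero_iff.1 this)
  let L : LinearMap.range J →ₗ[𝕜] 𝕜 :=
    (Submodule.liftQ _ φ hker).comp (LinearMap.quotKerEquivRange J).symm.toLinearMap
  have hL : ∀ f, L ⟨J f, LinearMap.mem_range_self _ f⟩ = φ f := fun f => by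
    simp only [L, LinearMap.comp_apply, LinearEquiv.coe_coe]
    rw [LinearMap.quotKerEquivRange_symm_apply_image]
    rfl
  let L' : LinearMap.range J →L[𝕜] 𝕜 :=
    L.mkContinuous C (by
      rintro ⟨_, f, rfl⟩
      rw [hL]
      exact hle f)
  obtain ⟨Ψ, hΨ, -⟩ := exists_extension_norm_eq _ L'
  refine ⟨Ψ, fun f => ?_⟩
  exact (hL f).symm.trans (hΨ ⟨J f, LinearMap.mem_range_self _ f⟩).symm

/-- A tempered distribution factors through finitely many weighted derivatives. -/
theorem exists_jets_extension (φ : 𝓢(Rd d, 𝕜) →L[𝕜] 𝕜) :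
    ∃ (s : Finset (ℕ × ℕ)) (Ψ : JetSpace 𝕜 d s →L[𝕜] 𝕜), ∀ f, φ f = Ψ (jets s f) := by
  obtain ⟨s, C, -, hC⟩ := Seminorm.bound_of_continuous (schwartz_withSeminorms 𝕜 (Rd d) 𝕜)
    ((normSeminorm 𝕜 𝕜).comp φ.toLinearMap) (continuous_norm.comp φ.continuous)
  have hle : ∀ f, ‖φ f‖ ≤ C * ‖jets s f‖ := fun f => by
    refine (hC f).trans ?_
    rw [smul_apply, NNReal.smul_def, smul_eq_mul]
    gcongr
    refine Seminorm.finset_sup_apply_le (norm_nonneg _) fun i hi => ?_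
    refine SchwartzMap.seminorm_le_bound 𝕜 i.1 i.2 f (norm_nonneg _) fun y => ?_
    have h1 := JetSpace.norm_apply_le (jets s f) ⟨i, hi⟩ y
    rwa [jets_apply, norm_smul, norm_pow, norm_norm] at h1
  exact ⟨s, exists_extension_of_norm_le (jets s) φ.toLinearMap C hle⟩

theorem pow_norm_mul_le (g : 𝓢(Rd d, 𝕜)) (m n : ℕ) :
    ∃ B, 0 ≤ B ∧ ∀ w r : Rd d, ‖w + r‖ ^ m * ‖iteratedFDeriv ℝ n g w‖ ≤ B * (1 + ‖r‖) ^ m := by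
  refine ⟨2 ^ m * ((Finset.Iic (m, n)).sup fun i => SchwartzMap.seminorm ℝ i.1 i.2) g,
    by positivity, fun w r => ?_⟩
  have h1 := SchwartzMap.one_add_le_sup_seminorm_apply (𝕜 := ℝ) (m := (m, n)) le_rfl le_rfl g w
  calc ‖w + r‖ ^ m * ‖iteratedFDeriv ℝ n g w‖
      ≤ ((1 + ‖w‖) * (1 + ‖r‖)) ^ m * ‖iteratedFDeriv ℝ n g w‖ := by
        gcongr
        nlinarith [norm_add_le w r, norm_nonneg w, norm_nonneg r,
          mul_nonneg (norm_nonneg w) (norm_nonneg r)]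
    _ = ((1 + ‖w‖) ^ m * ‖iteratedFDeriv ℝ n g w‖) * (1 + ‖r‖) ^ m := by rw [mul_pow]; ring
    _ ≤ _ := by gcongr

end Jets

section Translation

variable {𝕜 : Type*} [RCLike 𝕜] {d : ℕ}

theorem iteratedFDeriv_translate (g : 𝓢(Rd d, 𝕜)) (z : Rd d) (n : ℕ) (y : Rd d) :
    iteratedFDeriv ℝ n (SchwartzMap.compSubConstCLM 𝕜 z g) y = iteratedFDeriv ℝ n g (y - z) :=
  iteratedFDeriv_comp_sub (f := g) n z y

theorem exists_norm_jets_translate_le (s : Finset (ℕ × ℕ)) (g : 𝓢(Rd d, 𝕜)) :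
    ∃ (B : ℝ) (m : ℕ), ∀ z, ‖jets s (SchwartzMap.compSubConstCLM 𝕜 z g)‖ ≤ B * (1 + ‖z‖) ^ m := by
  choose B hB0 hB using fun i : ℕ × ℕ => pow_norm_mul_le g i.1 i.2
  refine ⟨∑ i ∈ s, B i, ∑ i ∈ s, i.1, fun z => ?_⟩
  have h1 : (1 : ℝ) ≤ 1 + ‖z‖ := by linarith [norm_nonneg z]
  have hs : 0 ≤ ∑ i ∈ s, B i := Finset.sum_nonneg fun i _ => hB0 i
  rw [JetSpace.norm_le_iff (by positivity)]
  intro i y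
  rw [jets_apply, iteratedFDeriv_translate, norm_smul, norm_pow, norm_norm]
  have := hB i (y - z) z
  rw [sub_add_cancel] at this
  refine this.trans ?_
  gcongr
  · exact Finset.single_le_sum (fun i _ => hB0 i) i.2
  · exact Finset.single_le_sum (f := fun i : ℕ × ℕ => i.1) (fun i _ => Nat.zero_le _) i.2

theorem continuous_jets_translate (s : Finset (ℕ × ℕ)) (g : 𝓢(Rd d, 𝕜)) :
    Continuous fun z => jets s (SchwartzMap.compSubConstCLM 𝕜 z g) := by
  choose B hB0 hB using fun i : ℕ × ℕ => pow_norm_mul_le g i.1 (i.2 + 1)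
  refine continuous_iff_continuousAt.2 fun z₀ => ?_
  set K : ℝ := ∑ i ∈ s, B i * (2 + ‖z₀‖) ^ i.1 with hK
  have hK0 : ∀ i ∈ s, 0 ≤ B i * (2 + ‖z₀‖) ^ i.1 := fun i _ => mul_nonneg (hB0 i) (by positivity)
  have key : ∀ᶠ z in 𝓝 z₀, dist (jets s (SchwartzMap.compSubConstCLM 𝕜 z g))
      (jets s (SchwartzMap.compSubConstCLM 𝕜 z₀ g)) ≤ K * ‖z - z₀‖ := by
    filter_upwards [Metric.closedBall_mem_nhds z₀ one_pos] with z hz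
    rw [Metric.mem_closedBall, dist_eq_norm] at hz
    rw [dist_eq_norm, JetSpace.norm_le_iff (mul_nonneg (Finset.sum_nonneg hK0) (norm_nonneg _))]
    intro i y
    have e : (jets s (SchwartzMap.compSubConstCLM 𝕜 z g) -
        jets s (SchwartzMap.compSubConstCLM 𝕜 z₀ g)) i y =
        ‖y‖ ^ i.1.1 • iteratedFDeriv ℝ i.1.2 g (y - z) -
          ‖y‖ ^ i.1.1 • iteratedFDeriv ℝ i.1.2 g (y - z₀) := by
      rw [← iteratedFDeriv_translate, ← iteratedFDeriv_translate]
      rfl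
    have hd : ∀ w, HasFDerivAt (fun w => ‖y‖ ^ i.1.1 • iteratedFDeriv ℝ i.1.2 g w)
        (‖y‖ ^ i.1.1 • fderiv ℝ (iteratedFDeriv ℝ i.1.2 g) w) w := fun w => by
      have := ((g.smooth (i.1.2 + 1)).differentiable_iteratedFDeriv
        (by exact_mod_cast Nat.lt_succ_self _) w).hasFDerivAt.const_smul (‖y‖ ^ i.1.1)
      exact this
    have hmv := (convex_closedBall (y - z₀) 1).norm_image_sub_le_of_norm_hasFDerivWithin_le
      (f := fun w => ‖y‖ ^ i.1.1 • iteratedFDeriv ℝ i.1.2 g w)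
      (C := B i * (2 + ‖z₀‖) ^ i.1.1) (fun w _ => (hd w).hasFDerivWithinAt) (fun w hw => ?_)
      (Metric.mem_closedBall_self zero_le_one) (y := y - z) (by
        rw [Metric.mem_closedBall, dist_eq_norm, sub_sub_sub_cancel_left, norm_sub_rev]
        exact hz)
    · rw [e]
      refine hmv.trans ?_
      rw [sub_sub_sub_cancel_left, norm_sub_rev]
      gcongr
      exact Finset.single_le_sum (f := fun i : ℕ × ℕ => B i * (2 + ‖z₀‖) ^ i.1) hK0 i.2
    · rw [norm_smul, norm_pow, norm_norm, norm_fderiv_iteratedFDeriv]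
      have := hB i w (y - w)
      rw [add_sub_cancel] at this
      refine this.trans ?_
      have h0 := hB0 i
      rw [Metric.mem_closedBall, dist_eq_norm] at hw
      have : ‖y - w‖ ≤ 1 + ‖z₀‖ := by
        calc ‖y - w‖ = ‖z₀ - (w - (y - z₀))‖ := by congr 1; abel
          _ ≤ ‖z₀‖ + ‖w - (y - z₀)‖ := norm_sub_le _ _
          _ ≤ 1 + ‖z₀‖ := by linarith
      exact mul_le_mul_of_nonneg_left (pow_le_pow_left₀ (by positivity) (by linarith) _) h0
  rw [ContinuousAt, tendsto_iff_dist_tendsto_zero]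
  refine squeeze_zero' (Eventually.of_forall fun _ => dist_nonneg) key ?_
  have : Tendsto (fun z => K * ‖z - z₀‖) (𝓝 z₀) (𝓝 (K * ‖z₀ - z₀‖)) :=
    (Continuous.tendsto (by fun_prop) z₀)
  rwa [sub_self, norm_zero, mul_zero] at this

theorem heatTest_eq_translate {t : ℝ} (ht : 0 < t) (x : Rd d) :
    heatTest 𝕜 ht x = SchwartzMap.compSubConstCLM 𝕜 x (heatTest 𝕜 ht 0) := by
  ext y
  rw [SchwartzMap.compSubConstCLM_apply, heatTest_apply, heatTest_apply]
  congr 2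
  abel

theorem continuous_heatDist (φ : 𝓢(Rd d, 𝕜) →L[𝕜] 𝕜) (t : ℝ) : Continuous (heatDist φ t) := by
  obtain ⟨s, Ψ, hΨ⟩ := exists_jets_extension φ
  unfold heatDist
  split_ifs with ht
  · refine (Ψ.continuous.comp (continuous_jets_translate s (heatTest 𝕜 ht 0))).congr fun x => ?_
    rw [heatTest_eq_translate ht x, hΨ]
    rfl
  · exact continuous_const

theorem integrable_gaussKernel_mul_pow {t : ℝ} (ht : 0 < t) (x : Rd d) (m : ℕ) :
    Integrable fun z => gaussKernel t (x - z) * (1 + ‖z‖) ^ m := by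
  have h := fun k => SchwartzMap.integrable_pow_mul volume (heatTest ℝ ht x) k
  have e : ∀ z, ‖heatTest ℝ ht x z‖ = gaussKernel t (x - z) := fun z => by
    rw [heatTest_apply]
    exact Real.norm_of_nonneg (gaussKernel_nonneg ht _)
  simp only [e] at h
  refine (((h 0).add (h m)).const_mul (2 ^ (m - 1))).mono'
    (((continuous_gaussKernel t).comp (continuous_const.sub continuous_id)).mul
      ((continuous_const.add continuous_norm).pow m)).aestronglyMeasurable
    (ae_of_all _ fun z => ?_)
  have hg := gaussKernel_nonneg ht (x - z)
  rw [Real.norm_of_nonneg (by positivity)]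
  calc gaussKernel t (x - z) * (1 + ‖z‖) ^ m
      ≤ gaussKernel t (x - z) * (2 ^ (m - 1) * (1 ^ m + ‖z‖ ^ m)) := by
        gcongr
        exact add_pow_le zero_le_one (norm_nonneg _) m
    _ = _ := by simp only [Pi.add_apply, one_pow, pow_zero]; ring

/-- The semigroup property on tempered distributions. -/
theorem heatDist_add (φ : 𝓢(Rd d, 𝕜) →L[𝕜] 𝕜) {s r : ℝ} (hs : 0 < s) (hr : 0 < r) (x : Rd d) :
    heatDist φ (s + r) x = heatFun (heatDist φ r) s x := by
  obtain ⟨S, Ψ, hΨ⟩ := exists_jets_extension φ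
  set g : 𝓢(Rd d, 𝕜) := heatTest 𝕜 hr 0 with hg
  set J : Rd d → JetSpace 𝕜 d S := fun z => jets S (SchwartzMap.compSubConstCLM 𝕜 z g) with hJ
  obtain ⟨B, m, hB⟩ := exists_norm_jets_translate_le S g
  have hint : Integrable fun z => gaussKernel s (x - z) • J z := by
    refine ((integrable_gaussKernel_mul_pow hs x m).const_mul B).mono'
      (((continuous_gaussKernel s).comp (continuous_const.sub continuous_id)).smul
        (continuous_jets_translate S g)).aestronglyMeasurable (ae_of_all _ fun z => ?_)
    have hgk := gaussKernel_nonneg hs (x - z)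
    rw [norm_smul, Real.norm_of_nonneg hgk]
    calc gaussKernel s (x - z) * ‖J z‖ ≤ gaussKernel s (x - z) * (B * (1 + ‖z‖) ^ m) := by
          gcongr; exact hB z
      _ = _ := by ring
  have hI : jets S (heatTest 𝕜 (add_pos hs hr) x) = ∫ z, gaussKernel s (x - z) • J z := by
    have hfun : (⇑(heatTest 𝕜 (add_pos hs hr) x) : Rd d → 𝕜) =
        fun y => ∫ z, gaussKernel s (x - z) • g (y - z) := by
      funext y
      rw [heatTest_apply, ← integral_gaussKernel_mul hs hr, ← integral_ofReal]
      refine integral_congr_ae (ae_of_all _ fun z => ?_)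
      simp only [hg, heatTest_apply]
      rw [zero_sub, neg_sub, RCLike.real_smul_eq_coe_mul, RCLike.ofReal_mul]
    refine funext fun i => BoundedContinuousFunction.ext fun y => ?_
    have h1 := ContinuousLinearMap.integral_comp_comm (JetSpace.eval (𝕜 := 𝕜) i y) hint
    simp only [map_smul, JetSpace.eval_apply] at h1
    rw [← h1, jets_apply, hfun, iteratedFDeriv_integral_smul_comp_sub
      (by simpa using integrable_gaussKernel_mul_pow hs x 0), ← integral_smul]
    refine integral_congr_ae (ae_of_all _ fun z => ?_)
    simp only [hJ, jets_apply, iteratedFDeriv_translate]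
    exact smul_comm _ _ _
  rw [heatDist, dif_pos (add_pos hs hr), hΨ, hI, ← ContinuousLinearMap.integral_comp_comm Ψ hint,
    heatFun]
  refine integral_congr_ae (ae_of_all _ fun z => ?_)
  simp only [heatDist, dif_pos hr]
  rw [heatTest_eq_translate, hΨ, ← algebraMap_smul 𝕜 (gaussKernel s (x - z)) (J z), map_smul,
    algebraMap_smul]

theorem stronglyMeasurable_heatFun {f : Rd d → 𝕜} (hf : AEStronglyMeasurable f volume) :
    StronglyMeasurable (Function.uncurry (heatFun f)) := by
  have e : heatFun f = heatFun (hf.mk f) := by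
    funext t x
    refine integral_congr_ae ?_
    filter_upwards [hf.ae_eq_mk] with y hy
    rw [hy]
  rw [e]
  refine StronglyMeasurable.integral_prod_right
    (f := fun (z : ℝ × Rd d) (y : Rd d) => gaussKernel z.1 (z.2 - y) • hf.mk f y) ?_
  refine StronglyMeasurable.smul ?_ (hf.stronglyMeasurable_mk.comp_measurable measurable_snd)
  exact (measurable_gaussKernel.comp (measurable_fst.fst.prodMk
    (measurable_fst.snd.sub measurable_snd))).stronglyMeasurable

theorem stronglyMeasurable_heatDist (φ : 𝓢(Rd d, 𝕜) →L[𝕜] 𝕜) :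
    StronglyMeasurable (Function.uncurry (heatDist φ)) := by
  refine stronglyMeasurable_of_tendsto atTop (f := fun (n : ℕ) =>
    {z : ℝ × Rd d | 1 / ((n : ℝ) + 1) < z.1}.indicator fun z =>
      heatFun (heatDist φ (1 / (n + 1))) (z.1 - 1 / (n + 1)) z.2) (fun n => ?_) ?_
  · refine StronglyMeasurable.indicator ?_ (measurableSet_lt measurable_const measurable_fst)
    exact (stronglyMeasurable_heatFun (continuous_heatDist φ _).aestronglyMeasurable).comp_measurable
      (g := fun z : ℝ × Rd d => (z.1 - 1 / ((n : ℝ) + 1), z.2))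
      ((measurable_fst.sub_const _).prodMk measurable_snd)
  · refine tendsto_pi_nhds.2 fun ⟨t, x⟩ => ?_
    by_cases ht : 0 < t
    · refine tendsto_const_nhds.congr' ?_
      filter_upwards [(tendsto_order.1 (tendsto_one_div_add_atTop_nhds_zero_nat (𝕜 := ℝ))).2 t ht]
        with n hn
      rw [indicator_of_mem (by exact hn), ← heatDist_add φ (by linarith) (by positivity),
        sub_add_cancel]
      rfl
    · refine tendsto_const_nhds.congr fun n => ?_
      rw [indicator_of_notMem]
      · simp [heatDist, ht]
      · simp only [mem_ofPred_eq, not_lt]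
        exact (not_lt.1 ht).trans (by positivity)

end Translation

/-! ### The heat flow of homogeneous profiles -/

section HeatFun

variable {𝕜 : Type*} [RCLike 𝕜] {d : ℕ}

theorem integrable_gaussKernel_smul {f : Rd d → 𝕜} (hf : AEStronglyMeasurable f volume) {t : ℝ}
    (ht : 0 < t) {x : Rd d} (h : heatP t (fun y => ‖f y‖ₑ) x < ∞) :
    Integrable fun y => gaussKernel t (x - y) • f y := by
  refine ⟨((measurable_gaussKernel.comp (measurable_const.prodMk
    (measurable_const.sub measurable_id))).aestronglyMeasurable).smul hf, ?_⟩
  rw [hasFiniteIntegral_iff_enorm]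
  refine lt_of_le_of_lt (le_of_eq (lintegral_congr fun y => ?_)) h
  rw [enorm_smul, Real.enorm_of_nonneg (gaussKernel_nonneg ht _)]

theorem heatFun_add {f : Rd d → 𝕜} (hf : AEStronglyMeasurable f volume) {s r : ℝ} (hs : 0 < s)
    (hr : 0 < r) {x : Rd d} (h : heatP (s + r) (fun y => ‖f y‖ₑ) x < ∞) :
    heatFun f (s + r) x = heatFun (heatFun f r) s x := by
  have hm : AEStronglyMeasurable (fun z : Rd d × Rd d =>
      gaussKernel s (x - z.1) • gaussKernel r (z.1 - z.2) • f z.2) (volume.prod volume) := by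
    refine AEStronglyMeasurable.smul ?_ (AEStronglyMeasurable.smul ?_ (hf.comp_snd))
    · exact (measurable_gaussKernel.comp (measurable_const.prodMk
        (measurable_const.sub measurable_fst))).aestronglyMeasurable
    · exact (measurable_gauss_sub r).aestronglyMeasurable
  have hi : Integrable (fun z : Rd d × Rd d =>
      gaussKernel s (x - z.1) • gaussKernel r (z.1 - z.2) • f z.2) (volume.prod volume) := by
    refine ⟨hm, ?_⟩
    rw [hasFiniteIntegral_iff_enorm, lintegral_prod _ hm.enorm]
    refine lt_of_le_of_lt (le_of_eq ?_) h
    rw [← heatP_heatP hs hr hf.enorm]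
    refine lintegral_congr fun z => ?_
    simp only [enorm_smul, Real.enorm_of_nonneg (gaussKernel_nonneg hs _),
      Real.enorm_of_nonneg (gaussKernel_nonneg hr _)]
    rw [lintegral_const_mul' _ _ ENNReal.ofReal_ne_top]
    rfl
  have h1 := integral_integral_swap
    (f := fun z y => gaussKernel s (x - z) • gaussKernel r (z - y) • f y) hi
  simp only [heatFun] at h1 ⊢
  simp_rw [integral_smul] at h1
  rw [h1]
  refine integral_congr_ae (ae_of_all _ fun y => ?_)
  simp only [smul_smul]
  rw [integral_smul_const, integral_gaussKernel_mul hs hr]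

theorem heatFun_scale {f : Rd d → 𝕜} {σ c t : ℝ} (hc : 0 < c) (ht : 0 < t)
    (hf : ∀ᵐ y, f (c • y) = (c ^ (-σ)) • f y) (x : Rd d) :
    (c ^ σ) • heatFun f (c ^ 2 * t) (c • x) = heatFun f t x := by
  have h := Measure.integral_comp_smul (volume : Measure (Rd d))
    (fun y => gaussKernel (c ^ 2 * t) (c • x - y) • f y) c
  rw [finrank_euclideanSpace_fin, abs_of_pos (by positivity)] at h
  have hcd : (c ^ d)⁻¹ ≠ 0 := by positivity
  have h2 : heatFun f (c ^ 2 * t) (c • x) = (c ^ (-σ)) • heatFun f t x := by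
    rw [heatFun, heatFun, ← integral_smul]
    refine smul_right_injective 𝕜 hcd ?_
    simp only
    rw [← h, ← integral_smul]
    refine integral_congr_ae ?_
    filter_upwards [hf] with y hy
    rw [hy, ← smul_sub, gaussKernel_smul hc ht, mul_smul]
    congr 1
    exact smul_comm _ _ _
  rw [h2, smul_smul, ← Real.rpow_add hc, add_neg_cancel, Real.rpow_zero, one_smul]

theorem heatFun_sq (f : Rd d → 𝕜) {s : ℝ} (hs : 0 < s) (x : Rd d) :
    heatFun f (s ^ 2) x = ∫ w, gaussKernel 1 w • f (x - s • w) := by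
  have h := Measure.integral_comp_smul (volume : Measure (Rd d))
    (fun v => gaussKernel (s ^ 2) v • f (x - v)) s
  rw [finrank_euclideanSpace_fin, abs_of_pos (by positivity)] at h
  have e : heatFun f (s ^ 2) x = ∫ v, gaussKernel (s ^ 2) v • f (x - v) := by
    rw [heatFun, ← integral_sub_left_eq_self _ volume x]
    simp only [sub_sub_cancel]
  have hsd : (s ^ d)⁻¹ ≠ 0 := by positivity
  refine smul_right_injective 𝕜 hsd ?_
  simp only
  rw [e, ← h, ← integral_smul]
  refine integral_congr_ae (ae_of_all _ fun w => ?_)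
  simp only
  rw [smul_smul, ← gaussKernel_smul hs one_pos, mul_one]

theorem ae_eq_zero_of_heatFun [NeZero d] {f : Rd d → 𝕜} {m : ℕ}
    (hf : Integrable fun y => ((1 + ‖y‖) ^ m)⁻¹ • f y)
    (h : ∀ t, 0 < t → heatFun f t =ᵐ[volume] 0) : f =ᵐ[volume] 0 := by
  have hfe : ∀ y, f y = (1 + ‖y‖) ^ m • ((1 + ‖y‖) ^ m)⁻¹ • f y := fun y => by
    rw [smul_smul, mul_inv_cancel₀ (by positivity), one_smul]
  have hcont : Continuous fun y : Rd d => (1 + ‖y‖) ^ m := by fun_prop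
  have hfm : AEStronglyMeasurable f volume :=
    (hcont.aestronglyMeasurable.smul hf.aestronglyMeasurable).congr
      (ae_of_all _ fun y => (hfe y).symm)
  have hloc : LocallyIntegrable f volume := locallyIntegrable_iff.2 fun K hK =>
    (hf.integrableOn.continuousOn_smul hcont.continuousOn hK).congr
      (ae_of_all _ fun y => (hfe y).symm)
  refine ae_eq_zero_of_integral_contDiff_smul_eq_zero hloc fun g hg hgc => ?_
  have hgcont : Continuous g := hg.continuous
  obtain ⟨B, hB⟩ : ∃ B, ∀ y, ‖(1 + ‖y‖) ^ m * g y‖ ≤ B :=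
    (hcont.mul hgcont).bounded_above_of_compact_support hgc.mul_left
  have hB0 : 0 ≤ B := (norm_nonneg _).trans (hB 0)
  have hgb : ∀ s : ℝ, 0 < s → s ≤ 1 → ∀ w y : Rd d,
      ‖g (y + s • w)‖ ≤ B * (1 + ‖w‖) ^ m * ((1 + ‖y‖) ^ m)⁻¹ := fun s hs hs1 w y => by
    have h1 := hB (y + s • w)
    rw [norm_mul, Real.norm_of_nonneg (by positivity)] at h1
    rw [← div_eq_mul_inv, le_div_iff₀ (by positivity)]
    have h2 : 1 + ‖y‖ ≤ (1 + ‖y + s • w‖) * (1 + ‖w‖) := by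
      have e : ‖y‖ ≤ ‖y + s • w‖ + ‖w‖ := by
        calc ‖y‖ = ‖(y + s • w) - s • w‖ := by rw [add_sub_cancel_right]
          _ ≤ ‖y + s • w‖ + ‖s • w‖ := norm_sub_le _ _
          _ ≤ _ := by
            rw [norm_smul, Real.norm_of_nonneg hs.le]
            nlinarith [norm_nonneg w]
      nlinarith [norm_nonneg w, norm_nonneg (y + s • w),
        mul_nonneg (norm_nonneg (y + s • w)) (norm_nonneg w)]
    calc ‖g (y + s • w)‖ * (1 + ‖y‖) ^ m
        ≤ ‖g (y + s • w)‖ * ((1 + ‖y + s • w‖) * (1 + ‖w‖)) ^ m := by gcongr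
      _ = ((1 + ‖y + s • w‖) ^ m * ‖g (y + s • w)‖) * (1 + ‖w‖) ^ m := by rw [mul_pow]; ring
      _ ≤ B * (1 + ‖w‖) ^ m := by gcongr
  have hG : Integrable fun w : Rd d => gaussKernel 1 w * (1 + ‖w‖) ^ m := by
    have := integrable_gaussKernel_mul_pow (d := d) one_pos 0 m
    simpa only [zero_sub, gaussKernel_neg] using this
  set H : ℝ → Rd d × Rd d → 𝕜 := fun s z => gaussKernel 1 z.1 • g (z.2 + s • z.1) • f z.2 with hH
  set D : Rd d × Rd d → ℝ := fun z =>
    B * ((gaussKernel 1 z.1 * (1 + ‖z.1‖) ^ m) * ‖((1 + ‖z.2‖) ^ m)⁻¹ • f z.2‖) with hD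
  have hDi : Integrable D (volume.prod volume) := (hG.mul_prod hf.norm).const_mul B
  have hHm : ∀ s, AEStronglyMeasurable (H s) (volume.prod volume) := fun s => by
    refine AEStronglyMeasurable.smul ?_ (AEStronglyMeasurable.smul ?_ hfm.comp_snd)
    · exact ((continuous_gaussKernel 1).comp continuous_fst).aestronglyMeasurable
    · exact (hgcont.comp (continuous_snd.add (continuous_fst.const_smul s))).aestronglyMeasurable
  have hHD : ∀ s, 0 < s → s ≤ 1 → ∀ z, ‖H s z‖ ≤ D z := fun s hs hs1 z => by
    have h0 := gaussKernel_nonneg one_pos z.1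
    simp only [hH, hD]
    rw [norm_smul, norm_smul, norm_smul, Real.norm_of_nonneg h0,
      Real.norm_of_nonneg (by positivity : 0 ≤ ((1 + ‖z.2‖) ^ m)⁻¹)]
    calc gaussKernel 1 z.1 * (‖g (z.2 + s • z.1)‖ * ‖f z.2‖)
        ≤ gaussKernel 1 z.1 * ((B * (1 + ‖z.1‖) ^ m * ((1 + ‖z.2‖) ^ m)⁻¹) * ‖f z.2‖) := by
          gcongr
          exact hgb s hs hs1 _ _
      _ = _ := by ring
  have hHi : ∀ s, 0 < s → s ≤ 1 → Integrable (H s) (volume.prod volume) := fun s hs hs1 =>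
    hDi.mono' (hHm s) (ae_of_all _ (hHD s hs hs1))
  have hzero : ∀ s, 0 < s → s ≤ 1 → ∫ z, H s z ∂(volume.prod volume) = 0 := fun s hs hs1 => by
    have hT : MeasurePreserving (fun z : Rd d × Rd d => (z.1, z.2 - s • z.1))
        (volume.prod volume) (volume.prod volume) := by
      refine (MeasurePreserving.id volume).skew_product (g := fun w x => x - s • w)
        (measurable_snd.sub (measurable_fst.const_smul s)) (ae_of_all _ fun w => ?_)
      exact (measurePreserving_sub_right volume (s • w)).map_eq
    have hTi := hT.integrable_comp_of_integrable (hHi s hs hs1)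
    have e1 : ∫ z, H s z ∂(volume.prod volume) =
        ∫ z, (H s ∘ fun z : Rd d × Rd d => (z.1, z.2 - s • z.1)) z ∂(volume.prod volume) := by
      conv_lhs => rw [← hT.map_eq]
      exact integral_map hT.measurable.aemeasurable (by rw [hT.map_eq]; exact hHm s)
    rw [e1, integral_prod_symm _ hTi]
    refine integral_eq_zero_of_ae ?_
    filter_upwards [h (s ^ 2) (by positivity)] with x hx
    have e2 := heatFun_sq f hs x
    rw [hx] at e2
    simp only [hH, Function.comp_apply, sub_add_cancel]
    simp_rw [smul_comm (gaussKernel 1 _) (g x)]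
    rw [integral_smul, ← e2]
    simp
  have hlim : Tendsto (fun n : ℕ => ∫ z, H (1 / ((n : ℝ) + 1)) z ∂(volume.prod volume)) atTop
      (𝓝 (∫ z, H 0 z ∂(volume.prod volume))) := by
    refine tendsto_integral_of_dominated_convergence D (fun n => hHm _) hDi
      (fun n => ae_of_all _ (hHD _ (by positivity) ?_)) (ae_of_all _ fun z => ?_)
    · rw [div_le_one (by positivity)]
      linarith [(Nat.cast_nonneg n : (0 : ℝ) ≤ n)]
    · have hc : Continuous fun s : ℝ => H s z := by
        simp only [hH]
        fun_prop
      exact (hc.tendsto 0).comp tendsto_one_div_add_atTop_nhds_zero_nat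
  have h0 : ∫ z, H 0 z ∂(volume.prod volume) = 0 := by
    refine tendsto_nhds_unique hlim (tendsto_const_nhds.congr fun n => ?_)
    refine (hzero _ (by positivity) ?_).symm
    rw [div_le_one (by positivity)]
    linarith [(Nat.cast_nonneg n : (0 : ℝ) ≤ n)]
  have e3 : ∫ z, H 0 z ∂(volume.prod volume) =
      (∫ w : Rd d, gaussKernel 1 w) • ∫ y, g y • f y := by
    simp only [hH, zero_smul, add_zero]
    exact integral_prod_smul (gaussKernel 1) fun y => g y • f y
  rwa [e3, integral_gaussKernel one_pos, one_smul] at h0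

end HeatFun

section Profile

variable {𝕜 : Type*} [RCLike 𝕜] {d : ℕ} {ω : Rd d → 𝕜} {σ ρ : ℝ}

theorem aestronglyMeasurable_profile (hω : AEStronglyMeasurable ω volume) :
    AEStronglyMeasurable (profile ω σ) volume :=
  ((measurable_norm.pow_const (-σ)).aestronglyMeasurable).smul hω

theorem enorm_profile_le (hω : eLpNorm ω ⊤ volume ≤ ENNReal.ofReal ρ) :
    (fun x => ‖profile ω σ x‖ₑ) ≤ᵐ[volume] fun x => ENNReal.ofReal ρ * wt (-σ) x := by
  rw [eLpNorm_exponent_top] at hω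
  filter_upwards [enorm_ae_le_eLpNormEssSup ω volume] with x hx
  rw [profile, enorm_rpow_smul, mul_comm]
  exact mul_le_mul_left (hx.trans hω) _

theorem profile_smul_ae (hω : IsHomogeneousZero ω) {c : ℝ} (hc : 0 < c) :
    ∀ᵐ x, profile ω σ (c • x) = (c ^ (-σ)) • profile ω σ x := by
  filter_upwards [hω.2 c hc] with x hx
  rw [profile, profile, hx, norm_smul, Real.norm_of_nonneg hc.le,
    Real.mul_rpow hc.le (norm_nonneg _), mul_smul]

theorem ae_eq_zero_of_profile [NeZero d] (h : profile ω σ =ᵐ[volume] 0) : ω =ᵐ[volume] 0 := by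
  filter_upwards [h, ae_ne_zero (d := d)] with x hx hx0
  exact (smul_eq_zero.1 hx).resolve_left (Real.rpow_pos_of_pos (norm_pos_iff.2 hx0) _).ne'

theorem lBound_profile [NeZero d] (hω : eLpNorm ω ⊤ volume ≤ ENNReal.ofReal ρ) {θ θm : ℝ}
    (hθ : 0 ≤ θ) (hθm : θ ≤ θm) (hθm1 : θm < 1) :
    LBound (σ - d * θ) θ (ENNReal.ofReal ρ * (weakConst θm * (1 + ballVol d)))
      (fun x => ‖profile ω σ x‖ₑ) := by
  refine ((MeanBound.const_mul (meanBound_wt hθ hθm hθm1) (c := ENNReal.ofReal ρ)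
    ENNReal.ofReal_ne_top)).mono ?_ le_rfl
  filter_upwards [enorm_profile_le (σ := σ) hω, ae_ne_zero (d := d)] with x hx hx0
  calc wt (σ - d * θ) x * ‖profile ω σ x‖ₑ
      ≤ wt (σ - d * θ) x * (ENNReal.ofReal ρ * wt (-σ) x) := mul_le_mul_right hx _
    _ = ENNReal.ofReal ρ * (wt (σ - d * θ) x * wt (-σ) x) := by ring
    _ = _ := by rw [← wt_add _ _ hx0]; congr 2; ring

theorem integrable_profile [NeZero d] (hωm : AEStronglyMeasurable ω volume)
    (hω : eLpNorm ω ⊤ volume ≤ ENNReal.ofReal ρ) (hσ : 0 ≤ σ) (hσd : σ < d) :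
    Integrable fun y => ((1 + ‖y‖) ^ (d + 1))⁻¹ • profile ω σ y := by
  have hd : (0 : ℝ) < d := by exact_mod_cast Nat.pos_of_ne_zero (NeZero.ne d)
  have hm := aestronglyMeasurable_profile (σ := σ) hωm
  have hcont : Continuous fun y : Rd d => ((1 + ‖y‖) ^ (d + 1))⁻¹ :=
    (by fun_prop : Continuous fun y : Rd d => (1 + ‖y‖) ^ (d + 1)).inv₀ fun y => by positivity
  have hball : IntegrableOn (profile ω σ) (Metric.closedBall 0 1) := by
    refine ⟨hm.restrict, ?_⟩
    rw [hasFiniteIntegral_iff_enorm]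
    have h := lBound_profile (σ := σ) hω (θ := σ / d) (by positivity) le_rfl
      ((div_lt_one hd).2 hσd) (Metric.closedBall (0 : Rd d) 1) measurableSet_closedBall
      measure_closedBall_lt_top.ne
    rw [mul_div_cancel₀ _ hd.ne', sub_self] at h
    simp only [wt_zero, one_mul] at h
    refine h.trans_lt (lt_top_iff_ne_top.2 (ENNReal.mul_ne_top (ENNReal.mul_ne_top
      ENNReal.ofReal_ne_top (ENNReal.mul_ne_top (weakConst_ne_top ((div_lt_one hd).2 hσd))
        (ENNReal.add_ne_top.2 ⟨ENNReal.one_ne_top, ballVol_ne_top⟩))) ?_))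
    exact ENNReal.rpow_ne_top_of_nonneg (by have := (div_lt_one hd).2 hσd; linarith)
      measure_closedBall_lt_top.ne
  have h1 : Integrable fun y : Rd d => ((1 + ‖y‖) ^ (d + 1))⁻¹ := by
    have := integrable_one_add_norm (E := Rd d) (μ := volume) (r := d + 1)
      (by rw [finrank_euclideanSpace_fin]; linarith)
    refine this.congr (ae_of_all _ fun y => ?_)
    simp only
    rw [Real.rpow_neg (by positivity), ← Real.rpow_natCast]
    push_cast
    rfl
  rw [← integrableOn_univ, ← union_compl_self (Metric.closedBall (0 : Rd d) 1)]
  refine IntegrableOn.union ?_ ?_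
  · exact hball.continuousOn_smul hcont.continuousOn (isCompact_closedBall 0 1)
  · refine Integrable.mono' (h1.mul_const |ρ|).integrableOn
      (hcont.aestronglyMeasurable.smul hm).restrict ?_
    rw [ae_restrict_iff' measurableSet_closedBall.compl]
    filter_upwards [enorm_profile_le (σ := σ) hω] with y hy hy1
    rw [mem_compl_iff, mem_closedBall_zero_iff, not_le] at hy1
    rw [norm_smul, Real.norm_of_nonneg (by positivity)]
    gcongr
    have h2 : ‖profile ω σ y‖ₑ ≤ ENNReal.ofReal |ρ| := by
      refine hy.trans ?_
      rw [wt, ← ENNReal.ofReal_mul' (by positivity)]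
      refine ENNReal.ofReal_le_ofReal ?_
      have h3 : ‖y‖ ^ (-σ) ≤ 1 := Real.rpow_le_one_of_one_le_of_nonpos hy1.le (by linarith)
      calc ρ * ‖y‖ ^ (-σ) ≤ |ρ| * ‖y‖ ^ (-σ) := by gcongr; exact le_abs_self ρ
        _ ≤ |ρ| * 1 := by gcongr
        _ = |ρ| := mul_one _
    rw [← ofReal_norm] at h2
    exact (ENNReal.ofReal_le_ofReal_iff (abs_nonneg ρ)).1 h2

theorem exists_heatP_profile_bound [NeZero d] (𝕜 : Type*) [RCLike 𝕜] {γ α k θ : ℝ}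
    (P : Params d γ α k θ)
    (hσ : homExp d k θ ≤ σ / 2) (hσd : σ < d) :
    ∃ C : ℝ, 0 < C ∧ ∀ (ρ : ℝ) (ω : Rd d → 𝕜), 0 ≤ ρ → AEStronglyMeasurable ω volume →
      eLpNorm ω ⊤ volume ≤ ENNReal.ofReal ρ → ∀ k' θ', Target d k θ k' θ' →
      homExp d k' θ' ≤ homExp d k θ →
      RateBound k' θ' (C * ρ) (σ / 2 - homExp d k' θ')
        (fun t => heatP t fun x => ‖profile ω σ x‖ₑ) := by
  have hd : (0 : ℝ) < d := by exact_mod_cast Nat.pos_of_ne_zero (NeZero.ne d)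
  obtain ⟨C₁, hC₁, h⟩ := exists_smoothing (d := d) (|σ| + |k| + d) P.theta_lt_one
    ((div_lt_one hd).2 hσd)
  set C₂ : ℝ≥0∞ := C₁ * (weakConst θ * (1 + ballVol d)) with hC₂
  have hwt : weakConst θ * (1 + ballVol d) ≠ ∞ := ENNReal.mul_ne_top
    (weakConst_ne_top P.theta_lt_one) (ENNReal.add_ne_top.2 ⟨ENNReal.one_ne_top, ballVol_ne_top⟩)
  have hC₂t : C₂ ≠ ∞ := ENNReal.mul_ne_top hC₁ hwt
  refine ⟨C₂.toReal + 1, by positivity, fun ρ ω hρ hωm hω k' θ' T hT t ht => ?_⟩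
  have hθ1 : θ' ≤ 1 := T.le.trans P.theta_lt_one.le
  have e : ∀ k θ : ℝ, (d : ℝ) / 2 * (k / d + θ) = homExp d k θ := half_mul_eq_homExp
  have hk' : |k'| ≤ |k| + d := T.abs_weight_le P
  have hσk : k' ≤ σ - d * θ' := by
    have := hT.trans hσ
    rw [homExp] at this
    linarith
  have hp : SmoothingPair d (|σ| + |k| + d) θ (σ / d) (σ - d * θ') θ' k' θ' := by
    refine ⟨?_, by linarith [abs_nonneg σ], hσk, T.nonneg, le_rfl, T.le, ?_, ?_⟩
    · calc |σ - d * θ'| ≤ |σ| + |d * θ'| := abs_sub _ _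
        _ ≤ |σ| + d := by
          rw [abs_of_nonneg (mul_nonneg hd.le T.nonneg)]
          gcongr
          nlinarith
        _ ≤ _ := by linarith [abs_nonneg k]
    · have := T.hom_nonneg
      rw [← e] at this
      exact nonneg_of_mul_nonneg_right this (by positivity)
    · refine le_of_eq ?_
      field_simp
      ring
  refine (h _ _ _ _ _ _ t ht hp (aestronglyMeasurable_profile hωm).enorm
    (ENNReal.mul_ne_top ENNReal.ofReal_ne_top hwt)
    (lBound_profile (σ := σ) hω T.nonneg T.le P.theta_lt_one)).mono (ae_of_all _ fun _ => le_rfl) ?_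
  rw [mul_sub, e, e, show homExp d (σ - d * θ') θ' = σ / 2 by rw [homExp]; ring]
  calc C₁ * ENNReal.ofReal (t ^ (-(σ / 2 - homExp d k' θ'))) *
        (ENNReal.ofReal ρ * (weakConst θ * (1 + ballVol d)))
      = C₂ * (ENNReal.ofReal ρ * ENNReal.ofReal (t ^ (-(σ / 2 - homExp d k' θ')))) := by
        rw [hC₂]; ring
    _ ≤ ENNReal.ofReal (C₂.toReal + 1) *
        (ENNReal.ofReal ρ * ENNReal.ofReal (t ^ (-(σ / 2 - homExp d k' θ')))) := by
        gcongr
        conv_lhs => rw [← ENNReal.ofReal_toReal hC₂t]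
        exact ENNReal.ofReal_le_ofReal (by linarith)
    _ = _ := by
        rw [← ENNReal.ofReal_mul hρ, ← ENNReal.ofReal_mul (by positivity), mul_assoc]

end Profile

/-! ### Restarting the integral equation -/

section Restart

variable {𝕜 : Type*} [RCLike 𝕜] {d : ℕ} {γ α a : ℝ} {u U : ℝ → Rd d → 𝕜} {s t : ℝ}

theorem heatP_duhP (hst : s < t) {h : ℝ → Rd d → ℝ≥0∞}
    (hh : AEMeasurable (Function.uncurry h) ((volume.restrict (Ioo 0 s)).prod volume)) (x : Rd d) :
    heatP (t - s) (duhP 0 s h) x = ∫⁻ τ in Ioo 0 s, heatP (t - τ) (h τ) x := by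
  have hm := aemeasurable_heatP_uncurry hh s
  have hslice : ∀ᵐ τ ∂(volume.restrict (Ioo 0 s)), AEMeasurable (h τ) volume := by
    filter_upwards [Measure.ae_ae_of_ae_prod hh.ae_eq_mk] with τ hτ
    exact ⟨_, hh.measurable_mk.comp measurable_prodMk_left, hτ⟩
  have h1 : heatP (t - s) (duhP 0 s h) x = ∫⁻ w, ∫⁻ τ in Ioo 0 s,
      ENNReal.ofReal (gaussKernel (t - s) (x - w)) * heatP (s - τ) (h τ) w := by
    refine lintegral_congr fun w => ?_
    rw [duhP, lintegral_const_mul' _ _ ENNReal.ofReal_ne_top]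
  rw [h1, lintegral_lintegral_swap]
  · refine lintegral_congr_ae ?_
    filter_upwards [hslice, ae_restrict_mem measurableSet_Ioo] with τ hτ hτs
    have := heatP_heatP (s := t - s) (r := s - τ) (sub_pos.2 hst) (sub_pos.2 hτs.2) hτ x
    rw [sub_add_sub_cancel] at this
    exact this
  · exact (((measurable_gauss_left (t - s) x).comp measurable_fst).aemeasurable).mul
      hm.prod_swap

theorem restrict_Ioo_add {r : ℝ} (hrs : r ≤ s) (hst : s ≤ t) :
    (volume : Measure ℝ).restrict (Ioo r t) =
      volume.restrict (Ioo r s) + volume.restrict (Ioo s t) := by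
  rw [restrict_Ioo_eq_restrict_Ioc, restrict_Ioo_eq_restrict_Ioc, restrict_Ioo_eq_restrict_Ioc,
    ← Measure.restrict_union (Ioc_disjoint_Ioc_of_le le_rfl) measurableSet_Ioc,
    Ioc_union_Ioc_eq_Ioc hrs hst]

theorem duh_split (hα : 1 < α) (hs : 0 < s) (hst : s < t)
    (hu : AEStronglyMeasurable (Function.uncurry u) ((volume.restrict (Ioo 0 t)).prod volume))
    {x : Rd d} (h : duhP 0 t (pot γ α (size u) (size u)) x < ∞) :
    duh γ α u 0 t x = heatFun (duh γ α u 0 s) (t - s) x + duh γ α u s t x ∧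
      heatP (t - s) (fun w => ‖duh γ α u 0 s w‖ₑ) x < ∞ := by
  set ν := (volume.restrict (Ioo 0 s)).prod (volume : Measure (Rd d)) with hν
  have hadd : (volume.restrict (Ioo 0 t)).prod (volume : Measure (Rd d)) =
      ν + (volume.restrict (Ioo s t)).prod volume := by
    rw [hν, ← Measure.add_prod, restrict_Ioo_add hs.le hst.le]
  have hus : AEStronglyMeasurable (Function.uncurry u) ν :=
    hu.mono_measure (by rw [hadd]; exact Measure.le_add_right le_rfl)
  have hN := aestronglyMeasurable_nonlin (γ := γ) hα hus
  have hpm : AEMeasurable (Function.uncurry (pot γ α (size u) (size u))) ν :=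
    aemeasurable_pot hus.enorm hus.enorm
  have hfin : heatP (t - s) (duhP 0 s (pot γ α (size u) (size u))) x < ∞ := by
    rw [heatP_duhP hst hpm]
    exact (lintegral_mono' (Measure.restrict_mono (Ioo_subset_Ioo_right hst.le) le_rfl)
      le_rfl).trans_lt h
  refine ⟨?_, (heatP_mono (ae_of_all _ fun w => enorm_duh_le hα hus w) _ _).trans_lt hfin⟩
  have hi := integrable_duh hα hu h
  rw [hadd, integrable_add_measure] at hi
  rw [duh, hadd, integral_add_measure hi.1 hi.2]
  congr 1
  have hFm : AEStronglyMeasurable (fun q : Rd d × (ℝ × Rd d) => gaussKernel (t - s) (x - q.1) •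
      gaussKernel (s - q.2.1) (q.1 - q.2.2) • nonlin γ α (u q.2.1) q.2.2) (volume.prod ν) := by
    refine AEStronglyMeasurable.smul ?_ (AEStronglyMeasurable.smul ?_ hN.comp_snd)
    · exact (measurable_gaussKernel.comp (measurable_const.prodMk
        (measurable_const.sub measurable_fst))).aestronglyMeasurable
    · exact (measurable_gaussKernel.comp ((measurable_const.sub measurable_snd.fst).prodMk
        (measurable_fst.sub measurable_snd.snd))).aestronglyMeasurable
  have hF : Integrable (fun q : Rd d × (ℝ × Rd d) => gaussKernel (t - s) (x - q.1) •
      gaussKernel (s - q.2.1) (q.1 - q.2.2) • nonlin γ α (u q.2.1) q.2.2) (volume.prod ν) := by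
    refine ⟨hFm, ?_⟩
    rw [hasFiniteIntegral_iff_enorm, lintegral_prod _ hFm.enorm]
    refine lt_of_le_of_lt (le_of_eq (lintegral_congr fun w => ?_)) hfin
    simp only [enorm_smul (gaussKernel (t - s) _), Real.enorm_of_nonneg
      (gaussKernel_nonneg (sub_pos.2 hst) _)]
    rw [lintegral_const_mul' _ _ ENNReal.ofReal_ne_top, hν, lintegral_gauss_enorm hN]
    simp only [enorm_nonlin hα]
    rfl
  have hswap := integral_integral_swap (f := fun w (z : ℝ × Rd d) => gaussKernel (t - s) (x - w) •
      gaussKernel (s - z.1) (w - z.2) • nonlin γ α (u z.1) z.2) hF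
  simp_rw [integral_smul (gaussKernel (t - s) _)] at hswap
  refine Eq.trans ?_ hswap.symm
  have hmem : ∀ᵐ z ∂ν, z.1 ∈ Ioo 0 s := by
    rw [hν]
    exact Measure.quasiMeasurePreserving_fst.ae (ae_restrict_mem measurableSet_Ioo)
  refine integral_congr_ae ?_
  filter_upwards [hmem] with z hz
  simp only [smul_smul]
  rw [integral_smul_const, integral_gaussKernel_mul (sub_pos.2 hst) (sub_pos.2 hz.2),
    sub_add_sub_cancel]

theorem heatFun_congr {f g : Rd d → 𝕜} (h : f =ᵐ[volume] g) (t : ℝ) (x : Rd d) :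
    heatFun f t x = heatFun g t x :=
  integral_congr_ae (h.mono fun y hy => by simp only [hy])

/-- The integral equation with initial time `s`. -/
theorem _root_.IsGlobalSolution.restart (hα : 1 < α) (h : IsGlobalSolution a γ α U u)
    (hU : ∀ t, 0 < t → AEStronglyMeasurable (U t) volume) (hs : 0 < s) (hst : s < t)
    (hUs : ∀ᵐ x, U t x = heatFun (U s) (t - s) x)
    (hUf : ∀ᵐ x, heatP (t - s) (fun y => ‖U s y‖ₑ) x < ∞)
    (hfin : ∀ᵐ x, duhP 0 t (pot γ α (size u) (size u)) x < ∞) :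
    ∀ᵐ x, u t x = heatFun (u s) (t - s) x + a • duh γ α u s t x := by
  have ht := hs.trans hst
  have htm := h.timeMeasurable
  filter_upwards [h.equation_duh ht, hUs, hUf, hfin] with x hx hUx hUfx hfx
  obtain ⟨h1, h2⟩ := duh_split hα hs hst (htm.joint t ht) hfx
  have hdm : AEStronglyMeasurable (fun w => a • duh γ α u 0 s w) volume := by
    have : (fun w => a • duh γ α u 0 s w) =ᵐ[volume] fun w => u s w - U s w := by
      filter_upwards [h.equation_duh hs] with w hw
      rw [hw, add_sub_cancel_left]
    exact ((htm.slice s hs).sub (hU s hs)).congr this.symm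
  have hts := sub_pos.2 hst
  have h3 : heatP (t - s) (fun w => ‖a • duh γ α u 0 s w‖ₑ) x < ∞ := by
    simp only [enorm_smul]
    rw [heatP_const_mul enorm_ne_top]
    exact ENNReal.mul_lt_top enorm_lt_top h2
  have h4 : heatFun (u s) (t - s) x =
      heatFun (U s) (t - s) x + a • heatFun (duh γ α u 0 s) (t - s) x := by
    rw [heatFun_congr (h.equation_duh hs), heatFun]
    simp only [smul_add]
    rw [integral_add (integrable_gaussKernel_smul (hU s hs) hts hUfx)
      (integrable_gaussKernel_smul hdm hts h3)]
    congr 1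
    rw [heatFun, ← integral_smul]
    refine integral_congr_ae (ae_of_all _ fun y => ?_)
    exact smul_comm _ _ _
  rw [hx, hUx, h1, h4, smul_add, add_assoc]

end Restart

/-! ### Regularity gain -/

section Bootstrap

variable {d : ℕ} {γ α k θ : ℝ}

theorem Target.homExp_le [NeZero d] {k' θ' : ℝ} (T : Target d k θ k' θ') :
    homExp d k' θ' ≤ homExp d k θ := by
  have hd : (0 : ℝ) < d := by exact_mod_cast Nat.pos_of_ne_zero (NeZero.ne d)
  have := mul_le_mul_of_nonneg_left T.le hd.le
  rw [homExp, homExp]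
  linarith [T.weight_le]

theorem Target.eq_of_homExp_le [NeZero d] {k' θ' : ℝ} (T : Target d k θ k' θ')
    (h : homExp d k θ ≤ homExp d k' θ') : k' = k ∧ θ' = θ := by
  have hd : (0 : ℝ) < d := by exact_mod_cast Nat.pos_of_ne_zero (NeZero.ne d)
  have h1 := mul_le_mul_of_nonneg_left T.le hd.le
  have h2 := T.weight_le
  rw [homExp, homExp] at h
  exact ⟨by linarith, mul_left_cancel₀ hd.ne' (by linarith : (d : ℝ) * θ' = d * θ)⟩

theorem Target.segment [NeZero d] {k' θ' r : ℝ} (P : Params d γ α k θ) (T : Target d k θ k' θ')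
    (hr : 0 ≤ r) (hr1 : r ≤ 1) :
    Target d k θ (k + r * (k' - k)) (θ + r * (θ' - θ)) ∧ k' ≤ k + r * (k' - k) ∧
      θ' ≤ θ + r * (θ' - θ) ∧ homExp d (k + r * (k' - k)) (θ + r * (θ' - θ)) =
        homExp d k θ + r * (homExp d k' θ' - homExp d k θ) := by
  have e : homExp d (k + r * (k' - k)) (θ + r * (θ' - θ)) =
      homExp d k θ + r * (homExp d k' θ' - homExp d k θ) := by
    simp only [homExp]; ring
  have h1 := T.weight_le
  have h2 := T.le
  have h3 : 0 ≤ 1 - r := by linarith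
  refine ⟨⟨by nlinarith, ?_, by nlinarith, ?_⟩, by nlinarith, by nlinarith, e⟩
  · nlinarith [mul_nonneg h3 P.nonneg, mul_nonneg hr T.nonneg]
  · rw [e]
    nlinarith [mul_nonneg h3 P.hom_nonneg, mul_nonneg hr T.hom_nonneg]

theorem exists_heatP_half_bound [NeZero d] (P : Params d γ α k θ) (c : ℝ) :
    ∃ C : ℝ, 0 < C ∧ ∀ (k₁ θ₁ k₂ θ₂ : ℝ), Target d k θ k₁ θ₁ → Target d k θ k₂ θ₂ → k₂ ≤ k₁ →
      θ₂ ≤ θ₁ → ∀ (v : ℝ → Rd d → ℝ≥0∞) (B : ℝ), 0 ≤ B →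
      (∀ t, 0 < t → AEMeasurable (v t) volume) →
      RateBound k₁ θ₁ B (c + (homExp d k θ - homExp d k₁ θ₁)) v →
      RateBound k₂ θ₂ (C * B) (c + (homExp d k θ - homExp d k₂ θ₂))
        (fun t => heatP (t / 2) (v (t / 2))) := by
  obtain ⟨C, hC, h⟩ := exists_smoothing (d := d) (weightMax d γ α k) P.mul_lt_one P.source_lt_one
  refine ⟨(C.toReal + 1) * 2 ^ (c + homExp d k θ), by positivity,
    fun k₁ θ₁ k₂ θ₂ T₁ T₂ hk hθ v B hB hv hb t ht => ?_⟩
  have ht2 : 0 < t / 2 := by positivity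
  refine (h k₁ θ₁ k₂ θ₂ _ _ _ ht2 (T₁.smoothingPair P T₂ hk hθ) (hv _ ht2) ENNReal.ofReal_ne_top
    (hb _ ht2)).mono (ae_of_all _ fun _ => le_rfl) ?_
  have hCC : C ≤ ENNReal.ofReal (C.toReal + 1) := by
    conv_lhs => rw [← ENNReal.ofReal_toReal hC]
    exact ENNReal.ofReal_le_ofReal (by linarith)
  rw [mul_sub, half_mul_eq_homExp, half_mul_eq_homExp]
  refine (mul_le_mul_left (mul_le_mul_left hCC _) _).trans ?_
  rw [← ENNReal.ofReal_mul (by positivity), ← ENNReal.ofReal_mul (by positivity)]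
  refine ENNReal.ofReal_le_ofReal ?_
  set r := c + (homExp d k θ - homExp d k₂ θ₂) with hr
  have e1 : (t / 2) ^ (-(homExp d k₁ θ₁ - homExp d k₂ θ₂)) *
      (t / 2) ^ (-(c + (homExp d k θ - homExp d k₁ θ₁))) = 2 ^ r * t ^ (-r) := by
    rw [← Real.rpow_add ht2, show -(homExp d k₁ θ₁ - homExp d k₂ θ₂) +
      -(c + (homExp d k θ - homExp d k₁ θ₁)) = -r by rw [hr]; ring,
      Real.div_rpow ht.le zero_le_two, Real.rpow_neg zero_le_two, div_inv_eq_mul, mul_comm]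
  calc (C.toReal + 1) * (t / 2) ^ (-(homExp d k₁ θ₁ - homExp d k₂ θ₂)) *
        (B * (t / 2) ^ (-(c + (homExp d k θ - homExp d k₁ θ₁))))
      = (C.toReal + 1) * B * ((t / 2) ^ (-(homExp d k₁ θ₁ - homExp d k₂ θ₂)) *
        (t / 2) ^ (-(c + (homExp d k θ - homExp d k₁ θ₁)))) := by ring
    _ = (C.toReal + 1) * B * (2 ^ r * t ^ (-r)) := by rw [e1]
    _ ≤ (C.toReal + 1) * B * (2 ^ (c + homExp d k θ) * t ^ (-r)) := by
        gcongr
        · norm_num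
        · rw [hr]; linarith [T₂.hom_nonneg]
    _ = _ := by ring

/-- Bounds in the auxiliary space propagate to all target pairs, for functions that satisfy an
integral inequality on the intervals `(t/2, t)`. -/
theorem exists_target_bounds [NeZero d] (P : Params d γ α k θ) {w v g : ℝ → Rd d → ℝ≥0∞}
    {W ω A c e K : ℝ} (hW : 0 ≤ W) (hω : 0 ≤ ω) (hA : 0 ≤ A) (he : 0 ≤ e) (hK : 0 ≤ K)
    (hec : e - (α - 1) * (rate d γ α k θ - ω) = c)
    (hwm : ∀ t, 0 < t → AEMeasurable (w t) volume) (hvm : ∀ t, 0 < t → AEMeasurable (v t) volume)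
    (hgm : ∀ t, 0 < t → AEMeasurable (g t) volume)
    (hwj : ∀ t, 0 < t → AEMeasurable (Function.uncurry w) ((volume.restrict (Ioo 0 t)).prod volume))
    (hgj : ∀ t, 0 < t → AEMeasurable (Function.uncurry g) ((volume.restrict (Ioo 0 t)).prod volume))
    (hw : RateBound k θ W ω w) (hv : RateBound k θ A c v)
    (hg : ∀ B, 0 ≤ B → ∃ G, 0 ≤ G ∧ ∀ k₁ θ₁, Target d k θ k₁ θ₁ →
      RateBound k₁ θ₁ B (c + (homExp d k θ - homExp d k₁ θ₁)) v →
      RateBound k₁ θ₁ G (e + (homExp d k θ - homExp d k₁ θ₁)) g)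
    (hrec : ∀ t, 0 < t → ∀ᵐ x, v t x ≤ heatP (t / 2) (v (t / 2)) x +
      ENNReal.ofReal K * duhP (t / 2) t (pot γ α w g) x) :
    ∃ B, 0 ≤ B ∧ ∀ k' θ', Target d k θ k' θ' →
      RateBound k' θ' B (c + (homExp d k θ - homExp d k' θ')) v := by
  obtain ⟨C₁, hC₁, h₁⟩ := exists_heatP_half_bound P c
  obtain ⟨C₂, hC₂, h₂⟩ := exists_duhP_tail_bound P ((α - 1) * ω + e + homExp d k θ)
  have hη : 0 < (α - 1) * rate d γ α k θ / 2 := by linarith [P.mul_rate_pos]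
  set η := (α - 1) * rate d γ α k θ / 2 with hηd
  have hα := P.sub_one_pos
  have key : ∀ n : ℕ, ∃ B, 0 ≤ B ∧ ∀ k' θ', Target d k θ k' θ' →
      homExp d k θ - homExp d k' θ' ≤ n * η →
      RateBound k' θ' B (c + (homExp d k θ - homExp d k' θ')) v := fun n => by
    induction n with
    | zero =>
      refine ⟨A, hA, fun k' θ' T hT => ?_⟩
      rw [Nat.cast_zero, zero_mul] at hT
      obtain ⟨rfl, rfl⟩ := T.eq_of_homExp_le (by linarith)
      rwa [sub_self, add_zero]
    | succ n ih =>
      obtain ⟨B, hB, ih⟩ := ih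
      obtain ⟨G, hG, hg⟩ := hg B hB
      refine ⟨C₁ * B + K * (C₂ * (W ^ (α - 1) * G)), by positivity, fun k' θ' T hT t ht => ?_⟩
      have hn : (0 : ℝ) < n + 1 := by positivity
      obtain ⟨T₁, hk, hθ, hh⟩ := T.segment P (r := n / (n + 1)) (by positivity)
        ((div_le_one hn).2 (by linarith))
      set k₁ := k + n / (n + 1) * (k' - k)
      set θ₁ := θ + n / (n + 1) * (θ' - θ)
      push_cast at hT
      have hT' : (homExp d k θ - homExp d k' θ') / (n + 1) ≤ η := by
        rw [div_le_iff₀ hn]; linarith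
      have hx : n / (n + 1) * (homExp d k' θ' - homExp d k θ) =
          -(n * ((homExp d k θ - homExp d k' θ') / (n + 1))) := by
        field_simp; ring
      have hx' : homExp d k θ - homExp d k' θ' =
          n * ((homExp d k θ - homExp d k' θ') / (n + 1)) +
            (homExp d k θ - homExp d k' θ') / (n + 1) := by
        field_simp
      have hgap : homExp d k θ - homExp d k₁ θ₁ ≤ n * η := by
        rw [hh, hx]
        have := mul_le_mul_of_nonneg_left hT' (Nat.cast_nonneg n)
        linarith
      have hstep : homExp d k₁ θ₁ - homExp d k' θ' ≤ η := by
        rw [hh, hx]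
        linarith
      have hb₁ := ih k₁ θ₁ T₁ hgap
      have hg₁ := hg k₁ θ₁ T₁ hb₁
      have hl := T₁.homExp_le
      have hl0 := T₁.hom_nonneg
      have hωα : 0 ≤ (α - 1) * ω := mul_nonneg hα.le hω
      have hd₁ := h₁ k₁ θ₁ k' θ' T₁ T hk hθ v B hB hvm hb₁ t ht
      have hd₂ := (h₂ k₁ θ₁ k' θ' T₁ T hk hθ hstep w g W G ω _ hW hG (by linarith) (by linarith)
        hwm hgm hwj hgj hw hg₁).const_mul hK t ht
      have hexp : e + (homExp d k θ - homExp d k₁ θ₁) - (α - 1) * (rate d γ α k θ - ω) +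
          (homExp d k₁ θ₁ - homExp d k' θ') = c + (homExp d k θ - homExp d k' θ') := by
        linarith
      rw [hexp] at hd₂
      refine (hd₁.add (aemeasurable_heatP (hvm _ (by positivity)) _).aemeasurable hd₂).mono
        (hrec t ht) ?_
      rw [← ENNReal.ofReal_add (by positivity) (by positivity), ← add_mul]
  obtain ⟨n, hn⟩ := exists_nat_ge (homExp d k θ / η)
  obtain ⟨B, hB, h⟩ := key n
  refine ⟨B, hB, fun k' θ' T => h k' θ' T ?_⟩
  rw [div_le_iff₀ hη] at hn
  linarith [T.hom_nonneg]

end Bootstrap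

/-! ### Solutions on the intervals `(t/2, t)` -/

section HalfStep

variable {𝕜 : Type*} [RCLike 𝕜] {d : ℕ} {a γ α k θ : ℝ} {U V u v : ℝ → Rd d → 𝕜}

/-- Free evolutions: measurable functions of time and space that satisfy the semigroup property. -/
structure FreeEvolution (U : ℝ → Rd d → 𝕜) : Prop where
  measurable : StronglyMeasurable (Function.uncurry U)
  semigroup : ∀ s r, 0 < s → 0 < r → ∀ᵐ x, U (s + r) x = heatFun (U r) s x

theorem FreeEvolution.timeMeasurable (h : FreeEvolution U) : TimeMeasurable U :=
  .of_stronglyMeasurable h.measurable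

theorem FreeEvolution.zero : FreeEvolution (0 : ℝ → Rd d → 𝕜) :=
  ⟨stronglyMeasurable_zero, fun s r _ _ => ae_of_all _ fun x => by simp [heatFun]⟩

theorem FreeEvolution.heatDist (φ : 𝓢(Rd d, 𝕜) →L[𝕜] 𝕜) : FreeEvolution (heatDist φ) :=
  ⟨stronglyMeasurable_heatDist φ, fun _ _ hs hr => ae_of_all _ fun x => heatDist_add φ hs hr x⟩

theorem FreeEvolution.heatFun {f : Rd d → 𝕜} (hf : AEStronglyMeasurable f volume)
    (h : ∀ t, 0 < t → ∀ᵐ x, heatP t (fun y => ‖f y‖ₑ) x < ∞) : FreeEvolution (heatFun f) :=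
  ⟨stronglyMeasurable_heatFun hf, fun s r hs hr =>
    (h (s + r) (add_pos hs hr)).mono fun _ hx => heatFun_add hf hs hr hx⟩

theorem FreeEvolution.half (h : FreeEvolution U) {t : ℝ} (ht : 0 < t) :
    ∀ᵐ x, U t x = _root_.heatFun (U (t / 2)) (t - t / 2) x := by
  have := h.semigroup (t - t / 2) (t / 2) (by linarith) (by linarith)
  rwa [sub_add_cancel] at this

theorem RateBound.heatP_half_lt_top [NeZero d] (P : Params d γ α k θ) {v : ℝ → Rd d → ℝ≥0∞}
    {B b : ℝ} (hB : 0 ≤ B) (hvm : ∀ t, 0 < t → AEMeasurable (v t) volume) (h : RateBound k θ B b v)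
    {t : ℝ} (ht : 0 < t) : ∀ᵐ x, heatP (t - t / 2) (v (t / 2)) x < ∞ := by
  obtain ⟨C, hC, hb⟩ := exists_heatP_half_bound P b
  have h1 := hb k θ k θ P.target_self P.target_self le_rfl le_rfl v B hB hvm
    (by rwa [sub_self, add_zero]) t ht
  rw [sub_half]
  exact LBound.ae_lt_top (aemeasurable_heatP (hvm _ (by positivity)) _).aemeasurable
    P.theta_lt_one.le ENNReal.ofReal_ne_top h1

theorem _root_.IsGlobalSolution.half_step [NeZero d] (P : Params d γ α k θ) {A B b b' : ℝ}
    (h : IsGlobalSolution a γ α U u) (hU : FreeEvolution U) (hA : 0 ≤ A)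
    (hUA : RateBound k θ A b (size U)) (hB : 0 ≤ B) (huB : RateBound k θ B b' (size u))
    (hfin : ∀ t, 0 < t → ∀ᵐ x, duhP 0 t (pot γ α (size u) (size u)) x < ∞) {t : ℝ} (ht : 0 < t) :
    ∀ᵐ x, u t x = heatFun (u (t / 2)) (t - t / 2) x + a • duh γ α u (t / 2) t x ∧
      heatP (t - t / 2) (fun y => ‖u (t / 2) y‖ₑ) x < ∞ ∧
      duhP (t / 2) t (pot γ α (size u) (size u)) x < ∞ := by
  filter_upwards [h.restart P.one_lt hU.timeMeasurable.slice (half_pos ht) (half_lt_self ht)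
    (hU.half ht) (hUA.heatP_half_lt_top P hA hU.timeMeasurable.size_slice ht) (hfin t ht),
    huB.heatP_half_lt_top P hB h.timeMeasurable.size_slice ht, hfin t ht] with x h1 h2 h3
  exact ⟨h1, h2, (lintegral_mono' (Measure.restrict_mono
    (Ioo_subset_Ioo_left (half_pos ht).le) le_rfl) le_rfl).trans_lt h3⟩

theorem restrict_half_le {t : ℝ} (ht : 0 < t) :
    (volume.restrict (Ioo (t / 2) t)).prod (volume : Measure (Rd d)) ≤
      (volume.restrict (Ioo 0 t)).prod volume :=
  Measure.prod_mono (Measure.restrict_mono (Ioo_subset_Ioo_left (half_pos ht).le) le_rfl) le_rfl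

theorem enorm_heatFun_sub_le {f g : Rd d → 𝕜} (hf : AEStronglyMeasurable f volume)
    (hg : AEStronglyMeasurable g volume) {t : ℝ} (ht : 0 < t) {x : Rd d}
    (hfx : heatP t (fun y => ‖f y‖ₑ) x < ∞) (hgx : heatP t (fun y => ‖g y‖ₑ) x < ∞) :
    ‖heatFun f t x - heatFun g t x‖ₑ ≤ heatP t (fun y => ‖f y - g y‖ₑ) x := by
  have e : heatFun f t x - heatFun g t x = heatFun (fun y => f y - g y) t x := by
    rw [heatFun, heatFun, ← integral_sub (integrable_gaussKernel_smul hf ht hfx)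
      (integrable_gaussKernel_smul hg ht hgx)]
    simp only [heatFun, smul_sub]
  rw [e]
  exact enorm_heatFun_le _ ht x

/-- The integral inequality for the difference of a solution and a free evolution. -/
theorem _root_.IsGlobalSolution.size_sub_free_le [NeZero d] (P : Params d γ α k θ)
    {A B B' b b' b'' : ℝ}
    (h : IsGlobalSolution a γ α U u) (hU : FreeEvolution U) (hA : 0 ≤ A)
    (hUA : RateBound k θ A b (size U)) (hB : 0 ≤ B) (huB : RateBound k θ B b' (size u))
    (hfin : ∀ t, 0 < t → ∀ᵐ x, duhP 0 t (pot γ α (size u) (size u)) x < ∞)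
    (hV : FreeEvolution V) (hB' : 0 ≤ B') (hVB : RateBound k θ B' b'' (size V))
    (t : ℝ) (ht : 0 < t) :
    ∀ᵐ x, size (u - V) t x ≤ heatP (t / 2) (size (u - V) (t / 2)) x +
      ENNReal.ofReal |a| * duhP (t / 2) t (pot γ α (size u) (size u)) x := by
  filter_upwards [h.half_step P hU hA hUA hB huB hfin ht, hV.half ht,
    hVB.heatP_half_lt_top P hB' hV.timeMeasurable.size_slice ht] with x ⟨h1, h2, h3⟩ h4 h5
  rw [sub_half] at h1 h2 h4 h5
  have e : (u - V) t x = (heatFun (u (t / 2)) (t / 2) x - heatFun (V (t / 2)) (t / 2) x) +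
      a • duh γ α u (t / 2) t x := by
    rw [Pi.sub_apply, Pi.sub_apply, h1, h4]
    abel
  rw [size, e]
  refine (enorm_add_le _ _).trans (add_le_add ?_ ?_)
  · exact enorm_heatFun_sub_le (h.timeMeasurable.slice _ (half_pos ht))
      (hV.timeMeasurable.slice _ (half_pos ht)) (half_pos ht) h2 h5
  · rw [enorm_smul, ← ofReal_norm a, Real.norm_eq_abs]
    gcongr
    exact enorm_duh_le P.one_lt ((h.timeMeasurable.joint t ht).mono_measure (restrict_half_le ht)) x

/-- The integral inequality for the difference of two solutions. -/
theorem _root_.IsGlobalSolution.size_sub_le [NeZero d] (P : Params d γ α k θ)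
    {A B A' B' b b' b₁ b₁' : ℝ}
    (h : IsGlobalSolution a γ α U u) (hU : FreeEvolution U) (hA : 0 ≤ A)
    (hUA : RateBound k θ A b (size U)) (hB : 0 ≤ B) (huB : RateBound k θ B b' (size u))
    (hfin : ∀ t, 0 < t → ∀ᵐ x, duhP 0 t (pot γ α (size u) (size u)) x < ∞)
    (h' : IsGlobalSolution a γ α V v) (hV : FreeEvolution V) (hA' : 0 ≤ A')
    (hVA : RateBound k θ A' b₁ (size V)) (hB' : 0 ≤ B') (hvB : RateBound k θ B' b₁' (size v))
    (hfin' : ∀ t, 0 < t → ∀ᵐ x, duhP 0 t (pot γ α (size v) (size v)) x < ∞)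
    (t : ℝ) (ht : 0 < t) :
    ∀ᵐ x, size (u - v) t x ≤ heatP (t / 2) (size (u - v) (t / 2)) x +
      ENNReal.ofReal (|a| * (1 + α)) *
        duhP (t / 2) t (pot γ α (fun τ y => size u τ y + size v τ y) (size (u - v))) x := by
  filter_upwards [h.half_step P hU hA hUA hB huB hfin ht,
    h'.half_step P hV hA' hVA hB' hvB hfin' ht] with x ⟨h1, h2, h3⟩ ⟨h4, h5, h6⟩
  rw [sub_half] at h1 h2 h4 h5
  have e : (u - v) t x = (heatFun (u (t / 2)) (t / 2) x - heatFun (v (t / 2)) (t / 2) x) +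
      a • (duh γ α u (t / 2) t x - duh γ α v (t / 2) t x) := by
    rw [Pi.sub_apply, Pi.sub_apply, h1, h4, smul_sub]
    abel
  rw [size, e]
  refine (enorm_add_le _ _).trans (add_le_add ?_ ?_)
  · exact enorm_heatFun_sub_le (h.timeMeasurable.slice _ (half_pos ht))
      (h'.timeMeasurable.slice _ (half_pos ht)) (half_pos ht) h2 h5
  · rw [enorm_smul, ENNReal.ofReal_mul (abs_nonneg a), mul_assoc, ← ofReal_norm a,
      Real.norm_eq_abs]
    gcongr
    exact enorm_duh_sub_le P.one_lt
      ((h.timeMeasurable.joint t ht).mono_measure (restrict_half_le ht))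
      ((h'.timeMeasurable.joint t ht).mono_measure (restrict_half_le ht)) h3 h6

theorem RateBound.interpolate {v : ℝ → Rd d → ℝ≥0∞} {A B b₁ b₂ b : ℝ}
    (h₁ : RateBound k θ A b₁ v) (h₂ : RateBound k θ B b₂ v) (hb₁ : b₁ ≤ b) (hb₂ : b ≤ b₂)
    (hA : 0 ≤ A) : RateBound k θ (max A B) b v := fun t ht => by
  rcases le_total t 1 with ht1 | ht1
  · refine (h₁ t ht).mono (ae_of_all _ fun _ => le_rfl) (ENNReal.ofReal_le_ofReal ?_)
    exact mul_le_mul (le_max_left _ _) (Real.rpow_le_rpow_of_exponent_ge ht ht1 (by linarith))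
      (by positivity) (hA.trans (le_max_left _ _))
  · refine (h₂ t ht).mono (ae_of_all _ fun _ => le_rfl) (ENNReal.ofReal_le_ofReal ?_)
    exact mul_le_mul (le_max_right _ _) (Real.rpow_le_rpow_of_exponent_le ht1 (by linarith))
      (by positivity) (hA.trans (le_max_left _ _))

/-- A solution satisfies in all target pairs the bounds that it has in the auxiliary space. -/
theorem _root_.IsGlobalSolution.exists_target_bounds [NeZero d] (P : Params d γ α k θ)
    {A M B b b' : ℝ}
    (h : IsGlobalSolution a γ α U u) (hU : FreeEvolution U) (hA : 0 ≤ A)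
    (hUA : RateBound k θ A b (size U)) (hM : 0 ≤ M)
    (huM : RateBound k θ M (rate d γ α k θ) (size u))
    (hfin : ∀ t, 0 < t → ∀ᵐ x, duhP 0 t (pot γ α (size u) (size u)) x < ∞)
    (hB : 0 ≤ B) (hb : 0 ≤ b') (huB : RateBound k θ B b' (size u)) :
    ∃ B', 0 ≤ B' ∧ ∀ k' θ', Target d k θ k' θ' →
      RateBound k' θ' B' (b' + (homExp d k θ - homExp d k' θ')) (size u) := by
  have hum := h.timeMeasurable
  refine _root_.exists_target_bounds P (w := size u) (g := size u) hM P.rate_pos.le hB hb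
    (abs_nonneg a)
    (by rw [sub_self, mul_zero, sub_zero]) hum.size_slice hum.size_slice hum.size_slice
    hum.size_joint hum.size_joint huM huB (fun G hG => ⟨G, hG, fun _ _ _ h => h⟩) fun t ht => ?_
  have := h.size_sub_free_le P hU hA hUA hB huB hfin (V := 0) .zero le_rfl
    (b'' := 0) RateBound.zero t ht
  rwa [sub_zero] at this

end HalfStep

/-! ### Self-similarity -/

section Scaling

variable {𝕜 : Type*} [RCLike 𝕜] {d : ℕ} {a γ α κ c : ℝ} {U u : ℝ → Rd d → 𝕜}

theorem map_prod_smul {t : ℝ} (hc : 0 < c) :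
    ((volume.restrict (Ioo 0 t)).prod (volume : Measure (Rd d))).map
      (Prod.map (fun τ => c ^ 2 * τ) (fun y => c • y)) =
    ENNReal.ofReal ((c ^ 2)⁻¹ * (c ^ d)⁻¹) •
      ((volume.restrict (Ioo 0 (c ^ 2 * t))).prod (volume : Measure (Rd d))) := by
  have hc2 : 0 < c ^ 2 := by positivity
  have h1 : Measure.map (fun τ => c ^ 2 * τ) (volume.restrict (Ioo 0 t)) =
      ENNReal.ofReal (c ^ 2)⁻¹ • volume.restrict (Ioo 0 (c ^ 2 * t)) := by
    have he : MeasurableEmbedding fun τ : ℝ => c ^ 2 * τ :=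
      (Homeomorph.mulLeft₀ (c ^ 2) hc2.ne').measurableEmbedding
    have hpre : Ioo 0 t = (fun τ : ℝ => c ^ 2 * τ) ⁻¹' Ioo 0 (c ^ 2 * t) := by
      ext τ
      simp only [mem_Ioo, mem_preimage, mul_pos_iff_of_pos_left hc2, mul_lt_mul_iff_right₀ hc2]
    rw [hpre, ← he.restrict_map, Real.map_volume_mul_left hc2.ne', Measure.restrict_smul,
      abs_of_pos (by positivity)]
  have h2 : Measure.map (fun y : Rd d => c • y) volume = ENNReal.ofReal (c ^ d)⁻¹ • volume := by
    rw [Measure.map_addHaar_smul _ hc.ne', finrank_euclideanSpace_fin,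
      abs_of_pos (by positivity)]
  have h3 : SFinite (ENNReal.ofReal (c ^ 2)⁻¹ • (volume : Measure ℝ).restrict (Ioo 0 (c ^ 2 * t))) :=
    inferInstance
  rw [← Measure.map_prod_map _ _ (by fun_prop) (by fun_prop), h1, h2, Measure.prod_smul_left,
    Measure.prod_smul_right, smul_smul, ENNReal.ofReal_mul (by positivity)]

theorem nonlin_scale (hα : 1 < α) (hκ : κ = (2 + γ) / (α - 1)) (hc : 0 < c) {f g : Rd d → 𝕜}
    {y : Rd d} (h : f y = (c ^ κ) • g (c • y)) :
    nonlin γ α f y = (c ^ (κ + 2)) • nonlin γ α g (c • y) := by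
  have hck : 0 < c ^ κ := Real.rpow_pos_of_pos hc κ
  have hα' : α - 1 ≠ 0 := by linarith
  rw [nonlin, nonlin, h, norm_smul, norm_smul, Real.norm_of_nonneg hck.le, Real.norm_of_nonneg hc.le,
    Real.mul_rpow hck.le (norm_nonneg _), Real.mul_rpow hc.le (norm_nonneg _), smul_smul, smul_smul,
    ← Real.rpow_mul hc.le]
  have e : c ^ (κ * (α - 1)) * c ^ κ = c ^ (κ + 2) * c ^ γ := by
    rw [← Real.rpow_add hc, ← Real.rpow_add hc]
    congr 1
    rw [hκ]
    field_simp
    ring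
  congr 1
  linear_combination (‖y‖ ^ γ * ‖g (c • y)‖ ^ (α - 1)) * e

theorem duh_scale (hα : 1 < α) (hκ : κ = (2 + γ) / (α - 1)) (hc : 0 < c)
    (hu : ∀ t, 0 < t → ∀ x, (c ^ κ) • u (c ^ 2 * t) (c • x) = u t x) {t : ℝ}
    (x : Rd d) : (c ^ κ) • duh γ α u 0 (c ^ 2 * t) (c • x) = duh γ α u 0 t x := by
  have hc2 : 0 < c ^ 2 := by positivity
  have he : MeasurableEmbedding (Prod.map (fun τ : ℝ => c ^ 2 * τ) (fun y : Rd d => c • y)) :=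
    ((Homeomorph.mulLeft₀ (c ^ 2) hc2.ne').prodCongr
      (Homeomorph.smulOfNeZero c hc.ne')).measurableEmbedding
  have h1 := he.integral_map (μ := (volume.restrict (Ioo 0 t)).prod (volume : Measure (Rd d)))
    (fun z => gaussKernel (c ^ 2 * t - z.1) (c • x - z.2) • nonlin γ α (u z.1) z.2)
  rw [map_prod_smul hc, integral_smul_measure, ENNReal.toReal_ofReal (by positivity)] at h1
  have hne : (c ^ 2)⁻¹ * (c ^ d)⁻¹ ≠ 0 := by positivity
  refine smul_right_injective 𝕜 hne ?_
  simp only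
  rw [smul_comm, duh, h1, ← integral_smul, duh, ← integral_smul]
  have hmem : ∀ᵐ z ∂((volume.restrict (Ioo 0 t)).prod (volume : Measure (Rd d))), z.1 ∈ Ioo 0 t :=
    Measure.quasiMeasurePreserving_fst.ae (ae_restrict_mem measurableSet_Ioo)
  refine integral_congr_ae ?_
  filter_upwards [hmem] with z hz
  have hn := nonlin_scale hα hκ hc (f := u z.1) (g := u (c ^ 2 * z.1)) (y := z.2)
    (hu z.1 hz.1 z.2).symm
  simp only [Prod.map_fst, Prod.map_snd]
  rw [hn, ← mul_sub, ← smul_sub, gaussKernel_smul hc (sub_pos.2 hz.2), smul_smul, smul_smul,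
    smul_smul]
  congr 1
  rw [Real.rpow_add hc, Real.rpow_two]
  field_simp

theorem picard_scale (hα : 1 < α) (hκ : κ = (2 + γ) / (α - 1)) (hc : 0 < c)
    (hU : ∀ t, 0 < t → ∀ x, (c ^ κ) • U (c ^ 2 * t) (c • x) = U t x) (n : ℕ) :
    ∀ t, 0 < t → ∀ x, (c ^ κ) • picard a γ α U n (c ^ 2 * t) (c • x) = picard a γ α U n t x := by
  induction n with
  | zero => intro t _ x; simp [picard]
  | succ n ih =>
    intro t ht x
    rw [picard, smul_add, hU t ht, smul_comm, duh_scale hα hκ hc ih]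

theorem ae_comp_smul {p : Rd d → Prop} (h : ∀ᵐ x, p x) (hc : 0 < c) : ∀ᵐ x, p (c • x) := by
  have hq : Measure.QuasiMeasurePreserving (fun x : Rd d => c • x) volume volume :=
    ⟨measurable_const_smul c, by
      rw [Measure.map_addHaar_smul _ hc.ne']
      exact Measure.smul_absolutelyContinuous⟩
  exact hq.ae h

theorem picardLimit_isSelfSimilar [NeZero d] {k θ cm M : ℝ} (P : Params d γ α k θ)
    (hcm : α * rate d γ α k θ ≤ cm) (hM : 0 ≤ M) (hC : Contracts 𝕜 d a γ α k θ cm M)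
    (hU : StronglyMeasurable (Function.uncurry U))
    (hUM : RateBound k θ (M / 2) (rate d γ α k θ) (size U))
    (hs : ∀ c, 0 < c → ∀ t, 0 < t → ∀ x,
      (c ^ ((2 + γ) / (α - 1))) • U (c ^ 2 * t) (c • x) = U t x) :
    IsSelfSimilar γ α (picardLimit a γ α U) := fun c hc t ht => by
  have hct : 0 < c ^ 2 * t := by positivity
  filter_upwards [picardLimit_spec P hcm hM hC hU hUM ht,
    ae_comp_smul (picardLimit_spec P hcm hM hC hU hUM hct) hc] with x h1 h2
  refine tendsto_nhds_unique ((h2.1.const_smul (c ^ ((2 + γ) / (α - 1)))).congr fun n => ?_) h1.1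
  exact picard_scale P.one_lt rfl hc (hs c hc) n t ht x

/-- A self-similar solution that vanishes at one time has zero initial datum. -/
theorem _root_.IsGlobalSolution.free_eq_zero (h : IsGlobalSolution a γ α U u)
    (hs : IsSelfSimilar γ α u) (h1 : u 1 =ᵐ[volume] 0) (t : ℝ) (ht : 0 < t) :
    U t =ᵐ[volume] 0 := by
  have hz : ∀ t, 0 < t → u t =ᵐ[volume] 0 := fun t ht => by
    have hr : 0 < Real.sqrt t := Real.sqrt_pos.2 ht
    have h2 := ae_comp_smul (c := (Real.sqrt t)⁻¹)
      ((hs (Real.sqrt t) hr 1 one_pos).and h1) (inv_pos.2 hr)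
    filter_upwards [h2] with x ⟨hx, hx0⟩
    rw [hx0, Real.sq_sqrt ht.le, mul_one, smul_smul, mul_inv_cancel₀ hr.ne', one_smul] at hx
    exact (smul_eq_zero.1 hx).resolve_left (Real.rpow_pos_of_pos hr _).ne'
  filter_upwards [h.equation t ht, hz t ht] with x hx hx0
  have hi : ∫ τ in Ioo 0 t, heatFun (nonlin γ α (u τ)) (t - τ) x = 0 := by
    refine setIntegral_eq_zero_of_forall_eq_zero fun τ hτ => ?_
    refine integral_eq_zero_of_ae ?_
    filter_upwards [hz τ hτ.1] with y hy
    simp [nonlin, hy]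
  rw [hx0, hi, smul_zero, add_zero] at hx
  exact hx.symm

end Scaling

/-! ### Asymptotics and two-sided bounds -/

section Asymptotics

variable {𝕜 : Type*} [RCLike 𝕜] {d : ℕ} {γ α k σ δ : ℝ} {p : ℝ≥0∞} {u v : ℝ → Rd d → 𝕜}

theorem TargetPair.target [NeZero d] (hp : 1 ≤ p) {k' : ℝ} {p' : ℝ≥0∞} (h : TargetPair d k p k' p') :
    Target d k (recip p) k' (recip p') := by
  refine ⟨h.1, recip_nonneg p', recip_anti hp h.2.1, ?_⟩
  rw [← half_mul_eq_homExp]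
  have := h.2.2
  positivity

theorem decayExp_eq [NeZero d] (σ k : ℝ) (p : ℝ≥0∞) :
    decayExp d (σ / d) k p = σ / 2 - homExp d k (recip p) := by
  have hd : (d : ℝ) ≠ 0 := by exact_mod_cast NeZero.ne d
  rw [decayExp, homExp]
  field_simp
  ring

theorem asymptoticTo_of_rateBound [NeZero d] (hp : 1 ≤ p) {B : ℝ} (hB : 0 ≤ B)
    (hm : ∀ t, 0 < t → AEStronglyMeasurable (fun x => u t x - v t x) volume)
    (h : ∀ k' θ', Target d k (recip p) k' θ' →
      RateBound k' θ' B (σ / 2 - homExp d k' θ' + δ) (size (u - v)))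
    (hv : ∀ c, 0 < c → ∀ t, 0 < t → ∀ᵐ x, (c ^ σ) • v (c ^ 2 * t) (c • x) = v t x) :
    AsymptoticTo σ δ k p u v := by
  refine ⟨B + 1, by positivity, fun t ht k' p' hT => ?_⟩
  have hmain : wNorm k' p' (fun x => u t x - v t x) ≤
      ENNReal.ofReal (B * t ^ (-(σ / 2 - homExp d k' (recip p') + δ))) :=
    LBound.wNorm_le (hm t ht) (h k' _ (hT.target hp) t ht)
  rw [decayExp_eq]
  constructor
  · refine hmain.trans (ENNReal.ofReal_le_ofReal ?_)
    rw [neg_add']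
    gcongr
    linarith
  · have hr : 0 < Real.sqrt t := Real.sqrt_pos.2 ht
    have e : (fun x => (t ^ (σ / 2)) • u t (Real.sqrt t • x) - v 1 x) =ᵐ[volume]
        fun x => (t ^ (σ / 2)) • (u t (Real.sqrt t • x) - v t (Real.sqrt t • x)) := by
      filter_upwards [hv (Real.sqrt t) hr 1 one_pos] with x hx
      rw [← hx, Real.sq_sqrt ht.le, mul_one, smul_sub, Real.sqrt_eq_rpow, ← Real.rpow_mul ht.le,
        one_div_mul_eq_div]
    rw [wNorm_congr e]
    refine (wNorm_smul_comp_smul_le (fun x => u t x - v t x) (by positivity) hr).trans ?_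
    refine (mul_le_mul_right hmain _).trans ?_
    rw [← ENNReal.ofReal_mul (by positivity)]
    refine ENNReal.ofReal_le_ofReal ?_
    have e2 : t ^ (σ / 2) * Real.sqrt t ^ (-(k' + d * recip p')) *
        t ^ (-(σ / 2 - homExp d k' (recip p') + δ)) = t ^ (-δ) := by
      rw [Real.sqrt_eq_rpow, ← Real.rpow_mul ht.le, ← Real.rpow_add ht, ← Real.rpow_add ht, homExp]
      congr 1
      ring
    calc t ^ (σ / 2) * Real.sqrt t ^ (-(k' + d * recip p')) *
          (B * t ^ (-(σ / 2 - homExp d k' (recip p') + δ)))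
        = B * (t ^ (σ / 2) * Real.sqrt t ^ (-(k' + d * recip p')) *
          t ^ (-(σ / 2 - homExp d k' (recip p') + δ))) := by ring
      _ = B * t ^ (-δ) := by rw [e2]
      _ ≤ (B + 1) * t ^ (-δ) := by gcongr; linarith

/-- A lower bound for the weighted norms of a nonzero function, uniform in the exponents. -/
theorem exists_le_wNorm [NeZero d] {f : Rd d → 𝕜} (hf : ¬ f =ᵐ[volume] 0) (K : ℝ) :
    ∃ m : ℝ, 0 < m ∧ ∀ (k' : ℝ) (p' : ℝ≥0∞), |k'| ≤ K → 1 ≤ p' →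
      ENNReal.ofReal m ≤ wNorm k' p' f := by
  set E : ℕ → Set (Rd d) := fun n => {x | 1 / ((n : ℝ) + 1) < ‖f x‖ ∧ 1 / ((n : ℝ) + 1) < ‖x‖ ∧
    ‖x‖ < n + 1} with hE
  obtain ⟨n, hn⟩ : ∃ n, volume (E n) ≠ 0 := by
    by_contra! hcon
    refine hf ?_
    have h0 : volume (⋃ n, E n) = 0 := measure_iUnion_null hcon
    filter_upwards [measure_eq_zero_iff_ae_notMem.1 h0, ae_ne_zero (d := d)] with x hx hx0
    by_contra hfx
    refine hx (mem_iUnion.2 ?_)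
    have hl := tendsto_one_div_add_atTop_nhds_zero_nat (𝕜 := ℝ)
    have h1 := (tendsto_order.1 hl).2 _ (norm_pos_iff.2 hfx)
    have h2 := (tendsto_order.1 hl).2 _ (norm_pos_iff.2 hx0)
    have h3 := eventually_gt_atTop ⌈‖x‖⌉₊
    obtain ⟨n, h1, h2, h3⟩ := (h1.and (h2.and h3)).exists
    refine ⟨n, h1, h2, ?_⟩
    have : ‖x‖ ≤ n := (Nat.le_ceil _).trans (by exact_mod_cast h3.le)
    linarith
  set ε : ℝ := 1 / ((n : ℝ) + 1) with hε
  have hε0 : 0 < ε := by positivity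
  have hε1 : ε ≤ 1 := by
    rw [hε, div_le_one (by positivity)]
    linarith [(Nat.cast_nonneg n : (0 : ℝ) ≤ n)]
  set μ : ℝ := (min (volume (E n)) 1).toReal / 2 with hμ
  have hmin : min (volume (E n)) 1 ≠ ∞ := ne_top_of_le_ne_top ENNReal.one_ne_top (min_le_right _ _)
  have hpos : 0 < (min (volume (E n)) 1).toReal :=
    ENNReal.toReal_pos (by simp [hn]) hmin
  have hμ0 : 0 < μ := by positivity
  have hμ1 : μ ≤ 1 := by
    have : (min (volume (E n)) 1).toReal ≤ 1 :=
      ENNReal.toReal_mono ENNReal.one_ne_top (min_le_right _ _)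
    rw [hμ]
    linarith
  have hμE : ENNReal.ofReal μ < volume (E n) := by
    refine lt_of_lt_of_le ?_ (min_le_left _ 1)
    rw [← ENNReal.ofReal_toReal hmin]
    exact (ENNReal.ofReal_lt_ofReal_iff hpos).2 (half_lt_self hpos)
  refine ⟨ε ^ K * ε * μ, by positivity, fun k' p' hk' hp' => ?_⟩
  by_contra! hcon
  have h1 := wNorm_le_iff.1 (le_refl (wNorm k' p' f)) (ENNReal.ofReal μ)
    (ENNReal.ofReal_pos.2 hμ0).ne' ENNReal.ofReal_ne_top
  refine absurd (hμE.trans_le ((measure_mono fun x hx => ?_).trans h1)) (lt_irrefl _)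
  obtain ⟨hx1, hx2, hx3⟩ := hx
  have hx0 : 0 < ‖x‖ := hε0.trans hx2
  have hxε : ‖x‖ ≤ ε⁻¹ := by rw [hε, one_div, inv_inv]; exact hx3.le
  have hw : ε ^ K ≤ ‖x‖ ^ k' := by
    rcases le_total 0 k' with h0 | h0
    · calc ε ^ K ≤ ε ^ k' :=
            Real.rpow_le_rpow_of_exponent_ge hε0 hε1 ((le_abs_self k').trans hk')
        _ ≤ ‖x‖ ^ k' := Real.rpow_le_rpow hε0.le hx2.le h0
    · calc ε ^ K ≤ ε ^ (-k') :=
            Real.rpow_le_rpow_of_exponent_ge hε0 hε1 ((neg_le_abs k').trans hk')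
        _ = ε⁻¹ ^ k' := by rw [Real.inv_rpow hε0.le, Real.rpow_neg hε0.le]
        _ ≤ ‖x‖ ^ k' := Real.rpow_le_rpow_of_nonpos hx0 hxε h0
  have hμθ : μ * μ ^ (-recip p') ≤ 1 := by
    calc μ * μ ^ (-recip p') = μ ^ (1 - recip p') := by
          rw [sub_eq_add_neg, Real.rpow_add hμ0, Real.rpow_one]
      _ ≤ 1 := Real.rpow_le_one hμ0.le hμ1 (by linarith [recip_le_one hp'])
  change wNorm k' p' f * ENNReal.ofReal μ ^ (-recip p') < wt k' x * ‖f x‖ₑ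
  rw [ENNReal.ofReal_rpow_of_pos hμ0, wt, ← ofReal_norm, ← ENNReal.ofReal_mul (by positivity)]
  calc wNorm k' p' f * ENNReal.ofReal (μ ^ (-recip p'))
      ≤ ENNReal.ofReal (ε ^ K * ε * μ) * ENNReal.ofReal (μ ^ (-recip p')) := by gcongr
    _ = ENNReal.ofReal (ε ^ K * ε * (μ * μ ^ (-recip p'))) := by
        rw [← ENNReal.ofReal_mul (by positivity), mul_assoc]
    _ ≤ ENNReal.ofReal (ε ^ K * ε) :=
        ENNReal.ofReal_le_ofReal (mul_le_of_le_one_right (by positivity) hμθ)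
    _ < ENNReal.ofReal (‖x‖ ^ k' * ‖f x‖) := by
        have hxk := Real.rpow_pos_of_pos hx0 k'
        refine (ENNReal.ofReal_lt_ofReal_iff (mul_pos hxk (hε0.trans hx1))).2 ?_
        exact mul_lt_mul' hw hx1 hε0.le hxk

theorem sharpDecay_of_asymptoticTo [NeZero d] (P : Params d γ α k (recip p)) (hp : 1 ≤ p)
    (hδ : 0 < δ) (huv : AsymptoticTo σ δ k p u v) {B : ℝ} (hB : 0 ≤ B)
    (hm : ∀ t, 0 < t → AEStronglyMeasurable (v t) volume)
    (h : ∀ k' θ', Target d k (recip p) k' θ' →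
      RateBound k' θ' B (σ / 2 - homExp d k' θ') (size v))
    (hv : ∀ c, 0 < c → ∀ t, 0 < t → ∀ᵐ x, (c ^ σ) • v (c ^ 2 * t) (c • x) = v t x)
    (hv0 : ¬ v 1 =ᵐ[volume] 0) : SharpDecay σ k p u := by
  obtain ⟨C, hC, hCuv⟩ := huv
  obtain ⟨m, hm0, hlow⟩ := exists_le_wNorm hv0 (|k| + d)
  obtain ⟨T, hT1, hT⟩ : ∃ T : ℝ, 1 ≤ T ∧ ∀ t, T ≤ t → C * t ^ (-δ) ≤ m / 4 := by
    have := (tendsto_rpow_neg_atTop hδ).const_mul C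
    rw [mul_zero] at this
    obtain ⟨T, hT⟩ := eventually_atTop.1 ((tendsto_order.1 this).2 (m / 4) (by positivity))
    exact ⟨max T 1, le_max_right _ _, fun t ht => (hT t ((le_max_left _ _).trans ht)).le⟩
  refine ⟨max (4 / m) (2 * (C + B)), T, lt_max_of_lt_left (by positivity), by linarith,
    fun t ht k' p' hkp => ?_⟩
  have ht1 : 1 ≤ t := hT1.trans ht
  have ht0 : 0 < t := by linarith
  have hp' : 1 ≤ p' := hp.trans hkp.2.1
  have hTgt := hkp.target hp
  have h1 := (hCuv t ht0 k' p' hkp).1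
  have h2 : wNorm k' p' (v t) ≤ ENNReal.ofReal (B * t ^ (-decayExp d (σ / d) k' p')) := by
    rw [decayExp_eq]
    exact LBound.wNorm_le (hm t ht0) (h k' _ hTgt t ht0)
  set b := decayExp d (σ / d) k' p' with hb
  have htb : 0 < t ^ (-b) := Real.rpow_pos_of_pos ht0 _
  have hsplit : t ^ (-b - δ) = t ^ (-b) * t ^ (-δ) := by
    rw [← Real.rpow_add ht0, sub_eq_add_neg]
  constructor
  · have hr : 0 < Real.sqrt t := Real.sqrt_pos.2 ht0
    have h3 : ENNReal.ofReal m ≤ ENNReal.ofReal (t ^ b) * wNorm k' p' (v t) := by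
      refine (hlow k' p' (hTgt.abs_weight_le P) hp').trans ?_
      have e : v 1 =ᵐ[volume] fun x => (t ^ (σ / 2)) • v t (Real.sqrt t • x) := by
        filter_upwards [hv (Real.sqrt t) hr 1 one_pos] with x hx
        rw [← hx, Real.sq_sqrt ht0.le, mul_one, Real.sqrt_eq_rpow, ← Real.rpow_mul ht0.le,
          one_div_mul_eq_div]
      rw [wNorm_congr e]
      refine (wNorm_smul_comp_smul_le (v t) (by positivity) hr).trans (le_of_eq ?_)
      congr 2
      rw [Real.sqrt_eq_rpow, ← Real.rpow_mul ht0.le, ← Real.rpow_add ht0, hb, decayExp_eq, homExp]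
      congr 1
      ring
    have h4 : ENNReal.ofReal (m * t ^ (-b)) ≤ wNorm k' p' (v t) := by
      calc ENNReal.ofReal (m * t ^ (-b)) = ENNReal.ofReal m * ENNReal.ofReal (t ^ (-b)) :=
            ENNReal.ofReal_mul hm0.le
        _ ≤ ENNReal.ofReal (t ^ b) * wNorm k' p' (v t) * ENNReal.ofReal (t ^ (-b)) := by gcongr
        _ = ENNReal.ofReal (t ^ b * t ^ (-b)) * wNorm k' p' (v t) := by
            rw [ENNReal.ofReal_mul (by positivity)]; ring
        _ = wNorm k' p' (v t) := by
            rw [← Real.rpow_add ht0, add_neg_cancel, Real.rpow_zero, ENNReal.ofReal_one, one_mul]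
    have h5 : wNorm k' p' (v t) ≤ 2 * (wNorm k' p' (u t) + ENNReal.ofReal (m / 4 * t ^ (-b))) := by
      have e : v t = fun x => u t x + (-1 : ℝ) • (u t x - v t x) := by
        funext x
        simp
      have hneg : wNorm k' p' (fun x => (-1 : ℝ) • (u t x - v t x)) =
          wNorm k' p' (fun x => u t x - v t x) := by
        refine eq_of_forall_ge_iff fun A => ?_
        rw [wNorm_le_iff, wNorm_le_iff]
        simp only [neg_smul, one_smul, enorm_neg]
      conv_lhs => rw [e]
      refine (wNorm_add_le hp' (u t) _).trans ?_
      rw [hneg]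
      gcongr
      refine h1.trans (ENNReal.ofReal_le_ofReal ?_)
      rw [hsplit]
      calc C * (t ^ (-b) * t ^ (-δ)) = (C * t ^ (-δ)) * t ^ (-b) := by ring
        _ ≤ m / 4 * t ^ (-b) := by gcongr; exact hT t ht
    have h6 : ENNReal.ofReal (m * t ^ (-b)) ≤
        2 * wNorm k' p' (u t) + ENNReal.ofReal (m / 2 * t ^ (-b)) := by
      refine (h4.trans h5).trans (le_of_eq ?_)
      rw [mul_add]
      congr 1
      rw [show (2 : ℝ≥0∞) = ENNReal.ofReal 2 by norm_num, ← ENNReal.ofReal_mul zero_le_two]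
      congr 1
      ring
    have h7 : ENNReal.ofReal (m / 2 * t ^ (-b)) ≤ 2 * wNorm k' p' (u t) := by
      rw [show m * t ^ (-b) = m / 2 * t ^ (-b) + m / 2 * t ^ (-b) by ring,
        ENNReal.ofReal_add (by positivity) (by positivity)] at h6
      exact (ENNReal.add_le_add_iff_right ENNReal.ofReal_ne_top).1 h6
    have h8 : ENNReal.ofReal (m / 4 * t ^ (-b)) ≤ wNorm k' p' (u t) := by
      have : ENNReal.ofReal (m / 2 * t ^ (-b)) = 2 * ENNReal.ofReal (m / 4 * t ^ (-b)) := by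
        rw [show (2 : ℝ≥0∞) = ENNReal.ofReal 2 by norm_num, ← ENNReal.ofReal_mul zero_le_two]
        congr 1
        ring
      rw [this] at h7
      exact (ENNReal.mul_le_mul_iff_right (by norm_num) (by norm_num)).1 h7
    refine (ENNReal.ofReal_le_ofReal ?_).trans h8
    gcongr
    calc (max (4 / m) (2 * (C + B)))⁻¹ ≤ (4 / m)⁻¹ := by
          gcongr
          exact le_max_left _ _
      _ = m / 4 := inv_div _ _
  · have e : u t = fun x => (u t x - v t x) + v t x := by
      funext x
      simp
    rw [e]
    refine (wNorm_add_le hp' _ _).trans ((mul_le_mul_right (add_le_add h1 h2) 2).trans ?_)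
    rw [← ENNReal.ofReal_add (by positivity) (by positivity),
      show (2 : ℝ≥0∞) = ENNReal.ofReal 2 by norm_num, ← ENNReal.ofReal_mul zero_le_two]
    refine ENNReal.ofReal_le_ofReal ?_
    have hδ1 : t ^ (-δ) ≤ 1 := Real.rpow_le_one_of_one_le_of_nonpos ht1 (by linarith)
    calc 2 * (C * t ^ (-b - δ) + B * t ^ (-b)) ≤ 2 * (C * t ^ (-b) + B * t ^ (-b)) := by
          rw [hsplit]
          gcongr
          exact mul_le_of_le_one_right htb.le hδ1
      _ = 2 * (C + B) * t ^ (-b) := by ring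
      _ ≤ _ := by
          gcongr
          exact le_max_right _ _

end Asymptotics

/-! ### Asymptotic behavior of constructed solutions -/

section Main

variable {𝕜 : Type*} [RCLike 𝕜] {d : ℕ} {a γ α k θ cm M : ℝ} {U V : ℝ → Rd d → 𝕜}

theorem RateBound.size_sub {u v : ℝ → Rd d → 𝕜} {A B b : ℝ} (hA : 0 ≤ A) (hB : 0 ≤ B)
    (hm : ∀ t, 0 < t → AEMeasurable (size u t) volume) (hu : RateBound k θ A b (size u))
    (hv : RateBound k θ B b (size v)) : RateBound k θ (A + B) b (size (u - v)) :=
  (hu.add hA hB hm hv).mono (fun _ _ => ae_of_all _ fun _ => enorm_sub_le) le_rfl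

theorem picardLimit_self_bound [NeZero d] (P : Params d γ α k θ) (hcm : α * rate d γ α k θ ≤ cm)
    (hM : 0 ≤ M) (hc : Contracts 𝕜 d a γ α k θ cm M) (hU : StronglyMeasurable (Function.uncurry U))
    (hUM : RateBound k θ (M / 2) (rate d γ α k θ) (size U)) :
    RateBound k θ M (rate d γ α k θ) (size (picardLimit a γ α U)) ∧
      ∀ t, 0 < t → ∀ᵐ x, duhP 0 t (pot γ α (size (picardLimit a γ α U))
        (size (picardLimit a γ α U))) x < ∞ := by
  have h : RateBound k θ M (rate d γ α k θ) (size (picardLimit a γ α U)) := by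
    have := picardLimit_rateBound P hcm hM hc hU hUM (by positivity) P.rate_pos.le
      (by linarith) hUM
    rwa [mul_div_cancel₀ M two_ne_zero] at this
  have hm := TimeMeasurable.of_stronglyMeasurable
    (stronglyMeasurable_picardLimit (a := a) (γ := γ) P.one_lt hU)
  exact ⟨h, (hc _ _ hm hm h h).1⟩

/-- Closeness of the free evolutions carries over to the solutions. -/
theorem nonlinear_asymptotics [NeZero d] (P : Params d γ α k θ) (hcm : α * rate d γ α k θ ≤ cm)
    (hM : 0 ≤ M) (hc : Contracts 𝕜 d a γ α k θ cm M) (hU : FreeEvolution U)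
    (hUM : RateBound k θ (M / 2) (rate d γ α k θ) (size U)) (hV : FreeEvolution V)
    (hVM : RateBound k θ (M / 2) (rate d γ α k θ) (size V)) {A δ : ℝ} (hA : 0 ≤ A) (hδ : 0 ≤ δ)
    (hδc : α * rate d γ α k θ + δ ≤ cm)
    (hUV : RateBound k θ A (rate d γ α k θ + δ) (size (U - V))) :
    ∃ B, 0 ≤ B ∧ ∀ k' θ', Target d k θ k' θ' →
      RateBound k' θ' B (rate d γ α k θ + δ + (homExp d k θ - homExp d k' θ'))
        (size (picardLimit a γ α U - picardLimit a γ α V)) := by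
  have hr := P.rate_pos
  obtain ⟨hu, hufin⟩ := picardLimit_self_bound P hcm hM hc hU.measurable hUM
  obtain ⟨hv, hvfin⟩ := picardLimit_self_bound P hcm hM hc hV.measurable hVM
  have hus := picardLimit_isGlobalSolution P hcm hM hc hU.measurable hUM
  have hvs := picardLimit_isGlobalSolution P hcm hM hc hV.measurable hVM
  have hD := picardLimit_sub_le P hcm hM hc hU.measurable hUM hV.measurable hVM hA
    (b := rate d γ α k θ + δ) (by linarith) (by linarith) hUV
  have hum := hus.timeMeasurable
  have hvm := hvs.timeMeasurable
  have hDm := hum.sub hvm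
  have hw := hu.add hM hM hum.size_slice hv
  exact exists_target_bounds P (g := size (picardLimit a γ α U - picardLimit a γ α V))
    (by positivity) hr.le (by positivity) (by positivity)
    (by have := P.one_lt; positivity) (by rw [sub_self, mul_zero, sub_zero])
    (fun t ht => (hum.size_slice t ht).add (hvm.size_slice t ht)) hDm.size_slice hDm.size_slice
    (fun t ht => (hum.size_joint t ht).add (hvm.size_joint t ht)) hDm.size_joint hw hD
    (fun B hB => ⟨B, hB, fun _ _ _ h => h⟩)
    (hus.size_sub_le P hU (by positivity) hUM hM hu hufin hvs hV (by positivity) hVM hM hv hvfin)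

/-- Solutions whose free evolution decays faster than at the critical rate are asymptotic to their
free evolution. -/
theorem linear_asymptotics [NeZero d] (P : Params d γ α k θ) (hcm : α * rate d γ α k θ ≤ cm)
    (hM : 0 ≤ M) (hc : Contracts 𝕜 d a γ α k θ cm M) (hU : FreeEvolution U)
    (hUM : RateBound k θ (M / 2) (rate d γ α k θ) (size U)) {A₀ A b₀ δ : ℝ} (hA₀ : 0 ≤ A₀)
    (hUA : RateBound k θ A₀ b₀ (size U)) (hb₀ : rate d γ α k θ ≤ b₀)
    (hb₀c : (α - 1) * rate d γ α k θ + b₀ ≤ cm) (hV : FreeEvolution V) {B : ℝ} (hB : 0 ≤ B)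
    (hVB : RateBound k θ B b₀ (size V)) (hA : 0 ≤ A) (hδ : 0 ≤ δ)
    (hUV : RateBound k θ A (b₀ + δ) (size (U - V)))
    (hδ₁ : δ ≤ (α - 1) * (b₀ - rate d γ α k θ)) (hδ₂ : (α - 1) * rate d γ α k θ + b₀ + δ < 1) :
    ∃ B, 0 ≤ B ∧ ∀ k' θ', Target d k θ k' θ' →
      RateBound k' θ' B (b₀ + δ + (homExp d k θ - homExp d k' θ'))
        (size (picardLimit a γ α U - V)) := by
  have hr := P.rate_pos
  have hα := P.sub_one_pos
  have hα0 : 0 < α := by linarith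
  set β := rate d γ α k θ with hβ
  obtain ⟨hu, hufin⟩ := picardLimit_self_bound P hcm hM hc hU.measurable hUM
  have hus := picardLimit_isGlobalSolution P hcm hM hc hU.measurable hUM
  have hu₀ := picardLimit_rateBound P hcm hM hc hU.measurable hUM hA₀ (hr.le.trans hb₀) hb₀c hUA
  set u := picardLimit a γ α U
  have hum := hus.timeMeasurable
  have hDm := hum.sub hV.timeMeasurable
  set b := ((α - 1) * β + b₀ + δ) / α with hb
  have hαb : α * b = (α - 1) * β + b₀ + δ := mul_div_cancel₀ _ hα0.ne'
  have hb1 : β ≤ b := by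
    rw [hb, le_div_iff₀ hα0]
    linarith
  have hb2 : b ≤ b₀ := by
    rw [hb, div_le_iff₀ hα0]
    linarith
  have hb0 : 0 ≤ b := hr.le.trans hb1
  have hub := hu.interpolate hu₀ hb1 hb2 hM
  set G := max M (2 * A₀) with hG
  have hG0 : 0 ≤ G := hM.trans (le_max_left _ _)
  obtain ⟨C, hC, hduh⟩ := exists_duhP_bound P hδ₂
  have hbb : (α - 1) * b + b = (α - 1) * β + b₀ + δ := by linarith
  have hbe : b - (α - 1) * (β - b) = b₀ + δ := by linarith
  have hd := hduh (size u) (size u) G G b b hG0 hG0 (by rw [hbb]; positivity [hr.le.trans hb₀])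
    hbb.le hum.size_slice hum.size_slice hum.size_joint hum.size_joint hub hub
  rw [hbe] at hd
  have hD : RateBound k θ (A + |a| * (C * (G ^ (α - 1) * G))) (b₀ + δ) (size (u - V)) := by
    refine (hUV.add hA (by positivity) (hU.timeMeasurable.sub hV.timeMeasurable).size_slice
      (hd.const_mul (abs_nonneg a))).mono (fun t ht => ?_) le_rfl
    filter_upwards [hus.equation_duh ht] with x hx
    have e : (u - V) t x = (U - V) t x + a • duh γ α u 0 t x := by
      simp only [Pi.sub_apply, hx]
      abel
    rw [size, e]
    refine (enorm_add_le _ _).trans (add_le_add le_rfl ?_)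
    rw [enorm_smul, ← ofReal_norm a, Real.norm_eq_abs]
    gcongr
    exact enorm_duh_le P.one_lt (hum.joint t ht) x
  obtain ⟨B', hB', huT⟩ := hus.exists_target_bounds P hU hA₀ hUA hM hu hufin hG0 hb0 hub
  exact exists_target_bounds P (w := size u) (g := size u) hG0 hb0 (by positivity) hb0
    (abs_nonneg a) hbe hum.size_slice hDm.size_slice hum.size_slice hum.size_joint hum.size_joint
    hub hD (fun _ _ => ⟨B', hB', fun k₁ θ₁ T _ => huT k₁ θ₁ T⟩)
    (hus.size_sub_free_le P hU hA₀ hUA hM hu hufin hV hB hVB)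

/-! ### Exponents and norms of the statement -/

theorem AuxPair.params [NeZero d] {l : ℝ} {p : ℝ≥0∞} (h : AuxPair d γ α l k p)
    (hγ : -min 2 (d : ℝ) < γ) (hα : fujitaExponent d γ < α) (hl : γ / (α - 1) ≤ l) :
    Params d γ α k (recip p) := by
  have hd : (0 : ℝ) < d := by exact_mod_cast Nat.pos_of_ne_zero (NeZero.ne d)
  have hγ2 : 0 < 2 + γ := by linarith [min_le_left 2 (d : ℝ)]
  have h1 : 1 < α := by
    have : 0 < (2 + γ) / d := by positivity
    rw [fujitaExponent] at hα
    linarith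
  have hα1 : 0 < α - 1 := by linarith
  have hα0 : 0 < α := by linarith
  have e : (d : ℝ) / 2 * (k / d + recip p) = homExp d k (recip p) := half_mul_eq_homExp _ _
  have e2 : k / d + recip p = homExp d k (recip p) * 2 / d := by rw [← e]; field_simp
  obtain ⟨hu1, hu2⟩ := lt_min_iff.1 h.upper
  refine ⟨h1, recip_nonneg p, ?_, ?_, ?_, ?_, ?_, ?_⟩
  · rcases eq_or_ne p ∞ with rfl | hp
    · simp [recip]
    · have hlt := (ENNReal.ofReal_lt_iff_lt_toReal hα0.le hp).1 h.lt_p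
      rw [recip, ENNReal.toReal_inv, ← div_eq_mul_inv, div_lt_one (hα0.trans hlt)]
      exact hlt
  · have h2 := h.le_k
    rw [div_le_iff₀ hα0] at h2
    rw [div_le_iff₀ hα1] at hl
    nlinarith
  · rw [← e]
    have := h.nonneg
    positivity
  · rw [lt_div_iff₀ (by positivity), ] at hu2
    rw [← e]
    nlinarith
  · rw [recipCrit, lt_div_iff₀ (by positivity)] at hu1
    rw [← e]
    nlinarith
  · have h3 := h.lower
    rw [div_lt_iff₀ (by positivity)] at h3
    rw [← e]
    have : α * ((2 + γ) / (2 * (α - 1)) - d / 2 * (k / d + recip p)) =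
        (α * (2 + γ) - (k / d + recip p) * (d * α * (α - 1))) / (2 * (α - 1)) := by
      field_simp
    rw [this, div_lt_one (by positivity)]
    linarith

theorem decayExp_recipCrit [NeZero d] (hα : 1 < α) (p : ℝ≥0∞) :
    decayExp d (recipCrit d γ α) k p = rate d γ α k (recip p) := by
  have hd : (d : ℝ) ≠ 0 := by exact_mod_cast NeZero.ne d
  have hα' : α - 1 ≠ 0 := by linarith
  rw [decayExp, recipCrit, rate, homExp]
  field_simp
  ring

theorem auxNorm_le_iff {l A b : ℝ} {q p : ℝ≥0∞}
    (hb : decayExp d (l / d + recip q) k p = b) {u : ℝ → Rd d → 𝕜} :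
    auxNorm l q k p u ≤ ENNReal.ofReal A ↔
      ∀ t, 0 < t → wNorm k p (u t) ≤ ENNReal.ofReal (A * t ^ (-b)) := by
  rw [auxNorm, iSup₂_le_iff, hb]
  refine forall₂_congr fun t ht => ?_
  have h0 : 0 < t ^ b := Real.rpow_pos_of_pos ht b
  rw [Real.rpow_neg ht.le, ← div_eq_mul_inv, ENNReal.ofReal_div_of_pos h0,
    ENNReal.le_div_iff_mul_le (Or.inl (ENNReal.ofReal_pos.2 h0).ne') (Or.inl ENNReal.ofReal_ne_top),
    mul_comm]

theorem RateBound.of_wNorm {p : ℝ≥0∞} (hp : recip p < 1) {A b : ℝ} {u : ℝ → Rd d → 𝕜}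
    (h : ∀ t, 0 < t → wNorm k p (u t) ≤ ENNReal.ofReal (A * t ^ (-b))) :
    RateBound k (recip p) ((weakConst (recip p)).toReal * A) b (size u) := fun t ht => by
  refine (LBound.of_wNorm_le hp (h t ht)).mono (ae_of_all _ fun _ => le_rfl) ?_
  rw [mul_assoc, ENNReal.ofReal_mul ENNReal.toReal_nonneg,
    ENNReal.ofReal_toReal (weakConst_ne_top hp)]

theorem exists_constructedSolution [NeZero d] (𝕜 : Type*) [RCLike 𝕜] {l : ℝ} {q p : ℝ≥0∞}
    (P : Params d γ α k (recip p))
    (hdec : decayExp d (l / d + recip q) k p = rate d γ α k (recip p)) (a : ℝ) (hcm : cm < 1)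
    (hβ : α * rate d γ α k (recip p) ≤ cm) :
    ∃ M, 0 < M ∧ Contracts 𝕜 d a γ α k (recip p) cm M ∧ ∀ U : ℝ → Rd d → 𝕜,
      StronglyMeasurable (Function.uncurry U) →
      RateBound k (recip p) (M / 2) (rate d γ α k (recip p)) (size U) →
      IsConstructedSolution a γ α l q k p M U (picardLimit a γ α U) := by
  obtain ⟨M₀, hM₀, hc⟩ := exists_contracts (𝕜 := 𝕜) P a hcm hβ
  have hθ := P.theta_lt_one
  set W := (weakConst (recip p)).toReal with hW
  have hW1 : 1 ≤ W := by
    rw [hW, ← ENNReal.toReal_one]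
    exact ENNReal.toReal_mono (weakConst_ne_top hθ) (one_le_weakConst _)
  have hW0 : 0 < W := by linarith
  have hMM : M₀ / W ≤ M₀ := div_le_self hM₀.le hW1
  have hM : 0 < M₀ / W := by positivity
  refine ⟨M₀ / W, hM, hc _ hM.le hMM, fun U hU hUM => ?_⟩
  have hu := (picardLimit_self_bound P hβ hM.le (hc _ hM.le hMM) hU hUM).1
  have hus := picardLimit_isGlobalSolution P hβ hM.le (hc _ hM.le hMM) hU hUM
  refine ⟨hus, (auxNorm_le_iff hdec).2 fun t ht =>
    LBound.wNorm_le (hus.measurable_slice t ht) (hu t ht), fun v hv hvM t ht => ?_⟩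
  have hvb := RateBound.of_wNorm hθ ((auxNorm_le_iff hdec).1 hvM)
  rw [mul_div_cancel₀ M₀ hW0.ne'] at hvb
  exact hv.eq_of_rateBound P hβ hM₀.le (hc _ hM₀.le le_rfl) hus hvb
    (hu.mono (fun _ _ => .rfl) hMM) ht

theorem exists_profile_bounds [NeZero d] (𝕜 : Type*) [RCLike 𝕜] (P : Params d γ α k θ) {σ : ℝ}
    (hσ : homExp d k θ ≤ σ / 2) (hσd : σ < d) :
    ∃ C : ℝ, 0 < C ∧ ∀ (ρ : ℝ) (ω : Rd d → 𝕜), 0 ≤ ρ → IsHomogeneousZero ω →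
      eLpNorm ω ⊤ volume ≤ ENNReal.ofReal ρ → FreeEvolution (heatFun (profile ω σ)) ∧
      ∀ k' θ', Target d k θ k' θ' →
        RateBound k' θ' (C * ρ) (σ / 2 - homExp d k' θ') (size (heatFun (profile ω σ))) := by
  obtain ⟨C, hC, h⟩ := exists_heatP_profile_bound 𝕜 P hσ hσd
  refine ⟨C, hC, fun ρ ω hρ hω hωρ => ?_⟩
  have hb := h ρ ω hρ hω.1 hωρ
  have hm := aestronglyMeasurable_profile (σ := σ) hω.1
  refine ⟨.heatFun hm fun t ht => ?_, fun k' θ' T => ?_⟩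
  · exact LBound.ae_lt_top (aemeasurable_heatP hm.enorm t).aemeasurable P.theta_lt_one.le
      ENNReal.ofReal_ne_top (hb k θ P.target_self P.target_self.homExp_le t ht)
  · exact (hb k' θ' T T.homExp_le).mono
      (fun t ht => ae_of_all _ fun x => enorm_heatFun_le _ ht x) le_rfl

theorem heatFun_profile_scale {ω : Rd d → 𝕜} (hω : IsHomogeneousZero ω) (σ : ℝ) (c : ℝ)
    (hc : 0 < c) (t : ℝ) (ht : 0 < t) (x : Rd d) :
    (c ^ σ) • heatFun (profile ω σ) (c ^ 2 * t) (c • x) = heatFun (profile ω σ) t x :=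
  heatFun_scale hc ht (profile_smul_ae hω hc) x

theorem ae_eq_zero_of_heatFun_profile [NeZero d] {ω : Rd d → 𝕜} {σ ρ : ℝ}
    (hω : IsHomogeneousZero ω) (hωρ : eLpNorm ω ⊤ volume ≤ ENNReal.ofReal ρ) (hσ : 0 ≤ σ)
    (hσd : σ < d) (h : ∀ t, 0 < t → heatFun (profile ω σ) t =ᵐ[volume] 0) : ω =ᵐ[volume] 0 :=
  ae_eq_zero_of_profile (ae_eq_zero_of_heatFun (integrable_profile hω.1 hωρ hσ hσd) h)

theorem DecayCondition.rateBound [NeZero d] {σ C δ : ℝ} {p : ℝ≥0∞} (hp : recip p < 1)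
    {φ : 𝓢(Rd d, 𝕜) →L[𝕜] 𝕜} {ω : Rd d → 𝕜} (h : DecayCondition σ k p φ ω C δ) :
    RateBound k (recip p) ((weakConst (recip p)).toReal * C) (σ / 2 - homExp d k (recip p))
      (size (heatDist φ)) ∧
    RateBound k (recip p) ((weakConst (recip p)).toReal * C) (σ / 2 - homExp d k (recip p) + δ)
      (size (heatDist φ - heatFun (profile ω σ))) := by
  refine ⟨.of_wNorm hp fun t ht => ?_, .of_wNorm hp fun t ht => ?_⟩
  · rw [← decayExp_eq]
    exact (h t ht).1
  · rw [← decayExp_eq, neg_add']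
    exact (h t ht).2

end Main

theorem theorem1p5 {𝕜 : Type*} [RCLike 𝕜] (d : ℕ) (hd : 1 ≤ d) (a γ α : ℝ)
    (hγ : -min 2 (d : ℝ) < γ) (hα : fujitaExponent d γ < α)
    (l : ℝ) (q : ℝ≥0∞) (hq : 1 ≤ q) (hcrit : l / d + recip q = recipCrit d γ α)
    (hl : γ / (α - 1) ≤ l)
    (k : ℝ) (p : ℝ≥0∞) (hkp : AuxPair d γ α l k p)
    (σ : ℝ) (hσ : (2 + γ) / (α - 1) ≤ σ) (hσd : σ < d) :
    -- nonlinear behavior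
    (σ = (2 + γ) / (α - 1) →
      ∀ δ₀ : ℝ, 0 < δ₀ → α * decayExp d (recipCrit d γ α) k p + δ₀ < 1 →
      ∃ ρ M : ℝ, 0 < ρ ∧ 0 < M ∧
        ∀ (φ : 𝓢(Rd d, 𝕜) →L[𝕜] 𝕜) (ω : Rd d → 𝕜),
          auxNorm l q k p (heatDist φ) ≤ ENNReal.ofReal ρ →
          IsHomogeneousZero ω → eLpNorm ω ⊤ volume ≤ ENNReal.ofReal ρ →
          ∃ u uS : ℝ → Rd d → 𝕜,
            IsConstructedSolution a γ α l q k p M (heatDist φ) u ∧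
            IsConstructedSolution a γ α l q k p M (heatFun (profile ω σ)) uS ∧
            IsSelfSimilar γ α uS ∧
            ∀ C δ : ℝ, 0 < C → 0 < δ → DecayCondition σ k p φ ω C δ →
              (∀ δ' : ℝ, 0 < δ' → δ' ≤ δ → δ' ≤ δ₀ → AsymptoticTo σ δ' k p u uS) ∧
              (¬ ω =ᵐ[volume] 0 → SharpDecay σ k p u)) ∧
    -- linear behavior
    ((2 + γ) / (α - 1) < σ → (σ + γ) / (d * α) < k / d + recip p →
      ∃ ρ M : ℝ, 0 < ρ ∧ 0 < M ∧
        ∀ (φ : 𝓢(Rd d, 𝕜) →L[𝕜] 𝕜) (ω : Rd d → 𝕜),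
          auxNorm l q k p (heatDist φ) ≤ ENNReal.ofReal ρ →
          IsHomogeneousZero ω → eLpNorm ω ⊤ volume ≤ ENNReal.ofReal ρ →
          ∃ u : ℝ → Rd d → 𝕜,
            IsConstructedSolution a γ α l q k p M (heatDist φ) u ∧
            ∀ C δ : ℝ, 0 < C → 0 < δ → DecayCondition σ k p φ ω C δ →
              (∀ δ' : ℝ, 0 < δ' → δ' ≤ δ →
                δ' ≤ (α - 1) / 2 * (σ - (2 + γ) / (α - 1)) →
                δ' < (d * α * (k / d + recip p) - (σ + γ)) / 2 →
                AsymptoticTo σ δ' k p u (heatFun (profile ω σ))) ∧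
              (¬ ω =ᵐ[volume] 0 → SharpDecay σ k p u)) := by
  have : NeZero d := ⟨by omega⟩
  have P := hkp.params hγ hα hl
  have hα1 := P.one_lt
  have hαp := P.sub_one_pos
  have hr := P.rate_pos
  have hθ := P.theta_lt_one
  have hp := hkp.one_le
  have hdec : decayExp d (l / d + recip q) k p = rate d γ α k (recip p) := by
    rw [hcrit, decayExp_recipCrit hα1]
  have hγ2 : 0 < 2 + γ := by linarith [min_le_left 2 (d : ℝ)]
  have hσ0 : 0 ≤ σ := le_trans (by positivity) hσ
  have hσr : (2 + γ) / (2 * (α - 1)) = (2 + γ) / (α - 1) / 2 := by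
    rw [div_div, mul_comm]
  have hβ : rate d γ α k (recip p) = (2 + γ) / (α - 1) / 2 - homExp d k (recip p) := by
    rw [rate, hσr]
  have hσh : homExp d k (recip p) ≤ σ / 2 := by linarith
  set β := rate d γ α k (recip p) with hβd
  set h := homExp d k (recip p) with hh
  set W := (weakConst (recip p)).toReal with hWd
  have hW : 0 < W := ENNReal.toReal_pos
    (zero_lt_one.trans_le (one_le_weakConst _)).ne' (weakConst_ne_top hθ)
  obtain ⟨K, hK, hprof⟩ := exists_profile_bounds 𝕜 P hσh hσd
  refine ⟨fun hσe δ₀ hδ₀ hδ₀c => ?_, fun hσlt hσk => ?_⟩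
  · rw [decayExp_recipCrit hα1, ← hβd] at hδ₀c
    have hβe : σ / 2 - h = β := by rw [hβ, hσe]
    obtain ⟨M, hM, hc, hcons⟩ := exists_constructedSolution (cm := α * β + δ₀) 𝕜 (l := l) (q := q)
      P hdec a hδ₀c (by linarith)
    have hcm : α * β ≤ α * β + δ₀ := by linarith
    refine ⟨min (M / 2 / W) (M / 2 / K), M, by positivity, hM, fun φ ω hφ hω hωρ => ?_⟩
    set ρ := min (M / 2 / W) (M / 2 / K) with hρd
    have hρ : 0 < ρ := by positivity
    have hU := FreeEvolution.heatDist φ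
    have hUM : RateBound k (recip p) (M / 2) β (size (heatDist φ)) := by
      refine (RateBound.of_wNorm hθ ((auxNorm_le_iff hdec).1 hφ)).mono (fun _ _ => .rfl) ?_
      rw [← le_div_iff₀' hW]
      exact min_le_left _ _
    obtain ⟨hV, hVT⟩ := hprof ρ ω hρ.le hω hωρ
    have hVM : RateBound k (recip p) (M / 2) β (size (heatFun (profile ω σ))) := by
      have := hVT k _ P.target_self
      rw [← hh, hβe] at this
      refine this.mono (fun _ _ => .rfl) ?_
      rw [← le_div_iff₀' hK]
      exact min_le_right _ _
    have hscale := heatFun_profile_scale hω σ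
    have hss : IsSelfSimilar γ α (picardLimit a γ α (heatFun (profile ω σ))) :=
      picardLimit_isSelfSimilar P hcm hM.le hc hV.measurable hVM (hσe ▸ hscale)
    have hv : ∀ c, 0 < c → ∀ t, 0 < t → ∀ᵐ x, (c ^ σ) •
        picardLimit a γ α (heatFun (profile ω σ)) (c ^ 2 * t) (c • x) =
          picardLimit a γ α (heatFun (profile ω σ)) t x := by
      rw [hσe] at hss ⊢
      exact hss
    have hus := hcons _ hU.measurable hUM
    have hvs := hcons _ hV.measurable hVM
    refine ⟨picardLimit a γ α (heatDist φ), picardLimit a γ α (heatFun (profile ω σ)),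
      hus, hvs, hss, fun C δ hC hδ hdecay => ?_⟩
    have hasym : ∀ δ' : ℝ, 0 < δ' → δ' ≤ δ → δ' ≤ δ₀ → AsymptoticTo σ δ' k p
        (picardLimit a γ α (heatDist φ)) (picardLimit a γ α (heatFun (profile ω σ))) :=
      fun δ' hδ' hδ'δ hδ'0 => by
        have h1 := (hdecay.rateBound hθ).2
        rw [← hh, hβe] at h1
        have h2 := RateBound.size_sub (by positivity) (by positivity) hU.timeMeasurable.size_slice
          hUM hVM
        have h3 := h2.interpolate h1 (b := β + δ') (by linarith) (by linarith) (by positivity)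
        obtain ⟨B, hB, hBT⟩ := nonlinear_asymptotics P hcm hM.le hc hU hUM hV hVM
          (le_max_of_le_left (by positivity)) hδ'.le (by linarith) h3
        refine asymptoticTo_of_rateBound hp hB (fun t ht => (hus.solution.measurable_slice t ht).sub
          (hvs.solution.measurable_slice t ht)) (fun k' θ' T => ?_) hv
        have := hBT k' θ' T
        rwa [show rate d γ α k (recip p) + δ' + (homExp d k (recip p) - homExp d k' θ') =
          σ / 2 - homExp d k' θ' + δ' by linarith] at this
    refine ⟨hasym, fun hω0 => ?_⟩
    obtain ⟨hvM, hvfin⟩ := picardLimit_self_bound P hcm hM.le hc hV.measurable hVM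
    obtain ⟨B, hB, hBT⟩ := hvs.solution.exists_target_bounds P hV (by positivity) hVM hM.le hvM
      hvfin hM.le hr.le hvM
    refine sharpDecay_of_asymptoticTo P hp (lt_min hδ hδ₀)
      (hasym _ (lt_min hδ hδ₀) (min_le_left _ _) (min_le_right _ _)) hB
      hvs.solution.measurable_slice (fun k' θ' T => ?_) hv fun hz => hω0 ?_
    · have := hBT k' θ' T
      rwa [show β + (homExp d k (recip p) - homExp d k' θ') =
          σ / 2 - homExp d k' θ' by linarith] at this
    · exact ae_eq_zero_of_heatFun_profile hω hωρ hσ0 hσd (hvs.solution.free_eq_zero hss hz)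
  · have hd : (0 : ℝ) < d := by exact_mod_cast hd
    set b₀ := σ / 2 - h with hb₀
    have hβb : β < b₀ := by rw [hβ]; linarith
    have hαβ : (α - 1) * β = 1 + γ / 2 - (α - 1) * h := P.rate_eq
    have hh2 : (d : ℝ) / 2 * (k / d + recip p) = h := half_mul_eq_homExp _ _
    have hcm1 : (α - 1) * β + b₀ < 1 := by
      rw [div_lt_iff₀ (by positivity)] at hσk
      nlinarith
    have hcm2 : α * β < 1 := by
      have := P.lower
      rwa [hβd, rate]
    have hcm : α * β ≤ max (α * β) ((α - 1) * β + b₀) := le_max_left _ _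
    obtain ⟨M, hM, hc, hcons⟩ := exists_constructedSolution
      (cm := max (α * β) ((α - 1) * β + b₀)) 𝕜 (l := l) (q := q) P hdec a (max_lt hcm2 hcm1) hcm
    refine ⟨M / 2 / W, M, by positivity, hM, fun φ ω hφ hω hωρ => ?_⟩
    set ρ := M / 2 / W with hρd
    have hρ : 0 < ρ := by positivity
    have hU := FreeEvolution.heatDist φ
    have hUM : RateBound k (recip p) (M / 2) β (size (heatDist φ)) := by
      refine (RateBound.of_wNorm hθ ((auxNorm_le_iff hdec).1 hφ)).mono (fun _ _ => .rfl) ?_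
      rw [← le_div_iff₀' hW]
    obtain ⟨hV, hVT⟩ := hprof ρ ω hρ.le hω hωρ
    have hv : ∀ c, 0 < c → ∀ t, 0 < t → ∀ᵐ x, (c ^ σ) •
        heatFun (profile ω σ) (c ^ 2 * t) (c • x) = heatFun (profile ω σ) t x :=
      fun c hc t ht => ae_of_all _ (heatFun_profile_scale hω σ c hc t ht)
    have hus := hcons _ hU.measurable hUM
    refine ⟨picardLimit a γ α (heatDist φ), hus, fun C δ hC hδ hdecay => ?_⟩
    obtain ⟨hU₀, hUV⟩ := hdecay.rateBound hθ
    have hV₀ := hVT k _ P.target_self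
    rw [← hh, ← hb₀] at hU₀ hUV hV₀
    have hasym : ∀ δ' : ℝ, 0 < δ' → δ' ≤ δ → δ' ≤ (α - 1) / 2 * (σ - (2 + γ) / (α - 1)) →
        δ' < (d * α * (k / d + recip p) - (σ + γ)) / 2 →
        AsymptoticTo σ δ' k p (picardLimit a γ α (heatDist φ)) (heatFun (profile ω σ)) :=
      fun δ' hδ' hδ'δ hδ'1 hδ'2 => by
        have h2 := RateBound.size_sub (by positivity) (by positivity) hU.timeMeasurable.size_slice
          hU₀ hV₀
        have h3 := h2.interpolate hUV (b := b₀ + δ') (by linarith) (by linarith) (by positivity)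
        obtain ⟨B, hB, hBT⟩ := linear_asymptotics P hcm hM.le hc hU hUM (by positivity) hU₀ hβb.le
          (le_max_right _ _) hV (by positivity) hV₀ (le_max_of_le_left (by positivity)) hδ'.le h3
          (by rw [← hβd, hβ, hb₀]; nlinarith) (by rw [← hβd]; nlinarith)
        refine asymptoticTo_of_rateBound hp hB (fun t ht => (hus.solution.measurable_slice t ht).sub
          (hV.timeMeasurable.slice t ht)) (fun k' θ' T => ?_) hv
        have := hBT k' θ' T
        rwa [show b₀ + δ' + (homExp d k (recip p) - homExp d k' θ') =
          σ / 2 - homExp d k' θ' + δ' by linarith] at this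
    refine ⟨hasym, fun hω0 => ?_⟩
    have h1 : 0 < (α - 1) / 2 * (σ - (2 + γ) / (α - 1)) :=
      mul_pos (by positivity) (sub_pos.2 hσlt)
    have h2 : 0 < (d * α * (k / d + recip p) - (σ + γ)) / 2 := by
      rw [div_lt_iff₀ (by positivity)] at hσk
      linarith
    set δ' := min δ (min ((α - 1) / 2 * (σ - (2 + γ) / (α - 1)))
      ((d * α * (k / d + recip p) - (σ + γ)) / 2 / 2)) with hδ'd
    have hδ' : 0 < δ' := lt_min hδ (lt_min h1 (half_pos h2))
    refine sharpDecay_of_asymptoticTo P hp hδ' (hasym δ' hδ' (min_le_left _ _)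
      ((min_le_right _ _).trans (min_le_left _ _))
      (((min_le_right _ _).trans (min_le_right _ _)).trans_lt (half_lt_self h2)))
      (B := K * ρ) (by positivity)
      hV.timeMeasurable.slice (fun k' θ' T => hVT k' θ' T) hv fun hz => hω0 ?_
    refine ae_eq_zero_of_heatFun_profile hω hωρ hσ0 hσd fun t ht => ?_
    have hr : 0 < Real.sqrt t := Real.sqrt_pos.2 ht
    have h4 := ae_comp_smul (c := (Real.sqrt t)⁻¹)
      ((hv (Real.sqrt t) hr 1 one_pos).and hz) (inv_pos.2 hr)
    filter_upwards [h4] with x ⟨hx, hx0⟩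
    rw [hx0, Real.sq_sqrt ht.le, mul_one, smul_smul, mul_inv_cancel₀ hr.ne', one_smul] at hx
    exact (smul_eq_zero.1 hx).resolve_left (Real.rpow_pos_of_pos hr _).ne'

end
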